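/- Let $R$ be an associative ring with identity, $\mathrm{Mod}R$ the category of left $R$-modules and $\mathrm{D}(R)$ the derived category of unbounded cochain complexes of $R$-modules. Let $\mathsf{A}$ and $\mathsf{B}$ be classes of $R$-modules, each closed under isomorphisms and direct summands. Definitions. (a) $(\mathsf{A},\mathsf{B})$ is a complete hereditary cotorsion pair in $\mathrm{Mod}R$ if $\mathsf{B}=\{M \mid \mathrm{Ext}^1_R(A,M)=0\ \text{for all}\ A\in\mathsf{A}\}$ and $\mathsf{A}=\{N \mid \mathrm{Ext}^1_R(N,B)=0\ \text{for all}\ B\in\mathsf{B}\}$ (cotorsion pair); every module $M$ has exact sequences $0\to B\to A\to M\to 0$ and $0\to M\to B'\to A'\to 0$ with $A,A'\in\mathsf{A}$ and $B,B'\in\mathsf{B}$ (complete); and $\mathsf{A}$ is closed under kernels of epimorphisms between its objects and $\mathsf{B}$ under cokernels of monomorphisms between its objects (hereditary). (b) A complex $P$ is semi-projective if $\mathrm{Hom}_R(P,\beta)$ is a surjective quasi-isomorphism for every surjective quasi-isomorphism $\beta$; a complex $I$ is semi-injective if $\mathrm{Hom}_R(\alpha,I)$ is a surjective quasi-isomorphism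 for every injective quasi-isomorphism $\alpha$. A semi-projective (semi-injective) resolution of $X$ is a quasi-isomorphism $P\to X$ ($X\to I$) with $P$ semi-projective ($I$ semi-injective). Let $\mathcal{A}_{\mathsf{P}}\subseteq\mathrm{D}(R)$ be the class of complexes that have some semi-projective resolution $P$ with $\mathrm{coker}(P^{s-1}\to P^s)\in\mathsf{A}$ for all $s\in\mathbb{Z}$, and $\mathcal{B}_{\mathsf{I}}\subseteq\mathrm{D}(R)$ the class of complexes that have some semi-injective resolution $I$ with $\ker(I^{s}\to I^{s+1})\in\mathsf{B}$ for all $s\in\mathbb{Z}$. (c) Let $\langle\mathsf{P}\rangle_1$ be the class of retracts in $\mathrm{D}(R)$ of coproducts of shifts of projective $R$-modules, and let $\xi$ be the class of cohomologically ghost triangles, i.e. of the exact triangles $X\to Y\to Z\to X[1]$ in $\mathrm{D}(R)$ such that $0\to\mathrm{Hom}(P,X)\to\mathrm{Hom}(P,Y)\to\mathrm{Hom}(P,Z)\to 0$ is exact for all $P\in\langle\mathsf{P}\rangle_1$. An object $P$ is $\xi$-projective if this sequence is exact for all triangles in $\xi$. A $\xi$-projective resolution of $X$ consists of triangles $K_{n+1}\to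 P_n\to K_n\to K_{n+1}[1]$ in $\xi$ $(n\ge 0)$ with all $P_n$ $\xi$-projective and $K_0\cong X$; with the composites $P_{n+1}\to K_{n+1}\to P_n$ as differentials, $\xi xt^n_\xi(X,Y)$ is the $n$-th cohomology of the complex $\mathrm{Hom}_{\mathrm{D}(R)}(P_\bullet,Y)$ (the $n$-th right $\xi$-derived functor of $\mathrm{Hom}_{\mathrm{D}(R)}(-,Y)$; it does not depend on the resolution). (d) A pair $(\mathcal{A},\mathcal{B})$ of classes of objects of $\mathrm{D}(R)$ is a complete hereditary cotorsion pair with respect to $\xi$ if $\mathcal{B}=\{U\mid \xi xt^1_\xi(A,U)=0\ \text{for all}\ A\in\mathcal{A}\}$ and $\mathcal{A}=\{V\mid \xi xt^1_\xi(V,B)=0\ \text{for all}\ B\in\mathcal{B}\}$; for every $X\in\mathrm{D}(R)$ there are triangles $B\to A\to X\to B[1]$ and $X\to B'\to A'\to X[1]$ in $\xi$ with $A,A'\in\mathcal{A}$ and $B,B'\in\mathcal{B}$; and for all triangles $A_1\to A_2\to A_3\to A_1[1]$ and $B_1\to B_2\to B_3\to B_1[1]$ in $\xi$ with $A_2,A_3\in\mathcal{A}$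 and $B_1,B_2\in\mathcal{B}$ one has $A_1\in\mathcal{A}$ and $B_3\in\mathcal{B}$. Theorem. The following are equivalent: (1) $(\mathsf{A},\mathsf{B})$ is a complete hereditary cotorsion pair in $\mathrm{Mod}R$; (2) $(\mathcal{A}_{\mathsf{P}},\mathcal{B}_{\mathsf{I}})$ is a complete hereditary cotorsion pair in $\mathrm{D}(R)$ with respect to $\xi$. -/

import Mathlib

open CategoryTheory Limits Pretriangulated

universe w u

noncomputable section

/-! ### Complete hereditary cotorsion pairs in a module category -/

section ModuleCotorsion

variable {R : Type u} [Ring R]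

/-- `A^⊥ = {M | Ext¹(N, M) = 0 for all N ∈ A}`. -/
def rightPerp (A : ObjectProperty (ModuleCat.{u} R)) : ObjectProperty (ModuleCat.{u} R) :=
  fun M => ∀ N, A N → Subsingleton (Abelian.Ext N M 1)

/-- `^⊥B = {N | Ext¹(N, M) = 0 for all M ∈ B}`. -/
def leftPerp (B : ObjectProperty (ModuleCat.{u} R)) : ObjectProperty (ModuleCat.{u} R) :=
  fun N => ∀ M, B M → Subsingleton (Abelian.Ext N M 1)

/-- `(A, B)` is a complete hereditary cotorsion pair in `Mod R`. -/
structure IsCompleteHereditaryCotorsionPair (A B : ObjectProperty (ModuleCat.{u} R)) : Prop where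
  rightPerp_eq : rightPerp A = B
  leftPerp_eq : leftPerp B = A
  /-- exact sequences `0 ⟶ B ⟶ A ⟶ M ⟶ 0` -/
  enough_left (M : ModuleCat.{u} R) : ∃ (Y X : ModuleCat.{u} R) (i : Y ⟶ X) (p : X ⟶ M)
    (h : i ≫ p = 0), (ShortComplex.mk i p h).ShortExact ∧ A X ∧ B Y
  /-- exact sequences `0 ⟶ M ⟶ B' ⟶ A' ⟶ 0` -/
  enough_right (M : ModuleCat.{u} R) : ∃ (Y X : ModuleCat.{u} R) (i : M ⟶ Y) (p : Y ⟶ X)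
    (h : i ≫ p = 0), (ShortComplex.mk i p h).ShortExact ∧ A X ∧ B Y
  /-- `A` is closed under kernels of epimorphisms -/
  hereditary_left (S : ShortComplex (ModuleCat.{u} R)) :
    S.ShortExact → A S.X₂ → A S.X₃ → A S.X₁
  /-- `B` is closed under cokernels of monomorphisms -/
  hereditary_right (S : ShortComplex (ModuleCat.{u} R)) :
    S.ShortExact → B S.X₁ → B S.X₂ → B S.X₃

end ModuleCotorsion

/-! ### Homological algebra relative to a class `ξ` of triangles -/

section Relative

variable {T : Type*} [Category* T] [Preadditive T] [HasZeroObject T] [HasShift T ℤ]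
  [∀ n : ℤ, (shiftFunctor T n).Additive] [Pretriangulated T]

/-- `0 ⟶ Hom(P, X) ⟶ Hom(P, Y) ⟶ Hom(P, Z) ⟶ 0` is exact for the triangle
`X ⟶ Y ⟶ Z ⟶ X⟦1⟧`. -/
def HomShortExact (P : T) (t : Triangle T) : Prop :=
  Function.Injective (fun f : P ⟶ t.obj₁ => f ≫ t.mor₁) ∧
  Function.Exact (fun f : P ⟶ t.obj₁ => f ≫ t.mor₁) (fun f : P ⟶ t.obj₂ => f ≫ t.mor₂) ∧
  Function.Surjective (fun f : P ⟶ t.obj₂ => f ≫ t.mor₂)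

/-- `ξ(𝒬)`: the exact triangles on which `Hom(P, -)` is short exact for all `P ∈ 𝒬`. -/
def triangleClass (𝒬 : ObjectProperty T) : ObjectProperty (Triangle T) :=
  fun t => t ∈ distTriang T ∧ ∀ P, 𝒬 P → HomShortExact P t

/-- The `ξ`-projective objects. -/
def xiProjective (ξ : ObjectProperty (Triangle T)) : ObjectProperty T :=
  fun P => ∀ t, ξ t → HomShortExact P t

/-- A `ξ`-projective resolution of `X`: triangles `K (n+1) ⟶ P n ⟶ K n ⟶ (K (n+1))⟦1⟧` in `ξ`
with `P n` a `ξ`-projective object, and `K 0 ≅ X`. -/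
structure XiProjectiveResolution (ξ : ObjectProperty (Triangle T)) (X : T) where
  K : ℕ → T
  P : ℕ → T
  ι (n : ℕ) : K (n + 1) ⟶ P n
  π (n : ℕ) : P n ⟶ K n
  ν (n : ℕ) : K n ⟶ (K (n + 1))⟦(1 : ℤ)⟧
  mem (n : ℕ) : ξ (Triangle.mk (ι n) (π n) (ν n))
  projective (n : ℕ) : xiProjective ξ (P n)
  augmentation : K 0 ≅ X

namespace XiProjectiveResolution

variable {ξ : ObjectProperty (Triangle T)} {X : T} (ρ : XiProjectiveResolution ξ X)

/-- The differential `P (n+1) ⟶ K (n+1) ⟶ P n` of the resolution. -/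
def d (n : ℕ) : ρ.P (n + 1) ⟶ ρ.P n := ρ.π (n + 1) ≫ ρ.ι n

/-- The differential `Hom(P n, Y) ⟶ Hom(P (n+1), Y)` of the complex `Hom(P, Y)`. -/
def homD (Y : T) (n : ℕ) : (ρ.P n ⟶ Y) →+ (ρ.P (n + 1) ⟶ Y) :=
  Preadditive.leftComp Y (ρ.d n)

/-- The cohomology in degree `n + 1` of the complex `Hom(P, Y)`, i.e. the group
`ξxt^{n+1}(X, Y)`, the value at `X` of the right `ξ`-derived functor of `Hom(-, Y)`,
computed with the resolution `ρ`. -/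
abbrev XiExtSucc (Y : T) (n : ℕ) : Type _ :=
  (ρ.homD Y (n + 1)).ker ⧸ ((ρ.homD Y n).range.addSubgroupOf (ρ.homD Y (n + 1)).ker)

end XiProjectiveResolution

/-- `ξxt¹(X, Y) = 0`. By the comparison theorem the group does not depend on the
`ξ`-projective resolution of `X` that computes it. -/
def XiExtOneVanishes (ξ : ObjectProperty (Triangle T)) (X Y : T) : Prop :=
  ∃ ρ : XiProjectiveResolution ξ X, Subsingleton (ρ.XiExtSucc Y 0)

/-- `𝒜^{⊥_ξ}` -/
def xiRightPerp (ξ : ObjectProperty (Triangle T)) (𝒜 : ObjectProperty T) : ObjectProperty T :=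
  fun U => ∀ X, 𝒜 X → XiExtOneVanishes ξ X U

/-- `^{⊥_ξ}ℬ` -/
def xiLeftPerp (ξ : ObjectProperty (Triangle T)) (ℬ : ObjectProperty T) : ObjectProperty T :=
  fun V => ∀ Y, ℬ Y → XiExtOneVanishes ξ V Y

/-- `(𝒜, ℬ)` is a complete hereditary cotorsion pair with respect to `ξ`. -/
structure IsXiCompleteHereditaryCotorsionPair (ξ : ObjectProperty (Triangle T))
    (𝒜 ℬ : ObjectProperty T) : Prop where
  rightPerp_eq : xiRightPerp ξ 𝒜 = ℬ
  leftPerp_eq : xiLeftPerp ξ ℬ = 𝒜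
  /-- triangles `B ⟶ A ⟶ X ⟶ B⟦1⟧` in `ξ` -/
  enough_left (X : T) : ∃ (B A : T) (f : B ⟶ A) (g : A ⟶ X) (h : X ⟶ B⟦(1 : ℤ)⟧),
    ξ (Triangle.mk f g h) ∧ 𝒜 A ∧ ℬ B
  /-- triangles `X ⟶ B' ⟶ A' ⟶ X⟦1⟧` in `ξ` -/
  enough_right (X : T) : ∃ (B A : T) (f : X ⟶ B) (g : B ⟶ A) (h : A ⟶ X⟦(1 : ℤ)⟧),
    ξ (Triangle.mk f g h) ∧ 𝒜 A ∧ ℬ B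
  hereditary_left (t : Triangle T) : ξ t → 𝒜 t.obj₂ → 𝒜 t.obj₃ → 𝒜 t.obj₁
  hereditary_right (t : Triangle T) : ξ t → ℬ t.obj₁ → ℬ t.obj₂ → ℬ t.obj₃

end Relative

/-! ### Semi-projective and semi-injective complexes -/

section Semi

open CochainComplex HomComplex

variable {C : Type*} [Category* C] [Preadditive C]

/-- The map of complexes `Hom(P, β) : Hom(P, M) ⟶ Hom(P, N)`. -/
def homComplexPostcomp (P : CochainComplex C ℤ) {M N : CochainComplex C ℤ} (β : M ⟶ N) :
    HomComplex P M ⟶ HomComplex P N where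
  f n := AddCommGrpCat.ofHom
    { toFun := fun z : Cochain P M n => z.comp (Cochain.ofHom β) (add_zero n)
      map_zero' := Cochain.zero_comp _ _
      map_add' := fun _ _ => Cochain.add_comp _ _ _ _ }
  comm' i j _ := by
    ext z
    exact δ_comp_ofHom (z : Cochain P M i) β j

/-- The map of complexes `Hom(α, I) : Hom(N, I) ⟶ Hom(M, I)`. -/
def homComplexPrecomp {M N : CochainComplex C ℤ} (α : M ⟶ N) (I : CochainComplex C ℤ) :
    HomComplex N I ⟶ HomComplex M I where
  f n := AddCommGrpCat.ofHom
    { toFun := fun z : Cochain N I n => (Cochain.ofHom α).comp z (zero_add n)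
      map_zero' := Cochain.comp_zero _ _
      map_add' := fun _ _ => Cochain.comp_add _ _ _ _ }
  comm' i j _ := by
    ext z
    exact δ_ofHom_comp α (z : Cochain N I i) j

/-- A morphism of complexes of abelian groups is a surjective quasi-isomorphism. -/
def IsSurjQuasiIso {K L : CochainComplex AddCommGrpCat ℤ} (φ : K ⟶ L) : Prop :=
  (∀ n, Function.Surjective (φ.f n)) ∧ QuasiIso φ

variable {R : Type u} [Ring R]

/-- `Hom(P, β)` is a surjective quasi-isomorphism for all surjective quasi-isomorphisms `β`. -/
def IsSemiProjective (P : CochainComplex (ModuleCat.{u} R) ℤ) : Prop :=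
  ∀ ⦃M N : CochainComplex (ModuleCat.{u} R) ℤ⦄ (β : M ⟶ N),
    (∀ n, Function.Surjective (β.f n)) → QuasiIso β → IsSurjQuasiIso (homComplexPostcomp P β)

/-- `Hom(α, I)` is a surjective quasi-isomorphism for all injective quasi-isomorphisms `α`. -/
def IsSemiInjective (I : CochainComplex (ModuleCat.{u} R) ℤ) : Prop :=
  ∀ ⦃M N : CochainComplex (ModuleCat.{u} R) ℤ⦄ (α : M ⟶ N),
    (∀ n, Function.Injective (α.f n)) → QuasiIso α → IsSurjQuasiIso (homComplexPrecomp α I)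

end Semi

/-! ### The classes in the derived category -/

section Derived

variable {R : Type u} [Ring R] [HasDerivedCategory.{w} (ModuleCat.{u} R)]

/-- `⟨𝖷⟩₁`: the retracts of coproducts of shifts of modules in `𝖷`. -/
def retractsOfCoproductsOfShifts (X : ObjectProperty (ModuleCat.{u} R)) :
    ObjectProperty (DerivedCategory (ModuleCat.{u} R)) :=
  fun Y => ∃ (J : Type u) (M : J → ModuleCat.{u} R) (n : J → ℤ)
    (c : Cofan (fun j =>
      ((DerivedCategory.singleFunctor (ModuleCat.{u} R) 0).obj (M j))⟦n j⟧)),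
    (∀ j, X (M j)) ∧ Nonempty (IsColimit c) ∧ Nonempty (Retract Y c.pt)

variable (R) in
/-- The class `ξ` of cohomologically ghost triangles in `D(R)`. -/
def ghostTriangles : ObjectProperty (Triangle (DerivedCategory (ModuleCat.{u} R))) :=
  triangleClass (retractsOfCoproductsOfShifts (isProjective (ModuleCat.{u} R)))

/-- `𝒳_P`: the complexes that have a semi-projective resolution `P` with
`coker (P^{s-1} ⟶ P^s)` in `𝖷` for all `s`. -/
def projClass (X : ObjectProperty (ModuleCat.{u} R)) :
    ObjectProperty (DerivedCategory (ModuleCat.{u} R)) :=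
  fun Y => ∃ (K P : CochainComplex (ModuleCat.{u} R) ℤ) (f : P ⟶ K),
    Nonempty (DerivedCategory.Q.obj K ≅ Y) ∧ IsSemiProjective P ∧ QuasiIso f ∧
    ∀ s : ℤ, X (cokernel (P.d (s - 1) s))

/-- `𝒳_I`: the complexes that have a semi-injective resolution `I` with
`ker (I^s ⟶ I^{s+1})` in `𝖷` for all `s`. -/
def injClass (X : ObjectProperty (ModuleCat.{u} R)) :
    ObjectProperty (DerivedCategory (ModuleCat.{u} R)) :=
  fun Y => ∃ (K I : CochainComplex (ModuleCat.{u} R) ℤ) (f : K ⟶ I),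
    Nonempty (DerivedCategory.Q.obj K ≅ Y) ∧ IsSemiInjective I ∧ QuasiIso f ∧
    ∀ s : ℤ, X (kernel (I.d s (s + 1)))

end Derived

end

/-
A distinguished triangle belongs to `ξ` exactly when its connecting morphism is a ghost, that is,
vanishes on homology, and the `ξ`-projectives are the objects out of which all ghosts vanish. Every
object `X` is the third term of such a triangle `K ⟶ P ⟶ X ⟶ K⟦1⟧` in which `P` is a coproduct of
shifts of projective modules, so `ξxt¹(X, Y) = 0` says that every `K ⟶ Y` extends to `P`.

Under (1), `projClass A` and `injClass B` consist of the objects whose homology lies in `A`, resp.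
in `B`, in every degree. Orthogonality amounts to the vanishing of all ghosts from `X` to `Y⟦1⟧`
when `H X` is in `A` and `H Y` in `B`. Such a ghost factors through a ghost into a new object with
homology in `B`, as `Ext¹(Hˢ X, Hˢ Y) = 0`; iterating, it factors through a tower of ghosts, and
these have vanishing homotopy limit because the derived category is generated by injectives under
products. Completeness embeds a complex into one with homology in `B`, degree by degree along its
boundaries, cycles and terms.

Conversely, the two pairs are compared on stalk complexes, whose `ξxt¹` is `Ext¹`, and two-term
complexes `P₁ ⟶ P₀` show that each module of `A` is a homology module of an object of `projClass A`.
-/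

section ZeroDifferential

open HomologicalComplex

variable {C : Type*} [Category* C] [Abelian C] {K L : CochainComplex C ℤ}

lemma nonempty_homotopy_zero_of_injective (hL : ∀ i j, L.d i j = 0) [∀ n, Injective (L.X n)]
    (f : K ⟶ L) (hf : ∀ s, homologyMap f s = 0) : Nonempty (Homotopy f 0) := by
  have hcycles (s : ℤ) : K.iCycles s ≫ f.f s = 0 := by
    have := L.isIso_homologyπ (s - 1) s (by simp) (hL _ _)
    have hzero : cyclesMap f s = 0 := by
      rw [← cancel_mono (L.homologyπ s), ← homologyπ_naturality, hf, comp_zero, zero_comp]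
    rw [← cyclesMap_i, hzero, zero_comp]
  have hext (i j : ℤ) (hij : (ComplexShape.up ℤ).Rel j i) :
      ∃ k : K.X i ⟶ L.X j, K.d j i ≫ k = f.f j := by
    have hex : (ShortComplex.mk (K.iCycles j) (K.d j i) (by simp)).Exact :=
      ShortComplex.exact_of_f_is_kernel _ (K.cyclesIsKernel j i ((ComplexShape.up ℤ).next_eq' hij))
    exact ⟨hex.descToInjective (f.f j) (hcycles j), hex.comp_descToInjective _ _⟩
  choose k hk using hext
  refine ⟨(Homotopy.ofEq ?_).trans (Homotopy.nullHomotopy' k)⟩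
  ext s
  rw [Homotopy.nullHomotopicMap'_f (k₂ := s - 1) (k₀ := s + 1) (by simp) (by simp), hk]
  simp [hL]

lemma nonempty_homotopy_zero_of_projective (hK : ∀ i j, K.d i j = 0) [∀ n, Projective (K.X n)]
    (f : K ⟶ L) (hf : ∀ s, homologyMap f s = 0) : Nonempty (Homotopy f 0) := by
  have hopcycles (s : ℤ) : f.f s ≫ L.pOpcycles s = 0 := by
    have := K.isIso_homologyι s (s + 1) (by simp) (hK _ _)
    have hzero : opcyclesMap f s = 0 := by
      rw [← cancel_epi (K.homologyι s), ← homologyι_naturality, hf, comp_zero, zero_comp]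
    rw [← p_opcyclesMap, hzero, comp_zero]
  have hlift (i j : ℤ) (hij : (ComplexShape.up ℤ).Rel j i) :
      ∃ k : K.X i ⟶ L.X j, k ≫ L.d j i = f.f i := by
    have hex : (ShortComplex.mk (L.d j i) (L.pOpcycles i) (by simp)).Exact :=
      ShortComplex.exact_of_g_is_cokernel _
        (L.opcyclesIsCokernel j i ((ComplexShape.up ℤ).prev_eq' hij))
    exact ⟨hex.liftFromProjective (f.f i) (hopcycles i), hex.liftFromProjective_comp _ _⟩
  choose k hk using hlift
  refine ⟨(Homotopy.ofEq ?_).trans (Homotopy.nullHomotopy' k)⟩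
  ext s
  rw [Homotopy.nullHomotopicMap'_f (k₂ := s - 1) (k₀ := s + 1) (by simp) (by simp), hk]
  simp [hK]

lemma exists_homologyMap_eq_of_injective (hL : ∀ i j, L.d i j = 0) [∀ n, Injective (L.X n)]
    (φ : ∀ s, K.homology s ⟶ L.homology s) : ∃ f : K ⟶ L, ∀ s, homologyMap f s = φ s := by
  have hp (s : ℤ) : IsIso (L.pOpcycles s) := L.isIso_pOpcycles (s - 1) s (by simp) (hL _ _)
  have hI (s : ℤ) : Injective (L.opcycles s) :=
    Injective.of_iso (asIso (L.pOpcycles s)) inferInstance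
  let g (s : ℤ) : K.opcycles s ⟶ L.opcycles s :=
    Injective.factorThru (φ s ≫ L.homologyι s) (K.homologyι s)
  let f : K ⟶ L :=
    { f s := K.pOpcycles s ≫ g s ≫ inv (L.pOpcycles s)
      comm' i j _ := by simp [hL] }
  refine ⟨f, fun s => ?_⟩
  have hg : opcyclesMap f s = g s := by
    rw [← cancel_epi (K.pOpcycles s), p_opcyclesMap]
    simp [f]
  rw [← cancel_mono (L.homologyι s), homologyι_naturality, hg, Injective.comp_factorThru]

lemma exists_homologyMap_eq_of_projective (hK : ∀ i j, K.d i j = 0) [∀ n, Projective (K.X n)]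
    (φ : ∀ s, K.homology s ⟶ L.homology s) : ∃ f : K ⟶ L, ∀ s, homologyMap f s = φ s := by
  have hi (s : ℤ) : IsIso (K.iCycles s) := K.isIso_iCycles s (s + 1) (by simp) (hK _ _)
  have hP (s : ℤ) : Projective (K.cycles s) :=
    Projective.of_iso (asIso (K.iCycles s)).symm inferInstance
  let g (s : ℤ) : K.cycles s ⟶ L.cycles s :=
    Projective.factorThru (K.homologyπ s ≫ φ s) (L.homologyπ s)
  let f : K ⟶ L :=
    { f s := inv (K.iCycles s) ≫ g s ≫ L.iCycles s
      comm' i j _ := by simp [hK] }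
  refine ⟨f, fun s => ?_⟩
  have hg : cyclesMap f s = g s := by
    rw [← cancel_mono (L.iCycles s), cyclesMap_i]
    simp [f]
  rw [← cancel_epi (K.homologyπ s), homologyπ_naturality, hg, Projective.factorThru_comp]

lemma isKInjective_of_injective_of_d_eq_zero (hL : ∀ i j, L.d i j = 0)
    [∀ n, Injective (L.X n)] : L.IsKInjective where
  nonempty_homotopy_zero f hK :=
    nonempty_homotopy_zero_of_injective hL f fun s => (hK s).isZero_homology.eq_of_src _ _

lemma isKProjective_of_projective_of_d_eq_zero (hK : ∀ i j, K.d i j = 0)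
    [∀ n, Projective (K.X n)] : K.IsKProjective where
  nonempty_homotopy_zero f hL :=
    nonempty_homotopy_zero_of_projective hK f fun s => (hL s).isZero_homology.eq_of_tgt _ _

end ZeroDifferential

section Homology

open DerivedCategory
open HomologicalComplex (homologyMap)

variable {C : Type*} [Category* C] [Abelian C] [HasDerivedCategory.{w} C]

lemma exists_Q_map_eq_of_isKProjective (K L : CochainComplex C ℤ) [K.IsKProjective]
    (g : Q.obj K ⟶ Q.obj L) : ∃ f : K ⟶ L, Q.map f = g := by
  obtain ⟨f, hf⟩ := (CochainComplex.IsKProjective.Qh_map_bijective K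
    ((HomotopyCategory.quotient _ _).obj L)).2 g
  obtain ⟨f, rfl⟩ := (HomotopyCategory.quotient _ _).map_surjective f
  exact ⟨f, hf⟩

lemma exists_Q_map_eq_of_isKInjective (K L : CochainComplex C ℤ) [L.IsKInjective]
    (g : Q.obj K ⟶ Q.obj L) : ∃ f : K ⟶ L, Q.map f = g := by
  obtain ⟨f, hf⟩ := (CochainComplex.IsKInjective.Qh_map_bijective
    ((HomotopyCategory.quotient _ _).obj K) L).2 g
  obtain ⟨f, rfl⟩ := (HomotopyCategory.quotient _ _).map_surjective f
  exact ⟨f, hf⟩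

lemma Q_map_eq_zero_of_homotopy {K L : CochainComplex C ℤ} {f : K ⟶ L} (h : Homotopy f 0) :
    Q.map f = 0 := by
  rw [Q_map_eq_of_homotopy C h, Functor.map_zero]

lemma nonempty_homotopy_of_isKProjective {K L : CochainComplex C ℤ} [K.IsKProjective]
    (f : K ⟶ L) (hf : Q.map f = 0) : Nonempty (Homotopy f 0) :=
  ⟨HomotopyCategory.homotopyOfEq _ _ ((CochainComplex.IsKProjective.Qh_map_bijective K
    ((HomotopyCategory.quotient _ _).obj L)).1 (by
      rw [Functor.map_zero, Functor.map_zero]; exact hf))⟩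

lemma nonempty_homotopy_of_isKInjective {K L : CochainComplex C ℤ} [L.IsKInjective]
    (f : K ⟶ L) (hf : Q.map f = 0) : Nonempty (Homotopy f 0) :=
  ⟨HomotopyCategory.homotopyOfEq _ _ ((CochainComplex.IsKInjective.Qh_map_bijective
    ((HomotopyCategory.quotient _ _).obj K) L).1 (by
      rw [Functor.map_zero, Functor.map_zero]; exact hf))⟩

/-- The homology of `Q.obj K` is the homology of `K`. -/
noncomputable def homologyQIso (K : CochainComplex C ℤ) (s : ℤ) :
    (homologyFunctor C s).obj (Q.obj K) ≅ K.homology s :=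
  (homologyFunctorFactors C s).app K

lemma homologyFunctor_map_Q_map {K L : CochainComplex C ℤ} (f : K ⟶ L) (s : ℤ) :
    (homologyFunctor C s).map (Q.map f) =
      (homologyQIso K s).hom ≫ homologyMap f s ≫ (homologyQIso L s).inv := by
  rw [← Category.assoc, Iso.eq_comp_inv]
  exact homologyFunctorFactors_hom_naturality f s

/-- The homology of a complex with zero differential is the complex itself. -/
noncomputable def homologyQIsoOfZero {K : CochainComplex C ℤ} (hK : ∀ i j, K.d i j = 0) (s : ℤ) :
    (homologyFunctor C s).obj (Q.obj K) ≅ K.X s :=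
  have := K.isIso_homologyπ (s - 1) s (by simp) (hK _ _)
  have := K.isIso_iCycles s (s + 1) (by simp) (hK _ _)
  homologyQIso K s ≪≫ (asIso (K.homologyπ s)).symm ≪≫ asIso (K.iCycles s)

variable {X Y Z : DerivedCategory C}

/-- A morphism of the derived category is ghost if it vanishes on homology. -/
def IsGhost (f : X ⟶ Y) : Prop := ∀ s, (homologyFunctor C s).map f = 0

lemma IsGhost.comp_left {g : Y ⟶ Z} (hg : IsGhost g) (f : X ⟶ Y) : IsGhost (f ≫ g) := fun s => by
  rw [Functor.map_comp, hg s, comp_zero]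

lemma IsGhost.comp_right {f : X ⟶ Y} (hf : IsGhost f) (g : Y ⟶ Z) : IsGhost (f ≫ g) := fun s => by
  rw [Functor.map_comp, hf s, zero_comp]

/-- The homology of a shift. -/
noncomputable def homologyShiftIso (Y : DerivedCategory C) (n a b : ℤ) (h : n + a = b) :
    (homologyFunctor C a).obj (Y⟦n⟧) ≅ (homologyFunctor C b).obj Y :=
  ((homologyFunctor C 0).shiftIso n a b h).app Y

lemma homologyShiftIso_hom_naturality (f : X ⟶ Y) (n a b : ℤ) (h : n + a = b) :
    (homologyFunctor C a).map (f⟦n⟧') ≫ (homologyShiftIso Y n a b h).hom =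
      (homologyShiftIso X n a b h).hom ≫ (homologyFunctor C b).map f :=
  ((homologyFunctor C 0).shiftIso n a b h).hom.naturality f

lemma isGhost_shift_iff (f : X ⟶ Y) (n : ℤ) : IsGhost (f⟦n⟧') ↔ IsGhost f := by
  refine ⟨fun hf s => ?_, fun hf s => ?_⟩
  · rw [← cancel_epi (homologyShiftIso X n (s - n) s (by lia)).hom,
      ← homologyShiftIso_hom_naturality, hf, zero_comp, comp_zero]
  · rw [← cancel_mono (homologyShiftIso Y n s (n + s) rfl).hom,
      homologyShiftIso_hom_naturality, hf, zero_comp, comp_zero]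

variable {t : Triangle (DerivedCategory C)}

lemma epi_homology_mor₂_iff_isGhost (ht : t ∈ distTriang _) :
    (∀ s, Epi ((homologyFunctor C s).map t.mor₂)) ↔ IsGhost t.mor₃ := by
  refine forall_congr' fun s => ?_
  rw [HomologySequence.epi_homologyMap_mor₂_iff t ht s (s + 1) (by lia)]
  exact Preadditive.IsIso.comp_right_eq_zero _ _

lemma mono_homology_mor₁_iff_isGhost (ht : t ∈ distTriang _) :
    (∀ s, Mono ((homologyFunctor C s).map t.mor₁)) ↔ IsGhost t.mor₃ := by
  rw [← epi_homology_mor₂_iff_isGhost ht]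
  refine ⟨fun h s => ?_, fun h s => ?_⟩
  · rw [HomologySequence.epi_homologyMap_mor₂_iff t ht s (s + 1) (by lia),
      ← HomologySequence.mono_homologyMap_mor₁_iff t ht s (s + 1) (by lia)]
    exact h _
  · rw [HomologySequence.mono_homologyMap_mor₁_iff t ht (s - 1) s (by lia),
      ← HomologySequence.epi_homologyMap_mor₂_iff t ht (s - 1) s (by lia)]
    exact h _

/-- The short complex `H^s X ⟶ H^s Y ⟶ H^s Z` of a distinguished triangle `X ⟶ Y ⟶ Z ⟶ X⟦1⟧`. -/
noncomputable abbrev homologyShortComplex (ht : t ∈ distTriang _) (s : ℤ) : ShortComplex C :=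
  (shortComplexOfDistTriangle t ht).map (homologyFunctor C s)

lemma homologyShortComplex_shortExact (ht : t ∈ distTriang _) (h : IsGhost t.mor₃) (s : ℤ) :
    (homologyShortComplex ht s).ShortExact where
  exact := HomologySequence.exact₂ t ht s
  mono_f := (mono_homology_mor₁_iff_isGhost ht).2 h s
  epi_g := (epi_homology_mor₂_iff_isGhost ht).2 h s

end Homology

section Formal

open DerivedCategory

variable {C : Type*} [Category* C] [Abelian C]

/-- The complex with terms `M s` and zero differential. -/
def formalComplex (M : ℤ → C) : CochainComplex C ℤ where
  X := M
  d _ _ := 0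

lemma formalComplex_d {M : ℤ → C} (i j : ℤ) : (formalComplex M).d i j = 0 := rfl

variable [HasDerivedCategory.{w} C]

/-- The formal object `∏ M s⟦-s⟧` of the derived category with homology `M`. -/
noncomputable def formalObj (M : ℤ → C) : DerivedCategory C := Q.obj (formalComplex M)

/-- The homology of a formal object. -/
noncomputable def homologyFormalIso (M : ℤ → C) (s : ℤ) :
    (homologyFunctor C s).obj (formalObj M) ≅ M s :=
  homologyQIsoOfZero formalComplex_d s

end Formal

section HomologyFree

open DerivedCategory

variable {C : Type*} [Category* C] [Abelian C] [HasDerivedCategory.{w} C]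

/-- An object out of which the maps are the same as the graded maps out of its homology, and whose
homology is projective. -/
structure IsHomologyFree (P : DerivedCategory C) : Prop where
  projective (s : ℤ) : Projective ((homologyFunctor C s).obj P)
  eq_zero {Y : DerivedCategory C} (f : P ⟶ Y) (hf : IsGhost f) : f = 0
  exists_map {Y : DerivedCategory C}
    (φ : ∀ s, (homologyFunctor C s).obj P ⟶ (homologyFunctor C s).obj Y) :
    ∃ f : P ⟶ Y, ∀ s, (homologyFunctor C s).map f = φ s

/-- An object into which the maps are the same as the graded maps into its homology, and whose
homology is injective. -/
structure IsHomologyCofree (E : DerivedCategory C) : Prop where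
  injective (s : ℤ) : Injective ((homologyFunctor C s).obj E)
  eq_zero {X : DerivedCategory C} (f : X ⟶ E) (hf : IsGhost f) : f = 0
  exists_map {X : DerivedCategory C}
    (φ : ∀ s, (homologyFunctor C s).obj X ⟶ (homologyFunctor C s).obj E) :
    ∃ f : X ⟶ E, ∀ s, (homologyFunctor C s).map f = φ s

lemma homologyMap_eq_zero_of_isGhost {K L : CochainComplex C ℤ} {f : K ⟶ L}
    (hf : IsGhost (Q.map f)) (s : ℤ) : HomologicalComplex.homologyMap f s = 0 := by
  have := hf s
  rwa [homologyFunctor_map_Q_map, Preadditive.IsIso.comp_left_eq_zero,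
    Preadditive.IsIso.comp_right_eq_zero] at this

lemma isHomologyFree_Q {K : CochainComplex C ℤ} (hK : ∀ i j, K.d i j = 0)
    [∀ n, Projective (K.X n)] : IsHomologyFree (Q.obj K) where
  projective s := Projective.of_iso (homologyQIsoOfZero hK s).symm inferInstance
  eq_zero {Y} f hf := by
    have := isKProjective_of_projective_of_d_eq_zero hK
    let e := Q.objObjPreimageIso Y
    obtain ⟨g, hg⟩ := exists_Q_map_eq_of_isKProjective K _ (f ≫ e.inv)
    have hg' : Q.map g = 0 := by
      refine Q_map_eq_zero_of_homotopy (nonempty_homotopy_zero_of_projective hK g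
        (homologyMap_eq_zero_of_isGhost ?_)).some
      rw [hg]
      exact hf.comp_right _
    rwa [hg, Preadditive.IsIso.comp_right_eq_zero] at hg'
  exists_map {Y} φ := by
    let e := Q.objObjPreimageIso Y
    obtain ⟨f, hf⟩ := exists_homologyMap_eq_of_projective hK fun s =>
      (homologyQIso K s).inv ≫ φ s ≫ (homologyFunctor C s).map e.inv ≫ (homologyQIso _ s).hom
    refine ⟨Q.map f ≫ e.hom, fun s => ?_⟩
    rw [Functor.map_comp, homologyFunctor_map_Q_map, hf]
    simp [← Functor.map_comp]

lemma isHomologyCofree_Q {K : CochainComplex C ℤ} (hK : ∀ i j, K.d i j = 0)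
    [∀ n, Injective (K.X n)] : IsHomologyCofree (Q.obj K) where
  injective s := Injective.of_iso (homologyQIsoOfZero hK s).symm inferInstance
  eq_zero {X} f hf := by
    have := isKInjective_of_injective_of_d_eq_zero hK
    let e := Q.objObjPreimageIso X
    obtain ⟨g, hg⟩ := exists_Q_map_eq_of_isKInjective _ K (e.hom ≫ f)
    have hg' : Q.map g = 0 := by
      refine Q_map_eq_zero_of_homotopy (nonempty_homotopy_zero_of_injective hK g
        (homologyMap_eq_zero_of_isGhost ?_)).some
      rw [hg]
      exact hf.comp_left _
    rwa [hg, Preadditive.IsIso.comp_left_eq_zero] at hg'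
  exists_map {X} φ := by
    let e := Q.objObjPreimageIso X
    obtain ⟨f, hf⟩ := exists_homologyMap_eq_of_injective hK fun s =>
      (homologyQIso _ s).inv ≫ (homologyFunctor C s).map e.hom ≫ φ s ≫ (homologyQIso K s).hom
    refine ⟨e.inv ≫ Q.map f, fun s => ?_⟩
    rw [Functor.map_comp, homologyFunctor_map_Q_map, hf]
    simp [← Functor.map_comp_assoc]

lemma isHomologyFree_formalObj (M : ℤ → C) [∀ s, Projective (M s)] :
    IsHomologyFree (formalObj M) :=
  have (s : ℤ) : Projective ((formalComplex M).X s) := inferInstanceAs (Projective (M s))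
  isHomologyFree_Q formalComplex_d

lemma isHomologyCofree_formalObj (M : ℤ → C) [∀ s, Injective (M s)] :
    IsHomologyCofree (formalObj M) :=
  have (s : ℤ) : Injective ((formalComplex M).X s) := inferInstanceAs (Injective (M s))
  isHomologyCofree_Q formalComplex_d

lemma IsHomologyFree.of_retract {P P' : DerivedCategory C} (r : Retract P P')
    (h : IsHomologyFree P') : IsHomologyFree P where
  projective s :=
    have := h.projective s
    (r.map (homologyFunctor C s)).projective
  eq_zero f hf := by
    rw [← Category.id_comp f, ← r.retract, Category.assoc, h.eq_zero _ (hf.comp_left r.r),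
      comp_zero]
  exists_map φ := by
    obtain ⟨f, hf⟩ := h.exists_map fun s => (homologyFunctor C s).map r.r ≫ φ s
    refine ⟨r.i ≫ f, fun s => ?_⟩
    rw [Functor.map_comp, hf, ← Functor.map_comp_assoc, r.retract,
      CategoryTheory.Functor.map_id, Category.id_comp]

lemma IsHomologyCofree.eq_zero_of_shift {E : DerivedCategory C} (hE : IsHomologyCofree E)
    {X : DerivedCategory C} (n : ℤ) (f : X ⟶ E⟦n⟧) (hf : IsGhost f) : f = 0 := by
  have h := hE.eq_zero (f⟦-n⟧' ≫ (shiftShiftNeg E n).hom)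
    (((isGhost_shift_iff f (-n)).2 hf).comp_right _)
  rwa [Preadditive.IsIso.comp_right_eq_zero, Functor.map_eq_zero_iff] at h

lemma exists_projective_formalObj_epi [EnoughProjectives C] (X : DerivedCategory C) :
    ∃ (M : ℤ → C) (p : formalObj M ⟶ X), (∀ s, Projective (M s)) ∧
      ∀ s, Epi ((homologyFunctor C s).map p) := by
  let M (s : ℤ) : C := Projective.over ((homologyFunctor C s).obj X)
  obtain ⟨p, hp⟩ := (isHomologyFree_formalObj M).exists_map fun s =>
    (homologyFormalIso M s).hom ≫ Projective.π ((homologyFunctor C s).obj X)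
  exact ⟨M, p, fun s => inferInstance, fun s => by rw [hp]; infer_instance⟩

lemma exists_injective_formalObj_mono [EnoughInjectives C] (X : DerivedCategory C) :
    ∃ (M : ℤ → C) (i : X ⟶ formalObj M), (∀ s, Injective (M s)) ∧
      ∀ s, Mono ((homologyFunctor C s).map i) := by
  let M (s : ℤ) : C := Injective.under ((homologyFunctor C s).obj X)
  obtain ⟨i, hi⟩ := (isHomologyCofree_formalObj M).exists_map fun s =>
    Injective.ι ((homologyFunctor C s).obj X) ≫ (homologyFormalIso M s).inv
  exact ⟨M, i, fun s => inferInstance, fun s => by rw [hi]; infer_instance⟩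

end HomologyFree

section LocalizationProducts

variable {K D J : Type*} [Category* K] [Category* D] [HasProductsOfShape J K]
  (L : K ⥤ D) (W : MorphismProperty K)

lemma exists_lift_map_piObj [L.IsLocalization W] [W.HasLeftCalculusOfFractions]
    [W.IsStableUnderProductsOfShape J] {F : J → K} {X : K} (f : ∀ j, L.obj X ⟶ L.obj (F j)) :
    ∃ g : L.obj X ⟶ L.obj (∏ᶜ F), ∀ j, g ≫ L.map (Pi.π F j) = f j := by
  choose φ hφ using fun j => Localization.exists_leftFraction L W (f j)
  let s := Limits.Pi.map fun j => (φ j).s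
  have hs : W s := W.limMap _ fun j => (φ j.as).hs
  have := Localization.inverts L W s hs
  refine ⟨L.map (Pi.lift fun j => (φ j).f) ≫ inv (L.map s), fun j => ?_⟩
  have hsj := Localization.inverts L W (φ j).s (φ j).hs
  have hπ : inv (L.map s) ≫ L.map (Pi.π F j) ≫ L.map (φ j).s = L.map (Pi.π _ j) := by
    rw [IsIso.inv_comp_eq, ← L.map_comp, ← L.map_comp, Limits.Pi.map_π]
  rw [hφ j, ← cancel_mono (L.map (φ j).s), MorphismProperty.LeftFraction.map_comp_map_s,
    Category.assoc, Category.assoc, hπ, ← L.map_comp, Pi.lift_π]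

lemma map_piObj_hom_ext [L.IsLocalization W] [W.HasLeftCalculusOfFractions]
    [W.HasRightCalculusOfFractions] [W.IsStableUnderProductsOfShape J] {F : J → K} {X : K}
    (f g : L.obj X ⟶ L.obj (∏ᶜ F))
    (h : ∀ j, f ≫ L.map (Pi.π F j) = g ≫ L.map (Pi.π F j)) : f = g := by
  -- Precomposing with the denominators of two right fractions reduces to morphisms of `K`.
  obtain ⟨φ, rfl⟩ := Localization.exists_rightFraction L W f
  have hs := Localization.inverts L W φ.s φ.hs
  obtain ⟨ψ, hψ⟩ := Localization.exists_rightFraction L W (L.map φ.s ≫ g)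
  have ht := Localization.inverts L W ψ.s ψ.hs
  have hfg (j : J) : L.map ((ψ.s ≫ φ.f) ≫ Pi.π F j) = L.map (ψ.f ≫ Pi.π F j) := by
    have := L.map ψ.s ≫= L.map φ.s ≫= h j
    rw [← Category.assoc (L.map φ.s) g, hψ] at this
    simpa only [MorphismProperty.RightFraction.map_s_comp_map_assoc, ← L.map_comp,
      Category.assoc] using this
  choose Z t ht' hfac using fun j => (MorphismProperty.map_eq_iff_postcomp L W _ _).1 (hfg j)
  have hmap : L.map (ψ.s ≫ φ.f) = L.map ψ.f :=
    (MorphismProperty.map_eq_iff_postcomp L W _ _).2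
      ⟨_, Limits.Pi.map t, W.limMap _ fun j => ht' j.as, by
        ext j
        simpa using hfac j⟩
  rw [← cancel_epi (L.map φ.s), hψ, ← cancel_epi (L.map ψ.s),
    MorphismProperty.RightFraction.map_s_comp_map, MorphismProperty.RightFraction.map_s_comp_map,
    ← hmap, L.map_comp]

lemma preservesProductsOfShape_of_isLocalization [L.IsLocalization W]
    [W.HasLeftCalculusOfFractions] [W.HasRightCalculusOfFractions]
    [W.IsStableUnderProductsOfShape J] : PreservesLimitsOfShape (Discrete J) L := by
  suffices ∀ F : J → K, PreservesLimit (Discrete.functor F) L from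
    ⟨fun {F} => preservesLimit_of_iso_diagram L (Discrete.natIsoFunctor (F := F)).symm⟩
  refine fun F => preservesLimit_of_preserves_limit_cone (productIsProduct F)
    ((isLimitMapConeFanMkEquiv L F _).symm ?_)
  have := Localization.essSurj L W
  choose g hg using fun s : Fan fun j => L.obj (F j) =>
    exists_lift_map_piObj L W fun j => (L.objObjPreimageIso s.pt).hom ≫ s.proj j
  refine Fan.IsLimit.mk _ (fun s => (L.objObjPreimageIso s.pt).inv ≫ g s) (fun s j => ?_)
    fun s m hm => ?_
  · rw [Category.assoc, Iso.inv_comp_eq]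
    exact hg s j
  · rw [Iso.eq_inv_comp]
    refine map_piObj_hom_ext L W _ _ fun j => ?_
    rw [hg, Category.assoc, ← hm]
    rfl

lemma hasProductsOfShape_of_isLocalization [L.IsLocalization W] [W.HasLeftCalculusOfFractions]
    [W.HasRightCalculusOfFractions] [W.IsStableUnderProductsOfShape J] :
    HasProductsOfShape J D := by
  have := Localization.essSurj L W
  have := preservesProductsOfShape_of_isLocalization (J := J) L W
  refine ⟨fun F => ?_⟩
  let G : J → K := fun j => L.objPreimage (F.obj ⟨j⟩)
  let e : Discrete.functor G ⋙ L ≅ F := Discrete.natIso fun j => L.objObjPreimageIso _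
  exact hasLimit_of_iso e

end LocalizationProducts

section HomotopyProducts

variable {C J : Type*} [Category* C] [Abelian C]

/-- Products of complexes are termwise products. -/
noncomputable def isLimitPiX [HasProductsOfShape J C] (K : J → CochainComplex C ℤ) (n : ℤ) :
    IsLimit (Fan.mk ((∏ᶜ K).X n) fun j => (Pi.π K j).f n) :=
  isLimitMapConeFanMkEquiv (HomologicalComplex.eval C (ComplexShape.up ℤ) n) K _
    (isLimitOfPreserves _ (productIsProduct K))

/-- Coproducts of complexes are termwise coproducts. -/
noncomputable def isColimitSigmaX [HasCoproductsOfShape J C] (K : J → CochainComplex C ℤ) (n : ℤ) :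
    IsColimit (Cofan.mk ((∐ K).X n) fun j => (Sigma.ι K j).f n) :=
  isColimitMapCoconeCofanMkEquiv (HomologicalComplex.eval C (ComplexShape.up ℤ) n) K _
    (isColimitOfPreserves _ (coproductIsCoproduct K))

lemma nonempty_homotopy_of_comp_π [HasProductsOfShape J C] {K : J → CochainComplex C ℤ}
    {L : CochainComplex C ℤ} (f g : L ⟶ ∏ᶜ K)
    (h : ∀ j, Homotopy (f ≫ Pi.π K j) (g ≫ Pi.π K j)) : Nonempty (Homotopy f g) := by
  let l (m n : ℤ) : L.X m ⟶ (∏ᶜ K).X n := Fan.IsLimit.lift (isLimitPiX K n) fun j => (h j).hom m n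
  have hl (m n : ℤ) (j : J) : l m n ≫ (Pi.π K j).f n = (h j).hom m n :=
    Fan.IsLimit.fac (isLimitPiX K n) _ j
  refine ⟨{ hom := l, zero m n hmn := ?_, comm n := ?_ }⟩
  · refine Fan.IsLimit.hom_ext (isLimitPiX K n) _ _ fun j => ?_
    simpa only [zero_comp, Fan.mk_π_app, Fan.proj] using (hl m n j).trans ((h j).zero m n hmn)
  · refine Fan.IsLimit.hom_ext (isLimitPiX K n) _ _ fun j => (((h j).comm n).trans ?_)
    simp [dNext_eq _ (show (ComplexShape.up ℤ).Rel n (n + 1) from rfl),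
      prevD_eq _ (show (ComplexShape.up ℤ).Rel (n - 1) n by simp), ← hl]

lemma nonempty_homotopy_of_ι_comp [HasCoproductsOfShape J C] {K : J → CochainComplex C ℤ}
    {L : CochainComplex C ℤ} (f g : ∐ K ⟶ L)
    (h : ∀ j, Homotopy (Sigma.ι K j ≫ f) (Sigma.ι K j ≫ g)) : Nonempty (Homotopy f g) := by
  let l (m n : ℤ) : (∐ K).X m ⟶ L.X n :=
    Cofan.IsColimit.desc (isColimitSigmaX K m) fun j => (h j).hom m n
  have hl (m n : ℤ) (j : J) : (Sigma.ι K j).f m ≫ l m n = (h j).hom m n :=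
    Cofan.IsColimit.fac (isColimitSigmaX K m) _ j
  refine ⟨{ hom := l, zero m n hmn := ?_, comm n := ?_ }⟩
  · refine Cofan.IsColimit.hom_ext (isColimitSigmaX K m) _ _ fun j => ?_
    simpa only [comp_zero, Cofan.mk_ι_app, Cofan.inj] using (hl m n j).trans ((h j).zero m n hmn)
  · refine Cofan.IsColimit.hom_ext (isColimitSigmaX K n) _ _ fun j => (((h j).comm n).trans ?_)
    simp [dNext_eq _ (show (ComplexShape.up ℤ).Rel n (n + 1) from rfl),
      prevD_eq _ (show (ComplexShape.up ℤ).Rel (n - 1) n by simp), ← hl]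

lemma exact_of_isLimit_fan [EnoughProjectives C] {S : ShortComplex C} {T : J → ShortComplex C}
    (p : ∀ j, S ⟶ T j) (h₁ : IsLimit (Fan.mk S.X₁ fun j => (p j).τ₁))
    (h₂ : IsLimit (Fan.mk S.X₂ fun j => (p j).τ₂)) (hT : ∀ j, (T j).Exact) : S.Exact := by
  rw [ShortComplex.exact_iff_exact_up_to_refinements]
  intro A x hx
  let x' : Projective.over A ⟶ S.X₂ := Projective.π A ≫ x
  have hx' (j : J) : (x' ≫ (p j).τ₂) ≫ (T j).g = 0 := by
    rw [Category.assoc, (p j).comm₂₃, ← Category.assoc, Category.assoc _ x, hx, comp_zero,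
      zero_comp]
  let y := Fan.IsLimit.lift h₁ fun j => (hT j).liftFromProjective _ (hx' j)
  have hy (j : J) : y ≫ (p j).τ₁ = (hT j).liftFromProjective _ (hx' j) := Fan.IsLimit.fac h₁ _ j
  refine ⟨_, Projective.π A, inferInstance, y, Fan.IsLimit.hom_ext h₂ _ _ fun j => ?_⟩
  change x' ≫ (p j).τ₂ = (y ≫ S.f) ≫ (p j).τ₂
  rw [Category.assoc y, ← (p j).comm₁₂, ← Category.assoc y, hy,
    ShortComplex.Exact.liftFromProjective_comp]

lemma exact_of_isColimit_cofan [EnoughInjectives C] {S : ShortComplex C} {T : J → ShortComplex C}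
    (i : ∀ j, T j ⟶ S) (h₂ : IsColimit (Cofan.mk S.X₂ fun j => (i j).τ₂))
    (h₃ : IsColimit (Cofan.mk S.X₃ fun j => (i j).τ₃)) (hT : ∀ j, (T j).Exact) : S.Exact := by
  rw [← ShortComplex.exact_op_iff]
  exact exact_of_isLimit_fan (fun j => ShortComplex.opMap (i j)) (Cofan.IsColimit.op h₃)
    (Cofan.IsColimit.op h₂) fun j => (hT j).op

lemma acyclic_piObj [EnoughProjectives C] [HasProductsOfShape J C]
    {K : J → CochainComplex C ℤ} (h : ∀ j, (K j).Acyclic) : (∏ᶜ K).Acyclic := fun n =>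
  exact_of_isLimit_fan
    (fun j => (HomologicalComplex.shortComplexFunctor C _ n).map (Pi.π K j))
    (isLimitPiX K _) (isLimitPiX K _) fun j => h j n

lemma acyclic_sigmaObj [EnoughInjectives C] [HasCoproductsOfShape J C]
    {K : J → CochainComplex C ℤ} (h : ∀ j, (K j).Acyclic) : (∐ K).Acyclic := fun n =>
  exact_of_isColimit_cofan
    (fun j => (HomologicalComplex.shortComplexFunctor C _ n).map (Sigma.ι K j))
    (isColimitSigmaX K _) (isColimitSigmaX K _) fun j => h j n

open HomotopyCategory

/-- The homotopy category inherits products. -/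
noncomputable def isLimitQuotientPi [HasProductsOfShape J C] (K : J → CochainComplex C ℤ) :
    IsLimit (Fan.mk ((quotient C (ComplexShape.up ℤ)).obj (∏ᶜ K))
      fun j => (quotient C (ComplexShape.up ℤ)).map (Pi.π K j)) := by
  choose l hl using fun (L : CochainComplex C ℤ)
      (s : ∀ j, (quotient C _).obj L ⟶ (quotient C _).obj (K j)) (j : J) =>
    (quotient C (ComplexShape.up ℤ)).map_surjective (s j)
  refine Fan.IsLimit.mk _ (fun s => (quotient _ _).map (Pi.lift (l s.pt.as s.proj))) (fun s j => ?_)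
    fun s m hm => ?_
  · exact ((quotient _ _).map_comp _ _).symm.trans ((congrArg _ (Pi.lift_π _ j)).trans (hl _ _ j))
  · obtain ⟨m, rfl⟩ := (quotient _ _).map_surjective (X := s.pt.as) m
    refine eq_of_homotopy _ _ (nonempty_homotopy_of_comp_π _ _ fun j => homotopyOfEq _ _ ?_).some
    exact ((quotient _ _).map_comp _ _).trans ((hm j).trans
      ((hl _ _ j).symm.trans (congrArg _ (Pi.lift_π _ j).symm)))

/-- The homotopy category inherits coproducts. -/
noncomputable def isColimitQuotientSigma [HasCoproductsOfShape J C] (K : J → CochainComplex C ℤ) :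
    IsColimit (Cofan.mk ((quotient C (ComplexShape.up ℤ)).obj (∐ K))
      fun j => (quotient C (ComplexShape.up ℤ)).map (Sigma.ι K j)) := by
  choose l hl using fun (L : CochainComplex C ℤ)
      (s : ∀ j, (quotient C _).obj (K j) ⟶ (quotient C _).obj L) (j : J) =>
    (quotient C (ComplexShape.up ℤ)).map_surjective (s j)
  refine Cofan.IsColimit.mk _ (fun s => (quotient _ _).map (Sigma.desc (l s.pt.as s.inj)))
    (fun s j => ?_) fun s m hm => ?_
  · exact ((quotient _ _).map_comp _ _).symm.trans
      ((congrArg _ (Sigma.ι_desc _ j)).trans (hl _ _ j))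
  · obtain ⟨m, rfl⟩ := (quotient _ _).map_surjective (Y := s.pt.as) m
    refine eq_of_homotopy _ _ (nonempty_homotopy_of_ι_comp _ _ fun j => homotopyOfEq _ _ ?_).some
    exact ((quotient _ _).map_comp _ _).trans ((hm j).trans
      ((hl _ _ j).symm.trans (congrArg _ (Sigma.ι_desc _ j).symm)))

lemma hasProductsOfShape_homotopyCategory [HasProductsOfShape J C] :
    HasProductsOfShape J (HomotopyCategory C (ComplexShape.up ℤ)) where
  has_limit F :=
    have : HasLimit (Discrete.functor (F.obj ∘ Discrete.mk)) :=
      ⟨⟨_, isLimitQuotientPi fun j => (F.obj ⟨j⟩).as⟩⟩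
    hasLimit_of_iso (Discrete.natIsoFunctor (F := F)).symm

lemma hasCoproductsOfShape_homotopyCategory [HasCoproductsOfShape J C] :
    HasCoproductsOfShape J (HomotopyCategory C (ComplexShape.up ℤ)) where
  has_colimit F :=
    have : HasColimit (Discrete.functor (F.obj ∘ Discrete.mk)) :=
      ⟨⟨_, isColimitQuotientSigma fun j => (F.obj ⟨j⟩).as⟩⟩
    hasColimit_of_iso (Discrete.natIsoFunctor (F := F))

lemma isClosedUnderProducts_subcategoryAcyclic [EnoughProjectives C] [HasProductsOfShape J C] :
    (subcategoryAcyclic C).IsClosedUnderLimitsOfShape (Discrete J) where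
  limitsOfShape_le := by
    rintro X ⟨p⟩
    let K (j : J) : CochainComplex C ℤ := (p.diag.obj ⟨j⟩).as
    let e : X ≅ (quotient C (ComplexShape.up ℤ)).obj (∏ᶜ K) :=
      IsLimit.conePointsIsoOfNatIso p.isLimit (isLimitQuotientPi K) Discrete.natIsoFunctor
    rw [(subcategoryAcyclic C).prop_iff_of_iso e, quotient_obj_mem_subcategoryAcyclic_iff_acyclic]
    refine acyclic_piObj fun j => ?_
    rw [← quotient_obj_mem_subcategoryAcyclic_iff_acyclic]
    exact p.prop_diag_obj ⟨j⟩

lemma isClosedUnderCoproducts_subcategoryAcyclic [EnoughInjectives C] [HasCoproductsOfShape J C] :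
    (subcategoryAcyclic C).IsClosedUnderColimitsOfShape (Discrete J) where
  colimitsOfShape_le := by
    rintro X ⟨p⟩
    let K (j : J) : CochainComplex C ℤ := (p.diag.obj ⟨j⟩).as
    let e : X ≅ (quotient C (ComplexShape.up ℤ)).obj (∐ K) :=
      IsColimit.coconePointsIsoOfNatIso p.isColimit (isColimitQuotientSigma K)
        Discrete.natIsoFunctor
    rw [(subcategoryAcyclic C).prop_iff_of_iso e, quotient_obj_mem_subcategoryAcyclic_iff_acyclic]
    refine acyclic_sigmaObj fun j => ?_
    rw [← quotient_obj_mem_subcategoryAcyclic_iff_acyclic]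
    exact p.prop_diag_obj ⟨j⟩

end HomotopyProducts

section DerivedProducts

open Pretriangulated.Opposite HomotopyCategory

lemma trW_isStableUnderProductsOfShape {T J : Type*} [Category* T] [HasZeroObject T] [HasShift T ℤ]
    [Preadditive T] [∀ n : ℤ, (shiftFunctor T n).Additive] [Pretriangulated T]
    (P : ObjectProperty T) [P.IsClosedUnderLimitsOfShape (Discrete J)] [HasProductsOfShape J T] :
    P.trW.IsStableUnderProductsOfShape J :=
  MorphismProperty.IsStableUnderProductsOfShape.mk _ _ fun _ _ _ _ f hf => by
    choose Z g h hd hZ using fun j => (P.trW_iff _).1 (hf j)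
    exact ObjectProperty.trW.mk _ (productTriangle_distinguished _ hd) (P.prop_pi _ hZ)

variable (C : Type*) [Category* C] [Abelian C] (J : Type*)

lemma trW_op_subcategoryAcyclic_isStableUnderProductsOfShape [EnoughInjectives C]
    [HasCoproductsOfShape J C] :
    (subcategoryAcyclic C).op.trW.IsStableUnderProductsOfShape J :=
  have := hasCoproductsOfShape_homotopyCategory (C := C) (J := J)
  have := isClosedUnderCoproducts_subcategoryAcyclic (C := C) (J := J)
  have : (subcategoryAcyclic C).op.IsClosedUnderLimitsOfShape (Discrete J) :=
    ObjectProperty.IsClosedUnderLimitsOfShape.of_equivalence (Discrete.opposite J)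
  trW_isStableUnderProductsOfShape _

variable [HasDerivedCategory.{w} C]

lemma isLocalization_Qh_op :
    (DerivedCategory.Qh (C := C)).op.IsLocalization (subcategoryAcyclic C).op.trW := by
  rw [ObjectProperty.trW_op]
  infer_instance

section

variable [EnoughProjectives C] [HasProductsOfShape J C]

lemma preservesProductsOfShape_Qh :
    PreservesLimitsOfShape (Discrete J) (DerivedCategory.Qh (C := C)) :=
  have := hasProductsOfShape_homotopyCategory (C := C) (J := J)
  have := isClosedUnderProducts_subcategoryAcyclic (C := C) (J := J)
  have := trW_isStableUnderProductsOfShape (J := J) (subcategoryAcyclic C)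
  preservesProductsOfShape_of_isLocalization DerivedCategory.Qh (subcategoryAcyclic C).trW

lemma hasProductsOfShape_derivedCategory : HasProductsOfShape J (DerivedCategory C) :=
  have := hasProductsOfShape_homotopyCategory (C := C) (J := J)
  have := isClosedUnderProducts_subcategoryAcyclic (C := C) (J := J)
  have := trW_isStableUnderProductsOfShape (J := J) (subcategoryAcyclic C)
  hasProductsOfShape_of_isLocalization DerivedCategory.Qh (subcategoryAcyclic C).trW

end

section

variable [EnoughInjectives C] [HasCoproductsOfShape J C]

lemma preservesCoproductsOfShape_Qh :
    PreservesColimitsOfShape (Discrete J) (DerivedCategory.Qh (C := C)) :=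
  have := hasCoproductsOfShape_homotopyCategory (C := C) (J := J)
  have := isLocalization_Qh_op C
  have := trW_op_subcategoryAcyclic_isStableUnderProductsOfShape C J
  have := preservesProductsOfShape_of_isLocalization (J := J) (DerivedCategory.Qh (C := C)).op
    (subcategoryAcyclic C).op.trW
  have : PreservesLimitsOfShape (Discrete J)ᵒᵖ (DerivedCategory.Qh (C := C)).op :=
    preservesLimitsOfShape_of_equiv (Discrete.opposite J).symm _
  preservesColimitsOfShape_of_op _ _

lemma hasCoproductsOfShape_derivedCategory : HasCoproductsOfShape J (DerivedCategory C) :=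
  have := hasCoproductsOfShape_homotopyCategory (C := C) (J := J)
  have := isLocalization_Qh_op C
  have := trW_op_subcategoryAcyclic_isStableUnderProductsOfShape C J
  have : HasProductsOfShape J (DerivedCategory C)ᵒᵖ :=
    hasProductsOfShape_of_isLocalization DerivedCategory.Qh.op (subcategoryAcyclic C).op.trW
  hasCoproductsOfShape_of_opposite J

end

end DerivedProducts

section Towers

lemma trW_of_precomp {T : Type*} [Category* T] [Preadditive T] [HasZeroObject T] [HasShift T ℤ]
    [∀ n : ℤ, (shiftFunctor T n).Additive] [Pretriangulated T] [IsTriangulated T]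
    (P : ObjectProperty T) [P.IsTriangulated] [P.IsClosedUnderIsomorphisms] {X Y Z : T}
    {f : X ⟶ Y} {g : Y ⟶ Z} (hf : P.trW f) (hfg : P.trW (f ≫ g)) : P.trW g := by
  obtain ⟨_, _, _, hf, hPf⟩ := hf
  obtain ⟨_, _, _, hfg, hPfg⟩ := hfg
  obtain ⟨_, _, _, hg⟩ := distinguished_cocone_triangle g
  have hPg := P.ext_of_isTriangulatedClosed₃ _ (Triangulated.someOctahedron rfl hf hg hfg).mem
    hPf hPfg
  exact ObjectProperty.trW.mk P hg hPg

variable {T : Type*} [Category* T] [Preadditive T] [HasProductsOfShape ℕ T]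

/-- The endomorphism of the product of a tower which is the identity minus the shift along the
transition maps; its fibre is the homotopy limit of the tower. -/
noncomputable def oneSubShift {X : ℕ → T} (r : ∀ n, X (n + 1) ⟶ X n) : ∏ᶜ X ⟶ ∏ᶜ X :=
  𝟙 _ - Pi.lift fun n => Pi.π X (n + 1) ≫ r n

lemma oneSubShift_π {X : ℕ → T} (r : ∀ n, X (n + 1) ⟶ X n) (n : ℕ) :
    oneSubShift r ≫ Pi.π X n = Pi.π X n - Pi.π X (n + 1) ≫ r n := by
  rw [oneSubShift, Preadditive.sub_comp, Category.id_comp, Pi.lift_π]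

lemma eq_zero_of_compatible {X : ℕ → T} (r : ∀ n, X (n + 1) ⟶ X n) [IsIso (oneSubShift r)] {Y : T}
    (f : ∀ n, Y ⟶ X n) (hf : ∀ n, f (n + 1) ≫ r n = f n) (n : ℕ) : f n = 0 := by
  have h : Pi.lift f ≫ oneSubShift r = 0 := Pi.hom_ext _ _ fun j => by
    rw [Category.assoc, oneSubShift_π, Preadditive.comp_sub, Pi.lift_π, ← Category.assoc, Pi.lift_π,
      hf, sub_self, zero_comp]
  rw [← Pi.lift_π f n, (Preadditive.IsIso.comp_right_eq_zero _ _).1 h, zero_comp]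

lemma oneSubShift_comp_map {X Y : ℕ → T} (r : ∀ n, X (n + 1) ⟶ X n) (q : ∀ n, Y (n + 1) ⟶ Y n)
    (c : ∀ n, X n ⟶ Y n) (hc : ∀ n, r n ≫ c n = c (n + 1) ≫ q n) :
    oneSubShift r ≫ Limits.Pi.map c = Limits.Pi.map c ≫ oneSubShift q := Pi.hom_ext _ _ fun n => by
  rw [Category.assoc, Pi.map_π, ← Category.assoc, oneSubShift_π, Preadditive.sub_comp,
    Category.assoc, hc, Category.assoc (Limits.Pi.map c), oneSubShift_π, Preadditive.comp_sub,
    Pi.map_π, ← Category.assoc (Limits.Pi.map c), Pi.map_π, Category.assoc]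

variable (X : T)

lemma exists_section_oneSubShift_id :
    ∃ s, s ≫ oneSubShift (fun _ : ℕ => 𝟙 X) = 𝟙 (∏ᶜ fun _ : ℕ => X) := by
  refine ⟨Pi.lift fun n => -∑ i ∈ Finset.range n, Pi.π (fun _ : ℕ => X) i,
    Pi.hom_ext _ _ fun n => ?_⟩
  rw [Category.assoc, oneSubShift_π, Category.comp_id, Preadditive.comp_sub, Pi.lift_π, Pi.lift_π,
    Finset.sum_range_succ, Category.id_comp]
  abel

variable {X} in
lemma π_eq_of_comp_oneSubShift_id {F : T} (ι : F ⟶ ∏ᶜ fun _ : ℕ => X)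
    (hι : ι ≫ oneSubShift (fun _ => 𝟙 X) = 0) (n : ℕ) : ι ≫ Pi.π _ n = ι ≫ Pi.π _ 0 := by
  induction n with
  | zero => rfl
  | succ n ih =>
    have := hι =≫ Pi.π _ n
    rw [Category.assoc, oneSubShift_π, Category.comp_id, Preadditive.comp_sub, zero_comp,
      sub_eq_zero] at this
    rw [← ih, this]

variable [HasZeroObject T] [HasShift T ℤ] [∀ n : ℤ, (shiftFunctor T n).Additive] [Pretriangulated T]

lemma exists_iso_of_fiber_oneSubShift_id {F : T} {ι : F ⟶ ∏ᶜ fun _ : ℕ => X}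
    {h : (∏ᶜ fun _ : ℕ => X) ⟶ F⟦(1 : ℤ)⟧}
    (ht : Triangle.mk ι (oneSubShift fun _ => 𝟙 X) h ∈ distTriang T) : Nonempty (X ≅ F) := by
  obtain ⟨s, hs⟩ := exists_section_oneSubShift_id X
  have : Mono ι := Triangle.mono₁ _ ht <| by
    change h = 0
    rw [← Category.id_comp h, ← hs, Category.assoc]
    exact (congrArg (s ≫ ·) (comp_distTriang_mor_zero₂₃ _ ht)).trans comp_zero
  have hdiag : Pi.lift (fun _ => 𝟙 X) ≫ oneSubShift (fun _ : ℕ => 𝟙 X) = 0 :=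
    Pi.hom_ext _ _ fun n => by
      rw [Category.assoc, oneSubShift_π, Category.comp_id, Preadditive.comp_sub, Pi.lift_π,
        Pi.lift_π, sub_self, zero_comp]
  obtain ⟨u, hu⟩ : ∃ u : X ⟶ F, _ = u ≫ ι := Triangle.coyoneda_exact₂ _ ht _ hdiag
  refine ⟨⟨u, ι ≫ Pi.π _ 0, ?_, ?_⟩⟩
  · rw [← Category.assoc, ← hu, Pi.lift_π]
  · rw [← cancel_mono ι, Category.assoc _ u, ← hu, Category.id_comp]
    refine Pi.hom_ext _ _ fun n => ?_
    rw [Category.assoc _ (Pi.lift _), Pi.lift_π, Category.comp_id]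
    exact (π_eq_of_comp_oneSubShift_id ι (comp_distTriang_mor_zero₁₂ _ ht) n).symm

variable [IsTriangulated T] (P : ObjectProperty T) [P.IsTriangulated] [P.IsClosedUnderIsomorphisms]
  [P.IsClosedUnderLimitsOfShape (Discrete ℕ)]

/-- The composite `X n ⟶ X 0` of the transition maps of a tower. -/
def toBottom {X : ℕ → T} (r : ∀ n, X (n + 1) ⟶ X n) : ∀ n, X n ⟶ X 0
  | 0 => 𝟙 _
  | n + 1 => r n ≫ toBottom r n

lemma prop_of_isIso_oneSubShift {X : ℕ → T} (r : ∀ n, X (n + 1) ⟶ X n) [IsIso (oneSubShift r)]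
    (hr : ∀ n, P.trW (r n)) : P (X 0) := by
  have hc (n : ℕ) : P.trW (toBottom r n) := by
    induction n with
    | zero => exact P.trW.id_mem _
    | succ n ih => exact P.trW.comp_mem _ _ (hr n) ih
  have := trW_isStableUnderProductsOfShape (J := ℕ) P
  have hmap : P.trW (Limits.Pi.map (toBottom r)) := P.trW.limMap _ fun n => hc n.as
  have hcomp := oneSubShift_comp_map (Y := fun _ => X 0) r (fun _ => 𝟙 (X 0)) (toBottom r)
    fun n => (Category.comp_id _).symm
  have hθ : P.trW (oneSubShift (X := fun _ => X 0) fun _ => 𝟙 (X 0)) := by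
    refine trW_of_precomp P hmap ?_
    rw [← hcomp]
    exact P.trW.comp_mem _ _ (P.trW_of_isIso _) hmap
  obtain ⟨F, ι, h, ht, hF⟩ := (P.trW_iff' _).1 hθ
  obtain ⟨e⟩ := exists_iso_of_fiber_oneSubShift_id _ ht
  exact P.prop_of_iso e.symm hF

end Towers

section GhostTowers

open DerivedCategory Opposite
open scoped Pretriangulated.Opposite

variable {C : Type*} [Category* C] [Abelian C] [HasDerivedCategory.{w} C]

lemma isIso_one_sub_of_isGhost {X : DerivedCategory C} {f : X ⟶ X} (hf : IsGhost f) :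
    IsIso (𝟙 X - f) := by
  rw [isIso_iff]
  intro s
  rw [Functor.map_sub, hf s, sub_zero]
  infer_instance

lemma isGhost_of_comp_π [EnoughProjectives C] {J : Type*} {X : J → DerivedCategory C}
    [HasProduct X] {Z : DerivedCategory C} (f : Z ⟶ ∏ᶜ X) (h : ∀ j, IsGhost (f ≫ Pi.π X j)) :
    IsGhost f := fun s => by
  obtain ⟨M, p, hM, hp⟩ := exists_projective_formalObj_epi Z
  have hpf : p ≫ f = 0 := Pi.hom_ext _ _ fun j => by
    rw [Category.assoc, zero_comp]
    exact (isHomologyFree_formalObj M).eq_zero _ ((h j).comp_left p)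
  have := hp s
  rw [← cancel_epi ((homologyFunctor C s).map p), ← Functor.map_comp, hpf, Functor.map_zero,
    comp_zero]

lemma isGhost_unop_of_comp_π [EnoughInjectives C] {J : Type*} {X : J → (DerivedCategory C)ᵒᵖ}
    [HasProduct X] {Z : (DerivedCategory C)ᵒᵖ} (f : Z ⟶ ∏ᶜ X)
    (h : ∀ j, IsGhost (f ≫ Pi.π X j).unop) : IsGhost f.unop := fun s => by
  obtain ⟨M, i, hM, hi⟩ := exists_injective_formalObj_mono Z.unop
  have hif : i.op ≫ f = 0 := Pi.hom_ext _ _ fun j => by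
    rw [Category.assoc, zero_comp]
    exact congrArg Quiver.Hom.op ((isHomologyCofree_formalObj M).eq_zero _ ((h j).comp_right i))
  have := hi s
  rw [← cancel_mono ((homologyFunctor C s).map i), ← Functor.map_comp, zero_comp,
    show f.unop ≫ i = 0 from congrArg Quiver.Hom.unop hif, Functor.map_zero]

lemma isIso_oneSubShift_of_isGhost [EnoughProjectives C] [HasProductsOfShape ℕ (DerivedCategory C)]
    {X : ℕ → DerivedCategory C} (r : ∀ n, X (n + 1) ⟶ X n) (hr : ∀ n, IsGhost (r n)) :
    IsIso (oneSubShift r) :=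
  isIso_one_sub_of_isGhost <| isGhost_of_comp_π _ fun n => by
    rw [Pi.lift_π]
    exact (hr n).comp_left _

lemma isIso_oneSubShift_of_isGhost_unop [EnoughInjectives C]
    [HasProductsOfShape ℕ (DerivedCategory C)ᵒᵖ] {X : ℕ → (DerivedCategory C)ᵒᵖ}
    (r : ∀ n, X (n + 1) ⟶ X n) (hr : ∀ n, IsGhost (r n).unop) : IsIso (oneSubShift r) := by
  rw [← isIso_unop_iff]
  refine isIso_one_sub_of_isGhost (f := (Pi.lift fun n => Pi.π X (n + 1) ≫ r n).unop) <|
    isGhost_unop_of_comp_π _ fun n => ?_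
  rw [Pi.lift_π]
  exact (hr n).comp_right _

/-- The sequence `X, F X, F (F X), …`. Unlike `F^[n] X`, its term at `n + 1` is definitionally `F`
of its term at `n`, so that it can serve as a tower. -/
def iterates {T : Type*} (F : T → T) (X : T) : ℕ → T
  | 0 => X
  | n + 1 => F (iterates F X n)

variable (P : ObjectProperty (DerivedCategory C)) [P.IsTriangulated] [P.IsClosedUnderIsomorphisms]

lemma prop_of_injective_formalObj [EnoughProjectives C] [EnoughInjectives C]
    [HasProductsOfShape ℕ C] [P.IsClosedUnderLimitsOfShape (Discrete ℕ)]
    (hP : ∀ M : ℤ → C, (∀ s, Injective (M s)) → P (formalObj M)) (X : DerivedCategory C) : P X := by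
  have := hasProductsOfShape_derivedCategory C ℕ
  have hstep (X : DerivedCategory C) : ∃ (X' : _) (r : X' ⟶ X), IsGhost r ∧ P.trW r := by
    obtain ⟨M, i, hM, hi⟩ := exists_injective_formalObj_mono X
    obtain ⟨X', r, _, ht⟩ := distinguished_cocone_triangle₁ i
    refine ⟨X', r, fun s => ?_, ObjectProperty.trW.mk P ht (hP M hM)⟩
    have := hi s
    have hri : r ≫ i = 0 := comp_distTriang_mor_zero₁₂ _ ht
    rw [← cancel_mono ((homologyFunctor C s).map i), ← Functor.map_comp, hri, Functor.map_zero,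
      zero_comp]
  choose F r hr hPr using hstep
  have := isIso_oneSubShift_of_isGhost (X := iterates F X) (fun n => r _) fun n => hr _
  exact prop_of_isIso_oneSubShift P (X := iterates F X) (fun n => r _) fun n => hPr _

lemma prop_of_projective_formalObj [EnoughProjectives C] [EnoughInjectives C]
    [HasCoproductsOfShape ℕ C] [P.IsClosedUnderColimitsOfShape (Discrete ℕ)]
    (hP : ∀ M : ℤ → C, (∀ s, Projective (M s)) → P (formalObj M)) (X : DerivedCategory C) :
    P X := by
  have := hasCoproductsOfShape_derivedCategory C ℕ
  have : HasProductsOfShape ℕ (DerivedCategory C)ᵒᵖ := hasProductsOfShape_opposite ℕ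
  have : P.op.IsClosedUnderLimitsOfShape (Discrete ℕ) :=
    ObjectProperty.IsClosedUnderLimitsOfShape.of_equivalence (Discrete.opposite ℕ)
  have hstep (X : (DerivedCategory C)ᵒᵖ) :
      ∃ (X' : _) (r : X' ⟶ X), IsGhost r.unop ∧ P.op.trW r := by
    obtain ⟨M, p, hM, hp⟩ := exists_projective_formalObj_epi X.unop
    obtain ⟨X', r, _, ht⟩ := distinguished_cocone_triangle p
    refine ⟨op X', r.op, fun s => ?_, ?_⟩
    · have := hp s
      have hpr : p ≫ r = 0 := comp_distTriang_mor_zero₁₂ _ ht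
      rw [← cancel_epi ((homologyFunctor C s).map p), Quiver.Hom.unop_op, ← Functor.map_comp, hpr,
        Functor.map_zero, comp_zero]
    · rw [P.trW_op]
      exact (P.trW_iff' _).2 ⟨_, _, _, ht, hP M hM⟩
  choose F r hr hPr using hstep
  have := isIso_oneSubShift_of_isGhost_unop (X := iterates F (op X)) (fun n => r _) fun n => hr _
  exact prop_of_isIso_oneSubShift P.op (X := iterates F (op X)) (fun n => r _) fun n => hPr _

end GhostTowers

section Models

open DerivedCategory HomotopyCategory CochainComplex
open scoped ZeroObject

variable {C : Type*} [Category* C] [Abelian C]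

lemma isKInjective_mappingCone {K L : CochainComplex C ℤ} (f : K ⟶ L) [K.IsKInjective]
    [L.IsKInjective] : (mappingCone f).IsKInjective := by
  rw [isKInjective_iff_rightOrthogonal]
  exact ObjectProperty.ext_of_isTriangulatedClosed₃ _ _ (mappingCone_triangleh_distinguished f)
    (IsKInjective.rightOrthogonal K) (IsKInjective.rightOrthogonal L)

lemma isKProjective_mappingCone {K L : CochainComplex C ℤ} (f : K ⟶ L) [K.IsKProjective]
    [L.IsKProjective] : (mappingCone f).IsKProjective := by
  rw [isKProjective_iff_leftOrthogonal]
  exact ObjectProperty.ext_of_isTriangulatedClosed₃ _ _ (mappingCone_triangleh_distinguished f)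
    (IsKProjective.leftOrthogonal K) (IsKProjective.leftOrthogonal L)

lemma isKInjective_piObj {J : Type*} [HasProductsOfShape J C] (K : J → CochainComplex C ℤ)
    [∀ j, (K j).IsKInjective] : (∏ᶜ K).IsKInjective where
  nonempty_homotopy_zero f hL :=
    nonempty_homotopy_of_comp_π _ _ fun j =>
      (IsKInjective.homotopyZero (f ≫ Pi.π K j) hL).trans (.ofEq zero_comp.symm)

lemma isKProjective_sigmaObj {J : Type*} [HasCoproductsOfShape J C] (K : J → CochainComplex C ℤ)
    [∀ j, (K j).IsKProjective] : (∐ K).IsKProjective where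
  nonempty_homotopy_zero f hL :=
    nonempty_homotopy_of_ι_comp _ _ fun j =>
      (IsKProjective.homotopyZero (Sigma.ι K j ≫ f) hL).trans (.ofEq comp_zero.symm)

variable (C) [HasDerivedCategory.{w} C]

/-- The objects represented by a K-injective complex of injective objects. -/
def hasInjectiveModel : ObjectProperty (DerivedCategory C) := fun X =>
  ∃ K : CochainComplex C ℤ, K.IsKInjective ∧ (∀ n, Injective (K.X n)) ∧ Nonempty (X ≅ Q.obj K)

/-- The objects represented by a K-projective complex of projective objects. -/
def hasProjectiveModel : ObjectProperty (DerivedCategory C) := fun X =>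
  ∃ K : CochainComplex C ℤ, K.IsKProjective ∧ (∀ n, Projective (K.X n)) ∧ Nonempty (X ≅ Q.obj K)

instance : (hasInjectiveModel C).IsClosedUnderIsomorphisms where
  of_iso := by
    rintro _ _ e ⟨K, h, h', ⟨e'⟩⟩
    exact ⟨K, h, h', ⟨e.symm ≪≫ e'⟩⟩

instance : (hasProjectiveModel C).IsClosedUnderIsomorphisms where
  of_iso := by
    rintro _ _ e ⟨K, h, h', ⟨e'⟩⟩
    exact ⟨K, h, h', ⟨e.symm ≪≫ e'⟩⟩

instance : (hasInjectiveModel C).IsStableUnderShift ℤ where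
  isStableUnderShiftBy n := ⟨by
    rintro X ⟨K, h, h', ⟨e⟩⟩
    exact ⟨K⟦n⟧, inferInstance, fun i => h' (i + n),
      ⟨(CategoryTheory.shiftFunctor _ n).mapIso e ≪≫ (Q.commShiftIso n).symm.app K⟩⟩⟩

instance : (hasProjectiveModel C).IsStableUnderShift ℤ where
  isStableUnderShiftBy n := ⟨by
    rintro X ⟨K, h, h', ⟨e⟩⟩
    exact ⟨K⟦n⟧, inferInstance, fun i => h' (i + n),
      ⟨(CategoryTheory.shiftFunctor _ n).mapIso e ≪≫ (Q.commShiftIso n).symm.app K⟩⟩⟩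

variable {C}

lemma hasInjectiveModel_formalObj {M : ℤ → C} (hM : ∀ s, Injective (M s)) :
    hasInjectiveModel C (formalObj M) :=
  have (n : ℤ) : Injective ((formalComplex M).X n) := hM n
  ⟨formalComplex M, isKInjective_of_injective_of_d_eq_zero formalComplex_d, hM, ⟨Iso.refl _⟩⟩

lemma hasProjectiveModel_formalObj {M : ℤ → C} (hM : ∀ s, Projective (M s)) :
    hasProjectiveModel C (formalObj M) :=
  have (n : ℤ) : Projective ((formalComplex M).X n) := hM n
  ⟨formalComplex M, isKProjective_of_projective_of_d_eq_zero formalComplex_d, hM, ⟨Iso.refl _⟩⟩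

variable {t : Triangle (DerivedCategory C)}

lemma exists_iso_mappingCone (ht : t ∈ distTriang _) {K L : CochainComplex C ℤ} {f : K ⟶ L}
    (e : t.obj₁ ≅ Q.obj K) (e' : t.obj₂ ≅ Q.obj L) (hf : Q.map f = e.inv ≫ t.mor₁ ≫ e'.hom) :
    Nonempty (t.obj₃ ≅ Q.obj (mappingCone f)) :=
  ⟨Triangle.π₃.mapIso (isoTriangleOfIso₁₂ _ _ ht (mappingCone_triangle_distinguished f) e e'
    ((Iso.eq_inv_comp e).1 hf).symm)⟩

lemma hasInjectiveModel_cone (ht : t ∈ distTriang _) (h₁ : hasInjectiveModel C t.obj₁)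
    (h₂ : hasInjectiveModel C t.obj₂) : hasInjectiveModel C t.obj₃ := by
  obtain ⟨K, hK, hK', ⟨e⟩⟩ := h₁
  obtain ⟨L, hL, hL', ⟨e'⟩⟩ := h₂
  obtain ⟨f, hf⟩ := exists_Q_map_eq_of_isKInjective K L (e.inv ≫ t.mor₁ ≫ e'.hom)
  exact ⟨_, isKInjective_mappingCone f, fun n => Injective.of_iso
    (HomologicalComplex.homotopyCofiber.XIsoBiprod f n (n + 1) rfl).symm inferInstance,
    exists_iso_mappingCone ht e e' hf⟩

lemma hasProjectiveModel_cone (ht : t ∈ distTriang _) (h₁ : hasProjectiveModel C t.obj₁)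
    (h₂ : hasProjectiveModel C t.obj₂) : hasProjectiveModel C t.obj₃ := by
  obtain ⟨K, hK, hK', ⟨e⟩⟩ := h₁
  obtain ⟨L, hL, hL', ⟨e'⟩⟩ := h₂
  obtain ⟨f, hf⟩ := exists_Q_map_eq_of_isKProjective K L (e.inv ≫ t.mor₁ ≫ e'.hom)
  exact ⟨_, isKProjective_mappingCone f, fun n => Projective.of_iso
    (HomologicalComplex.homotopyCofiber.XIsoBiprod f n (n + 1) rfl).symm inferInstance,
    exists_iso_mappingCone ht e e' hf⟩

lemma isTriangulated_of_cone {T : Type*} [Category* T] [Preadditive T] [HasZeroObject T]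
    [HasShift T ℤ] [∀ n : ℤ, (CategoryTheory.shiftFunctor T n).Additive] [Pretriangulated T]
    (P : ObjectProperty T) [P.IsStableUnderShift ℤ] {X : T} (hX : P X)
    (hP : ∀ t ∈ distTriang T, P t.obj₁ → P t.obj₂ → P t.obj₃) : P.IsTriangulated where
  exists_zero := ⟨_, isZero_zero T, hP _ (contractible_distinguished X) hX hX⟩
  ext₂' _ ht h₁ h₃ :=
    P.le_isoClosure _ (hP _ (inv_rot_of_distTriang _ ht) (P.le_shift (-1) _ h₃) h₁)

instance : (hasInjectiveModel C).IsTriangulated :=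
  isTriangulated_of_cone _ (hasInjectiveModel_formalObj (M := fun _ => 0) fun _ => inferInstance)
    fun _ => hasInjectiveModel_cone

instance : (hasProjectiveModel C).IsTriangulated :=
  isTriangulated_of_cone _ (hasProjectiveModel_formalObj (M := fun _ => 0) fun _ => inferInstance)
    fun _ => hasProjectiveModel_cone

variable {J : Type*}

/-- The derived category inherits products formed termwise. -/
noncomputable def isLimitQPi [EnoughProjectives C] [HasProductsOfShape J C]
    (K : J → CochainComplex C ℤ) : IsLimit (Fan.mk (Q.obj (∏ᶜ K)) fun j => Q.map (Pi.π K j)) :=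
  have := preservesProductsOfShape_Qh C J
  isLimitMapConeFanMkEquiv Qh _ _ (isLimitOfPreserves Qh (isLimitQuotientPi K))

/-- The derived category inherits coproducts formed termwise. -/
noncomputable def isColimitQSigma [EnoughInjectives C] [HasCoproductsOfShape J C]
    (K : J → CochainComplex C ℤ) :
    IsColimit (Cofan.mk (Q.obj (∐ K)) fun j => Q.map (Sigma.ι K j)) :=
  have := preservesCoproductsOfShape_Qh C J
  isColimitMapCoconeCofanMkEquiv Qh _ _ (isColimitOfPreserves Qh (isColimitQuotientSigma K))

lemma isClosedUnderProducts_hasInjectiveModel [EnoughProjectives C] [HasProductsOfShape J C] :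
    (hasInjectiveModel C).IsClosedUnderLimitsOfShape (Discrete J) where
  limitsOfShape_le := by
    rintro X ⟨p⟩
    choose K hK hK' e using fun j : J => p.prop_diag_obj ⟨j⟩
    refine ⟨∏ᶜ K, isKInjective_piObj K, fun n => ?_, ⟨IsLimit.conePointsIsoOfNatIso p.isLimit
      (isLimitQPi K) (Discrete.natIso fun j => (e j.as).some)⟩⟩
    have (j : J) : Injective ((K j).X n) := hK' j n
    exact Injective.of_iso
      ((productIsProduct _).conePointUniqueUpToIso (isLimitPiX K n))
      (inferInstanceAs (Injective (∏ᶜ fun j => (K j).X n)))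

lemma isClosedUnderCoproducts_hasProjectiveModel [EnoughInjectives C] [HasCoproductsOfShape J C] :
    (hasProjectiveModel C).IsClosedUnderColimitsOfShape (Discrete J) where
  colimitsOfShape_le := by
    rintro X ⟨p⟩
    choose K hK hK' e using fun j : J => p.prop_diag_obj ⟨j⟩
    refine ⟨∐ K, isKProjective_sigmaObj K, fun n => ?_, ⟨IsColimit.coconePointsIsoOfNatIso
      p.isColimit (isColimitQSigma K) (Discrete.natIso fun j => (e j.as).some)⟩⟩
    have (j : J) : Projective ((K j).X n) := hK' j n
    exact
      { factors f e _ :=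
          ⟨Cofan.IsColimit.desc (isColimitSigmaX K n) fun j =>
              Projective.factorThru ((Sigma.ι K j).f n ≫ f) e,
            Cofan.IsColimit.hom_ext (isColimitSigmaX K n) _ _ fun j =>
              (Cofan.IsColimit.fac_assoc (isColimitSigmaX K n) _ _ _).trans
                (Projective.factorThru_comp _ _)⟩ }

variable [EnoughProjectives C] [EnoughInjectives C]

lemma hasInjectiveModel_of_enoughInjectives [HasProductsOfShape ℕ C] (X : DerivedCategory C) :
    hasInjectiveModel C X :=
  have := isClosedUnderProducts_hasInjectiveModel (C := C) (J := ℕ)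
  prop_of_injective_formalObj _ (fun _ => hasInjectiveModel_formalObj) X

lemma hasProjectiveModel_of_enoughProjectives [HasCoproductsOfShape ℕ C] (X : DerivedCategory C) :
    hasProjectiveModel C X :=
  have := isClosedUnderCoproducts_hasProjectiveModel (C := C) (J := ℕ)
  prop_of_projective_formalObj _ (fun _ => hasProjectiveModel_formalObj) X

end Models

section SemiProjective

open CochainComplex HomComplex
open HomologicalComplex (homologyMap)

lemma acyclic_iff_exists_d_eq (K : CochainComplex AddCommGrpCat.{w} ℤ) :
    K.Acyclic ↔ ∀ (n : ℤ) (x : K.X n), K.d n (n + 1) x = 0 →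
      ∃ y : K.X (n - 1), K.d (n - 1) n y = x := by
  refine forall_congr' fun n => ?_
  rw [K.exactAt_iff' (n - 1) n (n + 1) (by simp) (by simp), ShortComplex.ab_exact_iff]
  rfl

variable {C : Type*} [Category* C] [Abelian C]

lemma isKProjective_iff_acyclic_homComplex (P : CochainComplex C ℤ) :
    P.IsKProjective ↔ ∀ L : CochainComplex C ℤ, L.Acyclic → (HomComplex P L).Acyclic := by
  refine ⟨fun hP L hL => (acyclic_iff_exists_d_eq _).2 fun n (z : Cochain P L n) hz => ?_,
    fun hP => ⟨fun {L} f hL => ?_⟩⟩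
  · -- a cocycle of degree `n` is a morphism `P⟦-n⟧ ⟶ L`
    obtain ⟨f, hf⟩ := (Cocycle.equivHom ..).surjective
      ((Cocycle.mk z _ rfl hz).leftShift (-n) 0 (by simp))
    obtain ⟨h⟩ := IsKProjective.nonempty_homotopy_zero f hL
    obtain ⟨g, hg⟩ := Cochain.equivHomotopy _ _ h
    have hf' : Cochain.ofHom f = z.leftShift (-n) 0 (by simp) := congrArg Subtype.val hf
    rw [Cochain.ofHom_zero, add_zero, hf'] at hg
    refine ⟨(-n).negOnePow • g.leftUnshift (n - 1) (by lia), ?_⟩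
    change δ (n - 1) n _ = z
    rw [δ_units_smul, Cochain.δ_leftUnshift _ _ _ n 0 (by simp), ← hg,
      Cochain.leftUnshift_leftShift, smul_smul]
    simp
  · obtain ⟨z, hz⟩ := (acyclic_iff_exists_d_eq _).1 (hP L hL) 0 (Cochain.ofHom f) (δ_ofHom f)
    exact ⟨(Cochain.equivHomotopy f 0).symm ⟨z, by simpa using! hz.symm⟩⟩

lemma isKInjective_iff_acyclic_homComplex (I : CochainComplex C ℤ) :
    I.IsKInjective ↔ ∀ K : CochainComplex C ℤ, K.Acyclic → (HomComplex K I).Acyclic := by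
  refine ⟨fun hI K hK => (acyclic_iff_exists_d_eq _).2 fun n z hz => ?_,
    fun hI => ⟨fun {K} f hK => ?_⟩⟩
  · exact IsKInjective.eq_δ_of_cocycle (Cocycle.mk z _ rfl hz) hK (n - 1) (by simp)
  · obtain ⟨z, hz⟩ := (acyclic_iff_exists_d_eq _).1 (hI K hK) 0 (Cochain.ofHom f) (δ_ofHom f)
    exact ⟨(Cochain.equivHomotopy f 0).symm ⟨z, by simpa using! hz.symm⟩⟩

/-- The complex of complexes `Hom(P, X₁) ⟶ Hom(P, X₂) ⟶ Hom(P, X₃)`. -/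
noncomputable def homComplexPostcompShortComplex (P : CochainComplex C ℤ)
    (S : ShortComplex (CochainComplex C ℤ)) : ShortComplex (CochainComplex AddCommGrpCat ℤ) where
  f := homComplexPostcomp P S.f
  g := homComplexPostcomp P S.g
  zero := by
    ext n (z : Cochain P S.X₁ n)
    change (z.comp (Cochain.ofHom S.f) (add_zero n)).comp (Cochain.ofHom S.g) (add_zero n) = 0
    rw [Cochain.comp_assoc_of_second_is_zero_cochain, ← Cochain.ofHom_comp, S.zero]
    simp

lemma homComplexPostcompShortComplex_shortExact (P : CochainComplex C ℤ)
    [∀ n, Projective (P.X n)] {S : ShortComplex (CochainComplex C ℤ)} (hS : S.ShortExact) :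
    (homComplexPostcompShortComplex P S).ShortExact := by
  have hS' (q : ℤ) := hS.map_of_exact (HomologicalComplex.eval C (.up ℤ) q)
  have := fun q => (hS' q).mono_f
  have := fun q => (hS' q).epi_g
  have (q : ℤ) : Mono (S.f.f q) := (hS' q).mono_f
  have (q : ℤ) : Epi (S.g.f q) := (hS' q).epi_g
  refine HomologicalComplex.shortExact_of_degreewise_shortExact _ fun n =>
    { exact := (ShortComplex.ab_exact_iff _).2 fun (z : Cochain P S.X₂ n) hz => ?_
      mono_f := (AddCommGrpCat.mono_iff_injective _).2
        fun (z z' : Cochain P S.X₁ n) h => ?_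
      epi_g := (AddCommGrpCat.epi_iff_surjective _).2 fun (z : Cochain P S.X₃ n) => ?_ }
  · have hz' (p q : ℤ) (h : p + n = q) : z.v p q h ≫ S.g.f q = 0 := by
      simpa using Cochain.congr_v (show z.comp (Cochain.ofHom S.g) (add_zero n) = 0 from hz) p q h
    refine ⟨Cochain.mk fun p q h => (hS' q).exact.lift (z.v p q h) (hz' p q h), ?_⟩
    change Cochain.comp _ (Cochain.ofHom S.f) (add_zero n) = z
    ext p q h
    simpa using! (hS' q).exact.lift_f (z.v p q h) (hz' p q h)
  · refine Cochain.ext _ _ fun p q hpq => ?_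
    rw [← cancel_mono (S.f.f q)]
    simpa using Cochain.congr_v (show z.comp (Cochain.ofHom S.f) (add_zero n) =
      z'.comp (Cochain.ofHom S.f) (add_zero n) from h) p q hpq
  · refine ⟨Cochain.mk fun p q h => Projective.factorThru (z.v p q h) (S.g.f q), ?_⟩
    change Cochain.comp _ (Cochain.ofHom S.g) (add_zero n) = z
    ext p q h : 3
    simp

/-- The complex of complexes `Hom(X₃, I) ⟶ Hom(X₂, I) ⟶ Hom(X₁, I)`. -/
noncomputable def homComplexPrecompShortComplex (S : ShortComplex (CochainComplex C ℤ))
    (I : CochainComplex C ℤ) : ShortComplex (CochainComplex AddCommGrpCat ℤ) where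
  f := homComplexPrecomp S.g I
  g := homComplexPrecomp S.f I
  zero := by
    ext n (z : Cochain S.X₃ I n)
    change (Cochain.ofHom S.f).comp ((Cochain.ofHom S.g).comp z (zero_add n)) (zero_add n) = 0
    rw [← Cochain.comp_assoc_of_first_is_zero_cochain, ← Cochain.ofHom_comp, S.zero]
    simp

lemma homComplexPrecompShortComplex_shortExact {S : ShortComplex (CochainComplex C ℤ)}
    (hS : S.ShortExact) (I : CochainComplex C ℤ) [∀ n, Injective (I.X n)] :
    (homComplexPrecompShortComplex S I).ShortExact := by
  have hS' (q : ℤ) := hS.map_of_exact (HomologicalComplex.eval C (.up ℤ) q)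
  have := fun q => (hS' q).mono_f
  have := fun q => (hS' q).epi_g
  have (q : ℤ) : Mono (S.f.f q) := (hS' q).mono_f
  have (q : ℤ) : Epi (S.g.f q) := (hS' q).epi_g
  refine HomologicalComplex.shortExact_of_degreewise_shortExact _ fun n =>
    { exact := (ShortComplex.ab_exact_iff _).2 fun (z : Cochain S.X₂ I n) hz => ?_
      mono_f := (AddCommGrpCat.mono_iff_injective _).2
        fun (z z' : Cochain S.X₃ I n) h => ?_
      epi_g := (AddCommGrpCat.epi_iff_surjective _).2 fun (z : Cochain S.X₁ I n) => ?_ }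
  · have hz' (p q : ℤ) (h : p + n = q) : S.f.f p ≫ z.v p q h = 0 := by
      simpa using Cochain.congr_v (show (Cochain.ofHom S.f).comp z (zero_add n) = 0 from hz) p q h
    refine ⟨Cochain.mk fun p q h => (hS' p).exact.desc (z.v p q h) (hz' p q h), ?_⟩
    change (Cochain.ofHom S.g).comp _ (zero_add n) = z
    ext p q h
    simpa using! (hS' p).exact.g_desc (z.v p q h) (hz' p q h)
  · refine Cochain.ext _ _ fun p q hpq => ?_
    rw [← cancel_epi (S.g.f p)]
    simpa using Cochain.congr_v (show (Cochain.ofHom S.g).comp z (zero_add n) =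
      (Cochain.ofHom S.g).comp z' (zero_add n) from h) p q hpq
  · refine ⟨Cochain.mk fun p q h => Injective.factorThru (z.v p q h) (S.f.f p), ?_⟩
    change (Cochain.ofHom S.f).comp _ (zero_add n) = z
    ext p q h : 3
    simp

lemma quasiIso_of_acyclic {K L : CochainComplex C ℤ} (f : K ⟶ L) (hK : K.Acyclic)
    (hL : L.Acyclic) : QuasiIso f :=
  (quasiIso_iff f).2 fun n => (quasiIsoAt_iff_exactAt f n (hK n)).2 (hL n)

lemma acyclic_of_quasiIso {K L : CochainComplex C ℤ} (f : K ⟶ L) [QuasiIso f]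
    (hL : L.Acyclic) : K.Acyclic :=
  fun n => (exactAt_iff_of_quasiIsoAt f n).2 (hL n)

lemma quasiIso_g_of_acyclic_X₁ {S : ShortComplex (CochainComplex C ℤ)} (hS : S.ShortExact)
    (h₁ : S.X₁.Acyclic) : QuasiIso S.g := by
  have h₁' (n : ℤ) := (S.X₁.exactAt_iff_isZero_homology n).1 (h₁ n)
  refine (quasiIso_iff _).2 fun n => (quasiIsoAt_iff_isIso_homologyMap _ _).2 ?_
  have : Mono (homologyMap S.g n) :=
    (hS.homology_exact₂ n).mono_g ((h₁' n).eq_of_src _ _)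
  have : Epi (homologyMap S.g n) :=
    (hS.homology_exact₃ n (n + 1) rfl).epi_f ((h₁' (n + 1)).eq_of_tgt _ _)
  exact isIso_of_mono_of_epi _

lemma acyclic_mappingCone_id (K : CochainComplex C ℤ) : (mappingCone (𝟙 K)).Acyclic := by
  intro n
  rw [HomologicalComplex.exactAt_iff_isZero_homology, IsZero.iff_id_eq_zero,
    ← HomologicalComplex.homologyMap_id,
    (mappingCone.homotopyToZeroOfId K).homologyMap_eq n, HomologicalComplex.homologyMap_zero]

/-- The morphism `cone (𝟙 K) ⟶ cone (𝟙 L)` induced by `f`. As a morphism between acyclic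
complexes it tests the terms of semi-projective and semi-injective complexes. -/
noncomputable def coneIdMap {K L : CochainComplex C ℤ} (f : K ⟶ L) :
    mappingCone (𝟙 K) ⟶ mappingCone (𝟙 L) :=
  mappingCone.map (𝟙 K) (𝟙 L) f f (by simp)

variable {K L : CochainComplex C ℤ} (f : K ⟶ L)

lemma quasiIso_coneIdMap : QuasiIso (coneIdMap f) :=
  quasiIso_of_acyclic _ (acyclic_mappingCone_id K) (acyclic_mappingCone_id L)

lemma inr_f_coneIdMap_f (i : ℤ) :
    (mappingCone.inr (𝟙 K)).f i ≫ (coneIdMap f).f i = f.f i ≫ (mappingCone.inr (𝟙 L)).f i := by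
  simp [coneIdMap, mappingCone.map]

lemma coneIdMap_f_fst_v (i j : ℤ) (h : i + 1 = j) :
    (coneIdMap f).f i ≫ (mappingCone.fst (𝟙 L)).1.v i j h =
      (mappingCone.fst (𝟙 K)).1.v i j h ≫ f.f j := by
  simp [mappingCone.ext_from_iff _ j i h, coneIdMap, mappingCone.map]

lemma coneIdMap_f_snd_v (i : ℤ) :
    (coneIdMap f).f i ≫ (mappingCone.snd (𝟙 L)).v i i (add_zero i) =
      (mappingCone.snd (𝟙 K)).v i i (add_zero i) ≫ f.f i := by
  simp [mappingCone.ext_from_iff _ (i + 1) i rfl, coneIdMap, mappingCone.map]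

instance [∀ i, Epi (f.f i)] (i : ℤ) : Epi ((coneIdMap f).f i) where
  left_cancellation u v huv := by
    have h₁ := (mappingCone.inl (𝟙 K)).v (i + 1) i (by lia) ≫= huv
    have h₂ := (mappingCone.inr (𝟙 K)).f i ≫= huv
    rw [mappingCone.ext_from_iff _ (i + 1) i rfl]
    simpa [coneIdMap, mappingCone.map, cancel_epi] using And.intro h₁ h₂

instance [∀ i, Mono (f.f i)] (i : ℤ) : Mono ((coneIdMap f).f i) where
  right_cancellation u v huv := by
    have h₁ := huv =≫ (mappingCone.fst (𝟙 L)).1.v i (i + 1) rfl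
    have h₂ := huv =≫ (mappingCone.snd (𝟙 L)).v i i (add_zero i)
    rw [mappingCone.ext_to_iff _ i (i + 1) rfl]
    simp only [Category.assoc, coneIdMap_f_fst_v, coneIdMap_f_snd_v] at h₁ h₂
    simp only [← Category.assoc, cancel_mono] at h₁ h₂
    exact ⟨h₁, h₂⟩

variable {R : Type u} [Ring R]

lemma subsingleton_X_of_isZero {Z : CochainComplex (ModuleCat.{u} R) ℤ} (hZ : IsZero Z) (n : ℤ) :
    Subsingleton (Z.X n) :=
  ModuleCat.subsingleton_of_isZero ((HomologicalComplex.eval _ _ n).map_isZero hZ)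

lemma IsSemiProjective.isKProjective {P : CochainComplex (ModuleCat.{u} R) ℤ}
    (hP : IsSemiProjective P) : P.IsKProjective := by
  refine (isKProjective_iff_acyclic_homComplex P).2 fun L hL => ?_
  obtain ⟨Z, hZ⟩ := HasZeroObject.zero (C := CochainComplex (ModuleCat.{u} R) ℤ)
  have hX := subsingleton_X_of_isZero hZ
  have := (hP (0 : L ⟶ Z) (fun n y => ⟨0, Subsingleton.elim _ _⟩)
    (quasiIso_of_acyclic _ hL (HomologicalComplex.acyclic_of_isZero Z hZ))).2
  refine acyclic_of_quasiIso (homComplexPostcomp P (0 : L ⟶ Z))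
    ((acyclic_iff_exists_d_eq _).2 fun n z _ => ⟨0, ?_⟩)
  exact Cochain.ext _ _ fun p q _ =>
    ((HomologicalComplex.eval _ _ q).map_isZero hZ).eq_of_tgt _ _

lemma IsSemiInjective.isKInjective {I : CochainComplex (ModuleCat.{u} R) ℤ}
    (hI : IsSemiInjective I) : I.IsKInjective := by
  refine (isKInjective_iff_acyclic_homComplex I).2 fun L hL => ?_
  obtain ⟨Z, hZ⟩ := HasZeroObject.zero (C := CochainComplex (ModuleCat.{u} R) ℤ)
  have hX := subsingleton_X_of_isZero hZ
  have := (hI (0 : Z ⟶ L) (fun n => Function.injective_of_subsingleton _)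
    (quasiIso_of_acyclic _ (HomologicalComplex.acyclic_of_isZero Z hZ) hL)).2
  refine acyclic_of_quasiIso (homComplexPrecomp (0 : Z ⟶ L) I)
    ((acyclic_iff_exists_d_eq _).2 fun n z _ => ⟨0, ?_⟩)
  exact Cochain.ext _ _ fun p q _ =>
    ((HomologicalComplex.eval _ _ p).map_isZero hZ).eq_of_src _ _

lemma IsSemiProjective.projective {P : CochainComplex (ModuleCat.{u} R) ℤ}
    (hP : IsSemiProjective P) (n : ℤ) : Projective (P.X n) where
  factors {E X} g e _ := by
    let F := HomologicalComplex.single (ModuleCat.{u} R) (.up ℤ) n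
    let iso (Y) := HomologicalComplex.singleObjXSelf (.up ℤ) n (Y : ModuleCat.{u} R)
    have h := hP (coneIdMap (F.map e)) (fun i => (ModuleCat.epi_iff_surjective _).1 inferInstance)
      (quasiIso_coneIdMap _)
    obtain ⟨x, hx⟩ : ∃ x : Cochain P (mappingCone (𝟙 (F.obj E))) 0,
      x.comp (Cochain.ofHom (coneIdMap (F.map e))) (add_zero 0) =
        (Cochain.single (g ≫ (iso X).inv) 0).comp
          (Cochain.ofHom (mappingCone.inr (𝟙 (F.obj X)))) (add_zero 0) := h.1 0 _
    have hx' := Cochain.congr_v hx n n (add_zero n) =≫ (mappingCone.snd _).v n n (add_zero n)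
    simp only [Cochain.comp_zero_cochain_v, Cochain.ofHom_v, Category.assoc, coneIdMap_f_snd_v,
      mappingCone.inr_f_snd_v, Category.comp_id, Cochain.single_v] at hx'
    refine ⟨x.v n n (add_zero n) ≫ (mappingCone.snd _).v n n (add_zero n) ≫ (iso E).hom, ?_⟩
    rw [HomologicalComplex.single_map_f_self] at hx'
    rw [← cancel_mono (iso X).inv]
    simpa only [Category.assoc] using hx'

lemma IsSemiInjective.injective {I : CochainComplex (ModuleCat.{u} R) ℤ}
    (hI : IsSemiInjective I) (n : ℤ) : Injective (I.X n) where
  factors {X Y} g m _ := by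
    let F := HomologicalComplex.single (ModuleCat.{u} R) (.up ℤ) n
    let iso (Y) := HomologicalComplex.singleObjXSelf (.up ℤ) n (Y : ModuleCat.{u} R)
    have h := hI (coneIdMap (F.map m)) (fun i => (ModuleCat.mono_iff_injective _).1 inferInstance)
      (quasiIso_coneIdMap _)
    obtain ⟨x, hx⟩ : ∃ x : Cochain (mappingCone (𝟙 (F.obj Y))) I 0,
      (Cochain.ofHom (coneIdMap (F.map m))).comp x (zero_add 0) =
        (mappingCone.snd (𝟙 (F.obj X))).comp (Cochain.single ((iso X).hom ≫ g) 0)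
          (zero_add 0) := h.1 0 _
    have hx' := (mappingCone.inr _).f n ≫= Cochain.congr_v hx n n (add_zero n)
    simp only [Cochain.zero_cochain_comp_v, Cochain.ofHom_v,
      mappingCone.inr_f_snd_v_assoc, Cochain.single_v] at hx'
    rw [← Category.assoc, inr_f_coneIdMap_f, Category.assoc] at hx'
    refine ⟨(iso Y).inv ≫ (mappingCone.inr _).f n ≫ x.v n n (add_zero n), ?_⟩
    rw [HomologicalComplex.single_map_f_self] at hx'
    rw [← cancel_epi (iso X).hom]
    simpa only [Category.assoc] using hx'

lemma isSemiProjective_iff (P : CochainComplex (ModuleCat.{u} R) ℤ) :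
    IsSemiProjective P ↔ P.IsKProjective ∧ ∀ n, Projective (P.X n) := by
  refine ⟨fun hP => ⟨hP.isKProjective, hP.projective⟩, fun ⟨hP, _⟩ M N β hβ _ => ?_⟩
  have (n : ℤ) : Epi (β.f n) := (ModuleCat.epi_iff_surjective _).2 (hβ n)
  have : Epi β := HomologicalComplex.epi_of_epi_f β inferInstance
  have hS : (ShortComplex.mk (kernel.ι β) β (kernel.condition β)).ShortExact :=
    { exact := ShortComplex.exact_of_f_is_kernel _ (kernelIsKernel β) }
  have hS' := homComplexPostcompShortComplex_shortExact P hS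
  exact ⟨fun n => (AddCommGrpCat.epi_iff_surjective _).1
      (hS'.map_of_exact (HomologicalComplex.eval _ (.up ℤ) n)).epi_g,
    quasiIso_g_of_acyclic_X₁ hS'
      ((isKProjective_iff_acyclic_homComplex P).1 hP _ (hS.acyclic_X₁ ‹_›))⟩

lemma isSemiInjective_iff (I : CochainComplex (ModuleCat.{u} R) ℤ) :
    IsSemiInjective I ↔ I.IsKInjective ∧ ∀ n, Injective (I.X n) := by
  refine ⟨fun hI => ⟨hI.isKInjective, hI.injective⟩, fun ⟨hI, _⟩ M N α hα _ => ?_⟩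
  have (n : ℤ) : Mono (α.f n) := (ModuleCat.mono_iff_injective _).2 (hα n)
  have : Mono α := HomologicalComplex.mono_of_mono_f α inferInstance
  have hS : (ShortComplex.mk α (cokernel.π α) (cokernel.condition α)).ShortExact :=
    { exact := ShortComplex.exact_of_g_is_cokernel _ (cokernelIsCokernel α) }
  have hS' := homComplexPrecompShortComplex_shortExact hS I
  exact ⟨fun n => (AddCommGrpCat.epi_iff_surjective _).1
      (hS'.map_of_exact (HomologicalComplex.eval _ (.up ℤ) n)).epi_g,
    quasiIso_g_of_acyclic_X₁ hS'
      ((isKInjective_iff_acyclic_homComplex I).1 hI _ (hS.acyclic_X₃ ‹_›))⟩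

end SemiProjective

section Image

variable {C : Type*} [Category* C] [Abelian C] {X Y : C} (f : X ⟶ Y)

lemma kernel_ι_comp_factorThruImage : kernel.ι f ≫ Abelian.factorThruImage f = 0 := by
  rw [← cancel_mono (Abelian.image.ι f), Category.assoc, Abelian.image.fac, kernel.condition,
    zero_comp]

lemma shortExact_kernel_image :
    (ShortComplex.mk _ _ (kernel_ι_comp_factorThruImage f)).ShortExact where
  exact := by
    let φ : ShortComplex.mk _ _ (kernel_ι_comp_factorThruImage f) ⟶
        ShortComplex.mk (kernel.ι f) f (kernel.condition f) :=
      { τ₁ := 𝟙 _, τ₂ := 𝟙 _, τ₃ := Abelian.image.ι f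
        comm₁₂ := by simp
        comm₂₃ := by simp }
    have : Epi φ.τ₁ := inferInstanceAs (Epi (𝟙 _))
    have : IsIso φ.τ₂ := inferInstanceAs (IsIso (𝟙 _))
    have : Mono φ.τ₃ := inferInstanceAs (Mono (Abelian.image.ι f))
    exact (ShortComplex.exact_iff_of_epi_of_isIso_of_mono φ).2 (ShortComplex.exact_kernel f)

lemma shortExact_image_cokernel :
    (ShortComplex.mk (Abelian.image.ι f) (cokernel.π f) (kernel.condition _)).ShortExact where
  exact := ShortComplex.exact_kernel _

end Image

section ExtOne

open Abelian

variable {C : Type*} [Category* C] [Abelian C] [HasExt.{w} C]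

lemma exists_extension_of_subsingleton_ext {S : ShortComplex C} (hS : S.ShortExact)
    {N : C} (h : Subsingleton (Ext S.X₃ N 1)) (g : S.X₁ ⟶ N) :
    ∃ g' : S.X₂ ⟶ N, S.f ≫ g' = g := by
  obtain ⟨x, hx⟩ := Ext.contravariant_sequence_exact₁ hS N (Ext.mk₀ g) (add_zero 1)
    (Subsingleton.elim _ _)
  obtain ⟨g', rfl⟩ := (Ext.mk₀_bijective _ _).2 x
  exact ⟨g', (Ext.mk₀_bijective _ _).1 (by rw [← hx, Ext.mk₀_comp_mk₀])⟩

lemma exists_lift_of_subsingleton_ext {S : ShortComplex C} (hS : S.ShortExact)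
    {M : C} (h : Subsingleton (Ext M S.X₁ 1)) (g : M ⟶ S.X₃) :
    ∃ g' : M ⟶ S.X₂, g' ≫ S.g = g := by
  obtain ⟨x, hx⟩ := Ext.covariant_sequence_exact₃ M hS (Ext.mk₀ g) (zero_add 1)
    (Subsingleton.elim _ _)
  obtain ⟨g', rfl⟩ := (Ext.mk₀_bijective _ _).2 x
  exact ⟨g', (Ext.mk₀_bijective _ _).1 (by rw [← hx, Ext.mk₀_comp_mk₀])⟩

lemma subsingleton_ext_of_exists_extension {S : ShortComplex C} (hS : S.ShortExact)
    [Projective S.X₂] {N : C}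
    (h : ∀ g : S.X₁ ⟶ N, ∃ g' : S.X₂ ⟶ N, S.f ≫ g' = g) : Subsingleton (Ext S.X₃ N 1) := by
  refine subsingleton_of_forall_eq 0 fun x => ?_
  obtain ⟨y, rfl⟩ := Ext.contravariant_sequence_exact₃ hS N x (Ext.eq_zero_of_projective _)
    (add_zero 1)
  obtain ⟨g, rfl⟩ := (Ext.mk₀_bijective _ _).2 y
  obtain ⟨g', rfl⟩ := h g
  rw [← Ext.mk₀_comp_mk₀, ShortComplex.ShortExact.extClass_comp_assoc]

lemma subsingleton_ext_iff_of_resolution {K₀ K₁ K₂ P₀ P₁ P₂ : C} {i₀ : K₁ ⟶ P₀} {p₀ : P₀ ⟶ K₀}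
    {i₁ : K₂ ⟶ P₁} {p₁ : P₁ ⟶ K₁} {w₀ : i₀ ≫ p₀ = 0} {w₁ : i₁ ≫ p₁ = 0}
    (h₀ : (ShortComplex.mk i₀ p₀ w₀).ShortExact) (h₁ : (ShortComplex.mk i₁ p₁ w₁).ShortExact)
    {p₂ : P₂ ⟶ K₂} (h₂ : Epi p₂) (hP₀ : Projective P₀) (N : C) :
    Subsingleton (Ext K₀ N 1) ↔
      ∀ φ : P₁ ⟶ N, (p₂ ≫ i₁) ≫ φ = 0 → ∃ ψ : P₀ ⟶ N, (p₁ ≫ i₀) ≫ ψ = φ := by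
  have : Epi p₁ := h₁.epi_g
  have : Projective (ShortComplex.mk i₀ p₀ w₀).X₂ := hP₀
  refine ⟨fun h φ hφ => ?_, fun h => subsingleton_ext_of_exists_extension h₀ fun g => ?_⟩
  · rw [Category.assoc, ← comp_zero (f := p₂), cancel_epi] at hφ
    obtain ⟨ψ, hψ⟩ := exists_extension_of_subsingleton_ext h₀ h (h₁.exact.desc φ hφ)
    exact ⟨ψ, by rw [Category.assoc, hψ]; exact h₁.exact.g_desc φ hφ⟩
  · obtain ⟨ψ, hψ⟩ := h (p₁ ≫ g) (by rw [Category.assoc, reassoc_of% w₁, zero_comp, comp_zero])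
    exact ⟨ψ, by rwa [Category.assoc, cancel_epi] at hψ⟩

lemma subsingleton_ext_of_exists_lift {S : ShortComplex C} (hS : S.ShortExact)
    [Injective S.X₂] {M : C}
    (h : ∀ g : M ⟶ S.X₃, ∃ g' : M ⟶ S.X₂, g' ≫ S.g = g) : Subsingleton (Ext M S.X₁ 1) := by
  refine subsingleton_of_forall_eq 0 fun x => ?_
  obtain ⟨y, rfl⟩ := Ext.covariant_sequence_exact₁ M hS x (Ext.eq_zero_of_injective _)
    (zero_add 1)
  obtain ⟨g, rfl⟩ := (Ext.mk₀_bijective _ _).2 y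
  obtain ⟨g', rfl⟩ := h g
  rw [← Ext.mk₀_comp_mk₀, Ext.comp_assoc_of_second_deg_zero, hS.comp_extClass, Ext.comp_zero]

lemma subsingleton_ext_cokernel {X P N : C} [hP : Projective P] (d : X ⟶ P)
    (h : ∀ φ : X ⟶ N, kernel.ι d ≫ φ = 0 → ∃ ψ, d ≫ ψ = φ) :
    Subsingleton (Ext (cokernel d) N 1) := by
  have : Projective (ShortComplex.mk _ _ (kernel.condition (cokernel.π d))).X₂ := hP
  refine subsingleton_ext_of_exists_extension (shortExact_image_cokernel d) fun g => ?_
  obtain ⟨ψ, hψ⟩ := h (Abelian.factorThruImage d ≫ g) (by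
    rw [reassoc_of% kernel_ι_comp_factorThruImage d, zero_comp])
  refine ⟨ψ, (cancel_epi (Abelian.factorThruImage d)).1 ?_⟩
  rw [← hψ, ← Category.assoc]
  exact congrArg (· ≫ ψ) (Abelian.image.fac d)

lemma subsingleton_ext_kernel {I Y M : C} [hI : Injective I] (d : I ⟶ Y)
    (h : ∀ φ : M ⟶ Y, φ ≫ cokernel.π d = 0 → ∃ ψ, ψ ≫ d = φ) :
    Subsingleton (Ext M (kernel d) 1) := by
  have : Injective (ShortComplex.mk _ _ (kernel_ι_comp_factorThruImage d)).X₂ := hI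
  refine subsingleton_ext_of_exists_lift (shortExact_kernel_image d) fun g => ?_
  obtain ⟨ψ, hψ⟩ := h (g ≫ Abelian.image.ι d) (by
    rw [Category.assoc, kernel.condition, comp_zero])
  refine ⟨ψ, (cancel_mono (Abelian.image.ι d)).1 ?_⟩
  rw [← hψ, Category.assoc]
  exact congrArg (ψ ≫ ·) (Abelian.image.fac d)

lemma subsingleton_ext_of_retract {X X' Y Y' : C} (r : Retract X X') (r' : Retract Y Y')
    (h : Subsingleton (Ext X' Y' 1)) : Subsingleton (Ext X Y 1) := by
  refine subsingleton_of_forall_eq 0 fun x => ?_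
  have hx : ((Ext.mk₀ r.r).comp x (zero_add 1)).comp (Ext.mk₀ r'.i) (add_zero 1) = 0 :=
    Subsingleton.elim _ _
  calc x = ((Ext.mk₀ r.i).comp (((Ext.mk₀ r.r).comp x (zero_add 1)).comp (Ext.mk₀ r'.i)
            (add_zero 1)) (zero_add 1)).comp (Ext.mk₀ r'.r) (add_zero 1) := by
        simp only [Ext.comp_assoc_of_second_deg_zero, Ext.comp_assoc_of_third_deg_zero,
          Ext.mk₀_comp_mk₀, Ext.mk₀_comp_mk₀_assoc, r.retract, r'.retract, Ext.mk₀_id_comp,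
          Ext.comp_mk₀_id]
    _ = 0 := by rw [hx, Ext.comp_zero, Ext.zero_comp]

end ExtOne

section GhostProjective

open DerivedCategory

variable {C : Type*} [Category* C] [Abelian C] [HasDerivedCategory.{w} C]

variable (C) in
/-- The objects of the derived category out of which all ghosts vanish. -/
def ghostProjective : ObjectProperty (DerivedCategory C) :=
  fun P => ∀ ⦃Y : DerivedCategory C⦄ (f : P ⟶ Y), IsGhost f → f = 0

lemma ghostProjective_of_retract {P P' : DerivedCategory C} (r : Retract P P')
    (h : ghostProjective C P') : ghostProjective C P := fun Y f hf => by
  rw [← Category.id_comp f, ← r.retract, Category.assoc, h _ (hf.comp_left r.r), comp_zero]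

lemma ghostProjective_of_isColimit {J : Type*} {P : J → DerivedCategory C} {c : Cofan P}
    (hc : IsColimit c) (h : ∀ j, ghostProjective C (P j)) : ghostProjective C c.pt :=
  fun Y f hf => Cofan.IsColimit.hom_ext hc _ _ fun j => by
    rw [h j _ (hf.comp_left (c.inj j)), comp_zero]

lemma ghostProjective_shift {P : DerivedCategory C} (h : ghostProjective C P) (n : ℤ) :
    ghostProjective C (P⟦n⟧) := fun Y f hf => by
  have h' := h ((shiftShiftNeg P n).inv ≫ f⟦-n⟧')
    (((isGhost_shift_iff f (-n)).2 hf).comp_left _)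
  rwa [Preadditive.IsIso.comp_left_eq_zero, Functor.map_eq_zero_iff] at h'

lemma isHomologyFree_singleFunctor_obj (P : C) [Projective P] (n : ℤ) :
    IsHomologyFree ((singleFunctor C n).obj P) := by
  have (i : ℤ) : Projective (((CochainComplex.singleFunctor C n).obj P).X i) := by
    dsimp [CochainComplex.singleFunctor, CochainComplex.singleFunctors, HomologicalComplex.single]
    split_ifs <;> infer_instance
  exact (isHomologyFree_Q (K := (CochainComplex.singleFunctor C n).obj P) fun _ _ => rfl).of_retract
    (Retract.refl _)

lemma homShortExact_of_isGhost {P : DerivedCategory C} (hP : ghostProjective C P)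
    {t : Triangle (DerivedCategory C)} (ht : t ∈ distTriang _) (h : IsGhost t.mor₃) :
    HomShortExact P t := by
  refine ⟨fun f g (hfg : f ≫ t.mor₁ = g ≫ t.mor₁) => sub_eq_zero.1 (hP _ fun s => ?_),
    fun f => ⟨fun hf => Triangle.coyoneda_exact₂ t ht f hf |>.imp fun _ => Eq.symm, ?_⟩,
    fun f => Triangle.coyoneda_exact₃ t ht f (hP _ (h.comp_left f)) |>.imp fun _ => Eq.symm⟩
  · have := (mono_homology_mor₁_iff_isGhost ht).2 h s
    rw [← cancel_mono ((homologyFunctor C s).map t.mor₁), ← Functor.map_comp, Preadditive.sub_comp,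
      hfg, sub_self, Functor.map_zero, zero_comp]
  · rintro ⟨g, rfl⟩
    exact (Category.assoc _ _ _).trans (by rw [comp_distTriang_mor_zero₁₂ t ht, comp_zero])

end GhostProjective

section GhostTriangles

open DerivedCategory

variable {R : Type u} [Ring R] [HasDerivedCategory.{w} (ModuleCat.{u} R)]

lemma ghostProjective_of_retractsOfCoproductsOfShifts {P : DerivedCategory (ModuleCat.{u} R)}
    (hP : retractsOfCoproductsOfShifts (isProjective (ModuleCat.{u} R)) P) :
    ghostProjective (ModuleCat.{u} R) P := by
  obtain ⟨J, M, n, c, hM, ⟨hc⟩, ⟨r⟩⟩ := hP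
  refine ghostProjective_of_retract r (ghostProjective_of_isColimit hc fun j => ?_)
  have : Projective (M j) := hM j
  exact ghostProjective_shift
    (fun _ f hf => (isHomologyFree_singleFunctor_obj (M j) 0).eq_zero f hf) (n j)

lemma retractsOfCoproductsOfShifts_singleFunctor_obj (X : ObjectProperty (ModuleCat.{u} R))
    {M : ModuleCat.{u} R} (hM : X M) (n : ℤ) :
    retractsOfCoproductsOfShifts X ((singleFunctor (ModuleCat.{u} R) n).obj M) := by
  let P := ((singleFunctor (ModuleCat.{u} R) 0).obj M)⟦-n⟧
  refine ⟨PUnit, fun _ => M, fun _ => -n, Cofan.mk P fun _ => 𝟙 P, fun _ => hM,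
    ⟨Cofan.IsColimit.mk _ (fun s => s.inj PUnit.unit) (fun _ _ => Category.id_comp _)
      fun s m h => by rw [← h PUnit.unit]; exact (Category.id_comp m).symm⟩,
    ⟨(((singleFunctors (ModuleCat.{u} R)).shiftIso (-n) n 0 (by lia)).symm.app M).retract⟩⟩

lemma exists_singleFunctor_obj_homologyMap_epi (X : DerivedCategory (ModuleCat.{u} R)) (s : ℤ) :
    ∃ (P : ModuleCat.{u} R) (p : (singleFunctor (ModuleCat.{u} R) s).obj P ⟶ X),
      Projective P ∧ Epi ((homologyFunctor _ s).map p) := by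
  let P := Projective.over ((homologyFunctor _ s).obj X)
  let e : (homologyFunctor _ s).obj ((singleFunctor (ModuleCat.{u} R) s).obj P) ≅ P :=
    (singleFunctorCompHomologyFunctorIso _ s).app P
  obtain ⟨p, hp⟩ := (isHomologyFree_singleFunctor_obj P s).exists_map
    (Function.update (fun _ => 0) s (e.hom ≫ Projective.π _))
  refine ⟨P, p, inferInstance, ?_⟩
  rw [hp, Function.update_self]
  infer_instance

lemma ghostTriangles_iff (t : Triangle (DerivedCategory (ModuleCat.{u} R))) :
    ghostTriangles R t ↔ t ∈ distTriang _ ∧ IsGhost t.mor₃ := by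
  refine ⟨fun ⟨ht, h⟩ => ⟨ht, fun s => ?_⟩, fun ⟨ht, h⟩ => ⟨ht, fun P hP =>
    homShortExact_of_isGhost (ghostProjective_of_retractsOfCoproductsOfShifts hP) ht h⟩⟩
  obtain ⟨P, p, hP, hp⟩ := exists_singleFunctor_obj_homologyMap_epi t.obj₃ s
  obtain ⟨g, rfl⟩ := (h _ (retractsOfCoproductsOfShifts_singleFunctor_obj _ hP s)).2.2 p
  rw [← cancel_epi ((homologyFunctor _ s).map (g ≫ t.mor₂)), ← Functor.map_comp, Category.assoc,
    comp_distTriang_mor_zero₂₃ t ht, comp_zero, Functor.map_zero, comp_zero]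

lemma exists_ghostTriangle_isHomologyFree (X : DerivedCategory (ModuleCat.{u} R)) :
    ∃ (K P : DerivedCategory (ModuleCat.{u} R)) (i : K ⟶ P) (p : P ⟶ X) (h : X ⟶ K⟦(1 : ℤ)⟧),
      ghostTriangles R (Triangle.mk i p h) ∧ IsHomologyFree P := by
  obtain ⟨M, p, hM, hp⟩ := exists_projective_formalObj_epi X
  obtain ⟨K, i, h, ht⟩ := distinguished_cocone_triangle₁ p
  exact ⟨K, _, i, p, h, (ghostTriangles_iff _).2 ⟨ht, (epi_homology_mor₂_iff_isGhost ht).1 hp⟩,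
    isHomologyFree_formalObj M⟩

lemma xiProjective_ghostTriangles_iff (P : DerivedCategory (ModuleCat.{u} R)) :
    xiProjective (ghostTriangles R) P ↔ IsHomologyFree P := by
  refine ⟨fun h => ?_, fun h t ht => ?_⟩
  · obtain ⟨K, F, i, p, _, ht, hF⟩ := exists_ghostTriangle_isHomologyFree P
    obtain ⟨s, hs⟩ := (h _ ht).2.2 (𝟙 P)
    exact hF.of_retract ⟨s, p, hs⟩
  · rw [ghostTriangles_iff] at ht
    exact homShortExact_of_isGhost (fun _ f hf => h.eq_zero f hf) ht.1 ht.2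

lemma nonempty_xiProjectiveResolution (X : DerivedCategory (ModuleCat.{u} R)) :
    Nonempty (XiProjectiveResolution (ghostTriangles R) X) := by
  choose K P i p h ht hP using exists_ghostTriangle_isHomologyFree (R := R)
  let Z := iterates K X
  exact ⟨{
    K := Z
    P n := P (Z n)
    ι n := i (Z n)
    π n := p (Z n)
    ν n := h (Z n)
    mem n := ht (Z n)
    projective n := (xiProjective_ghostTriangles_iff _).2 (hP (Z n))
    augmentation := Iso.refl X }⟩

end GhostTriangles

section XiExt

lemma subsingleton_xiExtSucc_iff {T : Type*} [Category* T] [Preadditive T] [HasShift T ℤ]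
    {ξ : ObjectProperty (Triangle T)} {X : T} (ρ : XiProjectiveResolution ξ X) (Y : T) (n : ℕ) :
    Subsingleton (ρ.XiExtSucc Y n) ↔ ∀ φ : ρ.P (n + 1) ⟶ Y, ρ.d (n + 1) ≫ φ = 0 →
      ∃ ψ : ρ.P n ⟶ Y, ρ.d n ≫ ψ = φ := by
  rw [QuotientAddGroup.subsingleton_iff, AddSubgroup.addSubgroupOf_eq_top]
  rfl

open DerivedCategory

variable {R : Type u} [Ring R] [HasDerivedCategory.{w} (ModuleCat.{u} R)]

lemma IsHomologyFree.forall_exists_comp_eq_iff {C : Type*} [Category* C] [Abelian C]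
    [HasDerivedCategory.{w} C] {P₀ P₁ P₂ : DerivedCategory C} (h₀ : IsHomologyFree P₀)
    (h₁ : IsHomologyFree P₁) (h₂ : IsHomologyFree P₂) (d : P₂ ⟶ P₁) (e : P₁ ⟶ P₀)
    (Y : DerivedCategory C) :
    (∀ φ : P₁ ⟶ Y, d ≫ φ = 0 → ∃ ψ : P₀ ⟶ Y, e ≫ ψ = φ) ↔
      ∀ s (φ : (homologyFunctor C s).obj P₁ ⟶ (homologyFunctor C s).obj Y),
        (homologyFunctor C s).map d ≫ φ = 0 → ∃ ψ, (homologyFunctor C s).map e ≫ ψ = φ := by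
  constructor
  · intro h s φ hφ
    obtain ⟨f, hf⟩ := h₁.exists_map (Function.update (fun _ => 0) s φ)
    have hdf : IsGhost (d ≫ f) := fun s' => by
      rw [Functor.map_comp, hf]
      rcases eq_or_ne s' s with rfl | hs
      · rw [Function.update_self, hφ]
      · rw [Function.update_of_ne hs, comp_zero]
    obtain ⟨ψ, rfl⟩ := h f (h₂.eq_zero _ hdf)
    exact ⟨(homologyFunctor C s).map ψ, by rw [← Functor.map_comp, hf, Function.update_self]⟩
  · intro h f hf
    choose ψ hψ using fun s => h s ((homologyFunctor C s).map f)
      (by rw [← Functor.map_comp, hf, Functor.map_zero])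
    obtain ⟨g, hg⟩ := h₀.exists_map ψ
    refine ⟨g, sub_eq_zero.1 (h₁.eq_zero _ fun s => ?_)⟩
    rw [Functor.map_sub, Functor.map_comp, hg, hψ, sub_self]

lemma subsingleton_xiExtSucc_zero_iff {X : DerivedCategory (ModuleCat.{u} R)}
    (ρ : XiProjectiveResolution (ghostTriangles R) X) (Y : DerivedCategory (ModuleCat.{u} R)) :
    Subsingleton (ρ.XiExtSucc Y 0) ↔ ∀ s, Subsingleton
      (Abelian.Ext ((homologyFunctor _ s).obj X) ((homologyFunctor _ s).obj Y) 1) := by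
  have hP n := (xiProjective_ghostTriangles_iff _).1 (ρ.projective n)
  have hρ n := (ghostTriangles_iff _).1 (ρ.mem n)
  rw [subsingleton_xiExtSucc_iff, (hP 0).forall_exists_comp_eq_iff (hP 1) (hP 2)]
  refine forall_congr' fun s => ?_
  have hS n := homologyShortComplex_shortExact (hρ n).1 (hρ n).2 s
  have hd n : (homologyFunctor _ s).map (ρ.d n) =
      (homologyFunctor _ s).map (ρ.π (n + 1)) ≫ (homologyFunctor _ s).map (ρ.ι n) :=
    Functor.map_comp _ _ _
  let e := (homologyFunctor _ s).mapIso ρ.augmentation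
  rw [hd, hd]
  refine (subsingleton_ext_iff_of_resolution (hS 0) (hS 1) (hS 2).epi_g
    ((hP 0).projective s) _).symm.trans ?_
  exact ⟨subsingleton_ext_of_retract e.symm.retract (Retract.refl _),
    subsingleton_ext_of_retract e.retract (Retract.refl _)⟩

lemma xiExtOneVanishes_iff (X Y : DerivedCategory (ModuleCat.{u} R)) :
    XiExtOneVanishes (ghostTriangles R) X Y ↔ ∀ s, Subsingleton
      (Abelian.Ext ((homologyFunctor _ s).obj X) ((homologyFunctor _ s).obj Y) 1) :=
  ⟨fun ⟨ρ, h⟩ => (subsingleton_xiExtSucc_zero_iff ρ Y).1 h, fun h =>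
    ⟨(nonempty_xiProjectiveResolution X).some, (subsingleton_xiExtSucc_zero_iff _ Y).2 h⟩⟩

end XiExt

namespace IsCompleteHereditaryCotorsionPair

open Abelian

variable {R : Type u} [Ring R] {A B : ObjectProperty (ModuleCat.{u} R)}

lemma left_of_forall_subsingleton_ext (h : IsCompleteHereditaryCotorsionPair A B)
    {X : ModuleCat.{u} R} (hX : ∀ Y, B Y → Subsingleton (Ext X Y 1)) : A X := by
  rw [← h.leftPerp_eq]
  exact hX

lemma right_of_forall_subsingleton_ext (h : IsCompleteHereditaryCotorsionPair A B)
    {Y : ModuleCat.{u} R} (hY : ∀ X, A X → Subsingleton (Ext X Y 1)) : B Y := by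
  rw [← h.rightPerp_eq]
  exact hY

lemma subsingleton_ext (h : IsCompleteHereditaryCotorsionPair A B) {X Y : ModuleCat.{u} R}
    (hX : A X) (hY : B Y) : Subsingleton (Ext X Y 1) := by
  rw [← h.rightPerp_eq] at hY
  exact hY X hX

lemma isClosedUnderIsomorphisms_left (h : IsCompleteHereditaryCotorsionPair A B) :
    A.IsClosedUnderIsomorphisms where
  of_iso e hX := h.left_of_forall_subsingleton_ext fun _ hY =>
    subsingleton_ext_of_retract e.symm.retract (.refl _) (h.subsingleton_ext hX hY)

lemma isClosedUnderIsomorphisms_right (h : IsCompleteHereditaryCotorsionPair A B) :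
    B.IsClosedUnderIsomorphisms where
  of_iso e hY := h.right_of_forall_subsingleton_ext fun _ hX =>
    subsingleton_ext_of_retract (.refl _) e.symm.retract (h.subsingleton_ext hX hY)

lemma left_of_projective (h : IsCompleteHereditaryCotorsionPair A B) (X : ModuleCat.{u} R)
    [Projective X] : A X :=
  h.left_of_forall_subsingleton_ext fun _ _ => Ext.subsingleton_of_projective _ _ _

lemma right_of_injective (h : IsCompleteHereditaryCotorsionPair A B) (Y : ModuleCat.{u} R)
    [Injective Y] : B Y :=
  h.right_of_forall_subsingleton_ext fun _ _ => Ext.subsingleton_of_injective _ _ _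

lemma left_kernel (h : IsCompleteHereditaryCotorsionPair A B) {X Y : ModuleCat.{u} R} (f : X ⟶ Y)
    (hX : A X) (hY : A Y) (hf : A (cokernel f)) : A (kernel f) := by
  have hi : A (Abelian.image f) := h.hereditary_left _ (shortExact_image_cokernel f) hY hf
  exact h.hereditary_left _ (shortExact_kernel_image f) hX hi

lemma right_cokernel (h : IsCompleteHereditaryCotorsionPair A B) {X Y : ModuleCat.{u} R}
    (f : X ⟶ Y) (hX : B X) (hY : B Y) (hf : B (kernel f)) : B (cokernel f) := by
  have hi : B (Abelian.image f) := h.hereditary_right _ (shortExact_kernel_image f) hf hX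
  exact h.hereditary_right _ (shortExact_image_cokernel f) hi hY

end IsCompleteHereditaryCotorsionPair

section HomologyIn

open DerivedCategory

variable {C : Type*} [Category* C] [Abelian C] [HasDerivedCategory.{w} C]

/-- The objects of the derived category whose homology belongs to `A` in every degree. -/
def homologyIn (A : ObjectProperty C) : ObjectProperty (DerivedCategory C) :=
  fun X => ∀ s, A ((homologyFunctor C s).obj X)

variable (A : ObjectProperty C) [A.IsClosedUnderIsomorphisms]

instance : (homologyIn A).IsClosedUnderIsomorphisms where
  of_iso e h s := A.prop_of_iso ((homologyFunctor C s).mapIso e) (h s)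

lemma homologyIn_formalObj_iff (M : ℤ → C) : homologyIn A (formalObj M) ↔ ∀ s, A (M s) :=
  forall_congr' fun s => A.prop_iff_of_iso (homologyFormalIso M s)

lemma homologyIn_shift {X : DerivedCategory C} (h : homologyIn A X) (n : ℤ) :
    homologyIn A (X⟦n⟧) := fun s =>
  A.prop_of_iso (homologyShiftIso X n s (n + s) rfl).symm (h _)

end HomologyIn

section GhostVanishing

open DerivedCategory

variable {R : Type u} [Ring R] [HasDerivedCategory.{w} (ModuleCat.{u} R)]
  {A B : ObjectProperty (ModuleCat.{u} R)} {X Y : DerivedCategory (ModuleCat.{u} R)}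

namespace IsCompleteHereditaryCotorsionPair

lemma exists_ghost_comp_ghost (h : IsCompleteHereditaryCotorsionPair A B) (hX : homologyIn A X)
    (hY : homologyIn B Y) (φ : X ⟶ Y) (hφ : IsGhost φ) :
    ∃ (Y' : DerivedCategory (ModuleCat.{u} R)) (r : Y' ⟶ Y) (φ' : X ⟶ Y'),
      homologyIn B Y' ∧ IsGhost r ∧ IsGhost φ' ∧ φ' ≫ r = φ := by
  have := h.isClosedUnderIsomorphisms_right
  obtain ⟨M, e, hM, he⟩ := exists_injective_formalObj_mono (Y⟦(-1 : ℤ)⟧)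
  obtain ⟨Y', p, v, ht⟩ := distinguished_cocone_triangle e
  have hE := isHomologyCofree_formalObj M
  have hv : IsGhost v := (mono_homology_mor₁_iff_isGhost ht).1 he
  have hS := homologyShortComplex_shortExact ht hv
  have hYs := homologyIn_shift B hY (-1)
  let i := shiftNegShift Y (1 : ℤ)
  obtain ⟨ψ, hψ⟩ : ∃ ψ : X ⟶ Y', φ ≫ i.inv = ψ ≫ v := Triangle.coyoneda_exact₁ _ ht _
    (hE.eq_zero_of_shift 1 _ ((hφ.comp_right i.inv).comp_right _))
  -- `ψ` need not be a ghost, but `H ψ` factors through `H p`, as `Ext¹(H X, H Y)` vanishes.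
  choose k hk using fun s => exists_lift_of_subsingleton_ext (hS s)
    (h.subsingleton_ext (hX s) (hYs s)) ((homologyFunctor _ s).map ψ)
  obtain ⟨c, hc⟩ := hE.exists_map k
  refine ⟨Y', v ≫ i.hom, ψ - c ≫ p, fun s => ?_, hv.comp_right _, fun s => ?_, ?_⟩
  · have := hE.injective s
    exact h.hereditary_right _ (hS s) (hYs s)
      (h.right_of_injective ((homologyFunctor _ s).obj (formalObj M)))
  · rw [Functor.map_sub, Functor.map_comp, hc]
    exact sub_eq_zero.2 (hk s).symm
  · have hpv : p ≫ v = 0 := comp_distTriang_mor_zero₂₃ _ ht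
    rw [Preadditive.sub_comp, Category.assoc, reassoc_of% hpv, zero_comp, comp_zero, sub_zero,
      ← Category.assoc, ← hψ, Category.assoc, Iso.inv_hom_id, Category.comp_id]

lemma eq_zero_of_isGhost (h : IsCompleteHereditaryCotorsionPair A B) (hX : homologyIn A X)
    (hY : homologyIn B Y) (φ : X ⟶ Y) (hφ : IsGhost φ) : φ = 0 := by
  have := hasProductsOfShape_derivedCategory (ModuleCat.{u} R) ℕ
  let S := Σ' Y : DerivedCategory (ModuleCat.{u} R), {φ : X ⟶ Y // homologyIn B Y ∧ IsGhost φ}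
  have hstep (q : S) : ∃ (q' : S) (r : q'.1 ⟶ q.1), q'.2.1 ≫ r = q.2.1 ∧ IsGhost r := by
    obtain ⟨Y, φ, hY, hφ⟩ := q
    obtain ⟨Y', r, φ', hY', hr, hφ', hr'⟩ := h.exists_ghost_comp_ghost hX hY φ hφ
    exact ⟨⟨Y', φ', hY', hφ'⟩, r, hr', hr⟩
  choose F r hr hr' using hstep
  let q : ℕ → S := iterates F ⟨Y, φ, hY, hφ⟩
  have := isIso_oneSubShift_of_isGhost (X := fun n => (q n).1) (fun n => r (q n)) fun n => hr' _
  exact eq_zero_of_compatible (fun n => r (q n)) (fun n => (q n).2.1) (fun n => hr (q n)) 0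

end IsCompleteHereditaryCotorsionPair

end GhostVanishing

universe w'

section ModelsAndHomology

open DerivedCategory
open HomologicalComplex (homologyMap)

variable {C : Type*} [Category* C] [Abelian C]

/-- The homology in degree `j` as a kernel. -/
noncomputable def homologyIsoKernelDesc (K : CochainComplex C ℤ) {i j k : ℤ} (hij : i + 1 = j)
    (hjk : j + 1 = k) :
    K.homology j ≅ kernel (cokernel.desc (K.d i j) (K.d j k) (K.d_comp_d i j k)) :=
  K.homologyIsoSc' i j k (by simp [← hij]) (by simp [hjk]) ≪≫ (K.sc' i j k).homologyIsoKernelDesc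

/-- The homology in degree `j` as a cokernel. -/
noncomputable def homologyIsoCokernelLift (K : CochainComplex C ℤ) {i j k : ℤ} (hij : i + 1 = j)
    (hjk : j + 1 = k) :
    K.homology j ≅ cokernel (kernel.lift (K.d j k) (K.d i j) (K.d_comp_d i j k)) :=
  K.homologyIsoSc' i j k (by simp [← hij]) (by simp [hjk]) ≪≫
    (K.sc' i j k).homologyIsoCokernelLift

variable [HasDerivedCategory.{w} C]

section Factorization

variable {N : ℤ → C} {K : CochainComplex C ℤ}

lemma exists_d_comp_eq_of_isKProjective [K.IsKProjective]
    (hK : ∀ f : Q.obj K ⟶ formalObj N, IsGhost f → f = 0) (φ : ∀ t, K.X t ⟶ N t)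
    (hφ : ∀ t, K.iCycles t ≫ φ t = 0) {i j : ℤ} (hij : i + 1 = j) :
    ∃ ψ : K.X j ⟶ N i, K.d i j ≫ ψ = φ i := by
  let f : K ⟶ formalComplex N :=
    { f := φ
      comm' t t' _ := by
        have hd : K.d t t' ≫ φ t' = 0 := by
          rw [← K.toCycles_i t t', Category.assoc, hφ, comp_zero]
        exact comp_zero.trans hd.symm }
  have hf : IsGhost (Q.map f) := fun t => by
    have hz : HomologicalComplex.cyclesMap f t = 0 := by
      rw [← cancel_mono (HomologicalComplex.iCycles _ t), HomologicalComplex.cyclesMap_i, zero_comp]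
      exact hφ t
    have hf : homologyMap f t = 0 := by
      rw [← cancel_epi (K.homologyπ t), HomologicalComplex.homologyπ_naturality, hz, zero_comp,
        comp_zero]
    rw [homologyFunctor_map_Q_map, hf, zero_comp, comp_zero]
  obtain ⟨H⟩ := nonempty_homotopy_of_isKProjective f (hK _ hf)
  have hH := H.comm i
  rw [dNext_eq _ (show (ComplexShape.up ℤ).Rel i j from hij), prevD_eq _
    (show (ComplexShape.up ℤ).Rel (i - 1) i by simp), formalComplex_d, comp_zero, add_zero,
    HomologicalComplex.zero_f, add_zero] at hH
  exact ⟨H.hom j i, hH.symm⟩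

lemma exists_comp_d_eq_of_isKInjective [K.IsKInjective]
    (hK : ∀ f : formalObj N ⟶ Q.obj K, IsGhost f → f = 0) (φ : ∀ t, N t ⟶ K.X t)
    (hφ : ∀ t, φ t ≫ K.pOpcycles t = 0) {i j : ℤ} (hij : i + 1 = j) :
    ∃ ψ : N j ⟶ K.X i, ψ ≫ K.d i j = φ j := by
  let f : formalComplex N ⟶ K :=
    { f := φ
      comm' t t' _ := by
        have hd : φ t ≫ K.d t t' = 0 := by rw [← K.p_fromOpcycles t t', reassoc_of% hφ, zero_comp]
        exact hd.trans zero_comp.symm }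
  have hf : IsGhost (Q.map f) := fun t => by
    have hz : HomologicalComplex.opcyclesMap f t = 0 := by
      rw [← cancel_epi (HomologicalComplex.pOpcycles _ t), HomologicalComplex.p_opcyclesMap,
        comp_zero]
      exact hφ t
    have hf : homologyMap f t = 0 := by
      rw [← cancel_mono (K.homologyι t), HomologicalComplex.homologyι_naturality, hz, comp_zero,
        zero_comp]
    rw [homologyFunctor_map_Q_map, hf, zero_comp, comp_zero]
  obtain ⟨H⟩ := nonempty_homotopy_of_isKInjective f (hK _ hf)
  have hH := H.comm j
  rw [dNext_eq _ (show (ComplexShape.up ℤ).Rel j (j + 1) by simp), prevD_eq _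
    (show (ComplexShape.up ℤ).Rel i j from hij), formalComplex_d, zero_comp, zero_add,
    HomologicalComplex.zero_f, add_zero] at hH
  exact ⟨H.hom j i, hH.symm⟩

end Factorization

lemma subsingleton_ext_cokernel_d_of_isKProjective [HasExt.{w'} C] {P : CochainComplex C ℤ}
    [P.IsKProjective] {N : C} (hP : ∀ f : Q.obj P ⟶ formalObj fun _ => N, IsGhost f → f = 0)
    {i j : ℤ} (hij : i + 1 = j) [Projective (P.X j)] :
    Subsingleton (Abelian.Ext (cokernel (P.d i j)) N 1) := by
  refine subsingleton_ext_cokernel _ fun φ hφ => ?_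
  let Φ : ∀ t, P.X t ⟶ N := Function.update (fun _ => 0) i φ
  have hΦi : Φ i = φ := Function.update_self ..
  have hΦ (t : ℤ) : P.iCycles t ≫ Φ t = 0 := by
    rcases eq_or_ne t i with rfl | ht
    · rw [hΦi, ← kernel.lift_ι _ _ (P.iCycles_d t j), Category.assoc, hφ, comp_zero]
    · rw [show Φ t = 0 from Function.update_of_ne ht .., comp_zero]
  simpa only [hΦi] using exists_d_comp_eq_of_isKProjective hP Φ hΦ hij

lemma subsingleton_ext_kernel_d_of_isKInjective [HasExt.{w'} C] {I : CochainComplex C ℤ}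
    [I.IsKInjective] {M : C} (hI : ∀ f : (formalObj fun _ => M) ⟶ Q.obj I, IsGhost f → f = 0)
    {i j : ℤ} (hij : i + 1 = j) [Injective (I.X i)] :
    Subsingleton (Abelian.Ext M (kernel (I.d i j)) 1) := by
  refine subsingleton_ext_kernel _ fun φ hφ => ?_
  let Φ : ∀ t, M ⟶ I.X t := Function.update (fun _ => 0) j φ
  have hΦj : Φ j = φ := Function.update_self ..
  have hΦ (t : ℤ) : Φ t ≫ I.pOpcycles t = 0 := by
    rcases eq_or_ne t j with rfl | ht
    · rw [hΦj, ← cokernel.π_desc _ _ (I.d_pOpcycles i t), reassoc_of% hφ, zero_comp]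
    · rw [show Φ t = 0 from Function.update_of_ne ht .., zero_comp]
  simpa only [hΦj] using exists_comp_d_eq_of_isKInjective hI Φ hΦ hij

end ModelsAndHomology

namespace IsCompleteHereditaryCotorsionPair

open DerivedCategory

variable {R : Type u} [Ring R] {A B : ObjectProperty (ModuleCat.{u} R)}

lemma left_homology (h : IsCompleteHereditaryCotorsionPair A B)
    {P : CochainComplex (ModuleCat.{u} R) ℤ} [∀ n, Projective (P.X n)]
    (hP : ∀ s, A (cokernel (P.d (s - 1) s))) (s : ℤ) : A (P.homology s) := by
  have := h.isClosedUnderIsomorphisms_left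
  let δ := cokernel.desc (P.d (s - 1) s) (P.d s (s + 1)) (P.d_comp_d _ _ _)
  refine A.prop_of_iso (homologyIsoKernelDesc P (by lia) rfl).symm
    (h.left_kernel δ (hP s) (h.left_of_projective _) ?_)
  have hδ : cokernel.π _ ≫ δ = P.d s (s + 1) := cokernel.π_desc _ _ _
  have hs : A (cokernel (P.d s (s + 1))) := by
    have := hP (s + 1)
    rwa [add_sub_cancel_right] at this
  exact A.prop_of_iso ((cokernelIsoOfEq hδ).symm ≪≫ cokernelEpiComp _ _) hs

lemma right_homology (h : IsCompleteHereditaryCotorsionPair A B)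
    {I : CochainComplex (ModuleCat.{u} R) ℤ} [∀ n, Injective (I.X n)]
    (hI : ∀ s, B (kernel (I.d s (s + 1)))) (s : ℤ) : B (I.homology s) := by
  have := h.isClosedUnderIsomorphisms_right
  let δ := kernel.lift (I.d s (s + 1)) (I.d (s - 1) s) (I.d_comp_d _ _ _)
  refine B.prop_of_iso (homologyIsoCokernelLift I (by lia) rfl).symm
    (h.right_cokernel δ (h.right_of_injective _) (hI s) ?_)
  have hδ : δ ≫ kernel.ι _ = I.d (s - 1) s := kernel.lift_ι _ _ _
  have hs : B (kernel (I.d (s - 1) s)) := by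
    have := hI (s - 1)
    rwa [sub_add_cancel] at this
  exact B.prop_of_iso ((kernelIsoOfEq hδ).symm ≪≫ kernelCompMono _ _) hs

variable [HasDerivedCategory.{w} (ModuleCat.{u} R)]

lemma left_cokernel (h : IsCompleteHereditaryCotorsionPair A B)
    {P : CochainComplex (ModuleCat.{u} R) ℤ} [P.IsKProjective] [∀ n, Projective (P.X n)]
    (hP : homologyIn A (Q.obj P)) (s : ℤ) : A (cokernel (P.d (s - 1) s)) := by
  have := h.isClosedUnderIsomorphisms_right
  exact h.left_of_forall_subsingleton_ext fun N hN =>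
    subsingleton_ext_cokernel_d_of_isKProjective
      (h.eq_zero_of_isGhost hP ((homologyIn_formalObj_iff B _).2 fun _ => hN)) (by lia)

lemma right_kernel (h : IsCompleteHereditaryCotorsionPair A B)
    {I : CochainComplex (ModuleCat.{u} R) ℤ} [I.IsKInjective] [∀ n, Injective (I.X n)]
    (hI : homologyIn B (Q.obj I)) (s : ℤ) : B (kernel (I.d s (s + 1))) := by
  have := h.isClosedUnderIsomorphisms_left
  exact h.right_of_forall_subsingleton_ext fun M hM =>
    subsingleton_ext_kernel_d_of_isKInjective
      (h.eq_zero_of_isGhost ((homologyIn_formalObj_iff A _).2 fun _ => hM) hI) rfl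

lemma projClass_eq (h : IsCompleteHereditaryCotorsionPair A B) : projClass A = homologyIn A := by
  have := h.isClosedUnderIsomorphisms_left
  ext X
  constructor
  · rintro ⟨K, P, f, ⟨e⟩, hP, hf, hA⟩
    have := ((isSemiProjective_iff P).1 hP).2
    exact (homologyIn A).prop_of_iso (asIso (Q.map f) ≪≫ e) fun s =>
      A.prop_of_iso (homologyQIso P s).symm (h.left_homology hA s)
  · intro hX
    obtain ⟨P, hP, hP', ⟨e⟩⟩ := hasProjectiveModel_of_enoughProjectives X
    exact ⟨P, P, 𝟙 P, ⟨e.symm⟩, (isSemiProjective_iff P).2 ⟨hP, hP'⟩, inferInstance,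
      h.left_cokernel ((homologyIn A).prop_of_iso e hX)⟩

lemma injClass_eq (h : IsCompleteHereditaryCotorsionPair A B) : injClass B = homologyIn B := by
  have := h.isClosedUnderIsomorphisms_right
  ext X
  constructor
  · rintro ⟨K, I, f, ⟨e⟩, hI, hf, hB⟩
    have := ((isSemiInjective_iff I).1 hI).2
    exact (homologyIn B).prop_of_iso ((asIso (Q.map f)).symm ≪≫ e) fun s =>
      B.prop_of_iso (homologyQIso I s).symm (h.right_homology hB s)
  · intro hX
    obtain ⟨I, hI, hI', ⟨e⟩⟩ := hasInjectiveModel_of_enoughInjectives X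
    exact ⟨I, I, 𝟙 I, ⟨e.symm⟩, (isSemiInjective_iff I).2 ⟨hI, hI'⟩, inferInstance,
      h.right_kernel ((homologyIn B).prop_of_iso e hX)⟩

end IsCompleteHereditaryCotorsionPair

section HomologyPerp

open DerivedCategory

variable {R : Type u} [Ring R] [HasDerivedCategory.{w} (ModuleCat.{u} R)]
  (A : ObjectProperty (ModuleCat.{u} R)) [A.IsClosedUnderIsomorphisms]

lemma xiRightPerp_homologyIn :
    xiRightPerp (ghostTriangles R) (homologyIn A) = homologyIn (rightPerp A) := by
  ext Y
  refine ⟨fun h s M hM => ?_, fun h X hX => (xiExtOneVanishes_iff X Y).2 fun s => h s _ (hX s)⟩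
  refine subsingleton_ext_of_retract (homologyFormalIso (fun _ => M) s).symm.retract (.refl _) ?_
  exact (xiExtOneVanishes_iff _ Y).1 (h _ ((homologyIn_formalObj_iff A _).2 fun _ => hM)) s

lemma xiLeftPerp_homologyIn :
    xiLeftPerp (ghostTriangles R) (homologyIn A) = homologyIn (leftPerp A) := by
  ext X
  refine ⟨fun h s N hN => ?_, fun h Y hY => (xiExtOneVanishes_iff X Y).2 fun s => h s _ (hY s)⟩
  refine subsingleton_ext_of_retract (.refl _) (homologyFormalIso (fun _ => N) s).symm.retract ?_
  exact (xiExtOneVanishes_iff X _).1 (h _ ((homologyIn_formalObj_iff A _).2 fun _ => hN)) s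

lemma ghostTriangles.homologyShortComplex_shortExact
    {t : Triangle (DerivedCategory (ModuleCat.{u} R))} (ht : ghostTriangles R t) (s : ℤ) :
    (homologyShortComplex ((ghostTriangles_iff t).1 ht).1 s).ShortExact :=
  _root_.homologyShortComplex_shortExact _ ((ghostTriangles_iff t).1 ht).2 s

end HomologyPerp

section Horseshoe

lemma shortExact_pullback {C : Type*} [Category* C] [Abelian C] {S : ShortComplex C}
    (hS : S.ShortExact) {Z : C} (z : Z ⟶ S.X₃) :
    (ShortComplex.mk (pullback.lift S.f 0 (by simp)) (pullback.snd S.g z)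
      (pullback.lift_snd _ _ _)).ShortExact := by
  have := hS.mono_f
  have := hS.epi_g
  have : Mono (pullback.lift S.f (0 : S.X₁ ⟶ Z) (by simp) : _ ⟶ pullback S.g z) :=
    mono_of_mono_fac (pullback.lift_fst _ _ _)
  refine .mk' (ShortComplex.exact_of_f_is_kernel _ (KernelFork.IsLimit.ofι' _ _ fun k hk => ?_))
    this inferInstance
  have hk' : (k ≫ pullback.fst S.g z) ≫ S.g = 0 := by
    rw [Category.assoc, pullback.condition, reassoc_of% hk, zero_comp]
  refine ⟨hS.exact.lift _ hk', pullback.hom_ext ?_ ?_⟩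
  · rw [Category.assoc, pullback.lift_fst, hS.exact.lift_f]
  · rw [Category.assoc, pullback.lift_snd, comp_zero, hk]

lemma IsCompleteHereditaryCotorsionPair.exists_extension_hom {R : Type u} [Ring R]
    {A B : ObjectProperty (ModuleCat.{u} R)} (h : IsCompleteHereditaryCotorsionPair A B)
    {X Y Z X' Z' : ModuleCat.{u} R} {f : X ⟶ Y} {g : Y ⟶ Z} {w : f ≫ g = 0}
    (hS : (ShortComplex.mk f g w).ShortExact) (hX' : B X') (a : X ⟶ X') (c : Z ⟶ Z') [Mono c]
    (hc : A (cokernel c)) :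
    ∃ (Y' : ModuleCat.{u} R) (i : X' ⟶ Y') (p : Y' ⟶ Z') (w : i ≫ p = 0) (b : Y ⟶ Y'),
      (ShortComplex.mk i p w).ShortExact ∧ f ≫ b = a ≫ i ∧ b ≫ p = g ≫ c := by
  let E : ShortComplex (ModuleCat.{u} R) :=
    ShortComplex.mk (Injective.ι X') (cokernel.π _) (cokernel.condition _)
  have hE : E.ShortExact := .mk' (ShortComplex.exact_cokernel _) inferInstance inferInstance
  have hE₃ : B E.X₃ := h.hereditary_right _ hE hX' (h.right_of_injective (Injective.under X'))
  have : Mono f := hS.mono_f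
  have hcS : (ShortComplex.mk c (cokernel.π c) (cokernel.condition c)).ShortExact :=
    .mk' (ShortComplex.exact_cokernel c) inferInstance inferInstance
  let e : Y ⟶ E.X₂ := Injective.factorThru (a ≫ Injective.ι X') f
  have he : f ≫ e = a ≫ E.f := Injective.comp_factorThru _ _
  have he' : f ≫ e ≫ E.g = 0 := by rw [reassoc_of% he, E.zero, comp_zero]
  have : Epi (ShortComplex.mk f g w).g := hS.epi_g
  obtain ⟨z, hz⟩ := exists_extension_of_subsingleton_ext hcS (h.subsingleton_ext hc hE₃)
    (hS.exact.desc _ he')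
  have hez : e ≫ E.g = (g ≫ c) ≫ z := by
    rw [Category.assoc]
    exact ((congrArg (g ≫ ·) hz).trans (hS.exact.g_desc _ he')).symm
  refine ⟨pullback E.g z, _, _, _, pullback.lift e (g ≫ c) hez, shortExact_pullback hE z,
    pullback.hom_ext ?_ ?_, pullback.lift_snd _ _ _⟩
  · rw [Category.assoc, Category.assoc, pullback.lift_fst, pullback.lift_fst, he]
  · rw [Category.assoc, Category.assoc, pullback.lift_snd, pullback.lift_snd, comp_zero,
      reassoc_of% w, zero_comp]

end Horseshoe

section CyclesFiltration

open HomologicalComplex (homologyMap cyclesMap)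

variable {C : Type*} [Category* C] [Abelian C] {L : CochainComplex C ℤ} {i j k : ℤ}
  {B Z H B' : C} {z : Z ⟶ L.X j}

lemma exists_cyclesIso_of_factorization (hjk : j + 1 = k) {q : L.X j ⟶ B'} {m : B' ⟶ L.X k}
    {w : z ≫ q = 0} [Mono m] (hq : q ≫ m = L.d j k)
    (hZ : (ShortComplex.mk z q w).ShortExact) :
    ∃ α : L.cycles j ≅ Z, α.hom ≫ z = L.iCycles j := by
  have := hZ.mono_f
  have hz : z ≫ L.d j k = 0 := by rw [← hq, reassoc_of% w, zero_comp]
  have hlim : IsLimit (KernelFork.ofι z hz) := KernelFork.IsLimit.ofι' _ _ fun x hx =>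
    ⟨hZ.exact.lift x ((cancel_mono m).1 (by
      rw [Category.assoc, hq, hx, zero_comp])), hZ.exact.lift_f _ _⟩
  exact ⟨(L.cyclesIsKernel j k (by simp [← hjk])).conePointUniqueUpToIso hlim,
    IsLimit.conePointUniqueUpToIso_hom_comp _ hlim .zero⟩

lemma exists_homologyIso_of_cyclesIso (hij : i + 1 = j) {p : L.X i ⟶ B} {b : B ⟶ Z} {π : Z ⟶ H}
    {w : b ≫ π = 0} [Epi p] [Mono z] (hp : p ≫ b ≫ z = L.d i j)
    (hB : (ShortComplex.mk b π w).ShortExact) (α : L.cycles j ≅ Z) (hα : α.hom ≫ z = L.iCycles j) :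
    ∃ e : L.homology j ≅ H, L.homologyπ j ≫ e.hom = α.hom ≫ π := by
  have := hB.epi_g
  have hb : L.toCycles i j ≫ α.hom = p ≫ b := by
    rw [← cancel_mono z, Category.assoc, Category.assoc, hα, HomologicalComplex.toCycles_i, hp]
  have hπ : L.toCycles i j ≫ α.hom ≫ π = 0 := by
    rw [reassoc_of% hb, w, comp_zero]
  have hcolim : IsColimit (CokernelCofork.ofπ (α.hom ≫ π) hπ) :=
    CokernelCofork.IsColimit.ofπ' _ _ fun x hx =>
    ⟨hB.exact.desc (α.inv ≫ x) ((cancel_epi p).1 (by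
      change p ≫ b ≫ α.inv ≫ x = _
      rw [← reassoc_of% hb, Iso.hom_inv_id_assoc, hx, comp_zero])), by
      rw [Category.assoc]
      exact (congrArg (α.hom ≫ ·) (hB.exact.g_desc _ _)).trans (α.hom_inv_id_assoc x)⟩
  have hcolim' := L.homologyIsCokernel i j (by simp [← hij])
  exact ⟨hcolim'.coconePointUniqueUpToIso hcolim,
    hcolim'.comp_coconePointUniqueUpToIso_hom hcolim .one⟩

lemma exists_homologyIso_of_factorization {K : CochainComplex C ℤ} (f : K ⟶ L)
    (hij : i + 1 = j) (hjk : j + 1 = k) {p : L.X i ⟶ B} {b : B ⟶ Z} {π : Z ⟶ H}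
    {q : L.X j ⟶ B'} {m : B' ⟶ L.X k} {wZ : z ≫ q = 0} {wB : b ≫ π = 0} [Epi p]
    [Mono m] (hp : p ≫ b ≫ z = L.d i j) (hq : q ≫ m = L.d j k)
    (hZ : (ShortComplex.mk z q wZ).ShortExact) (hB : (ShortComplex.mk b π wB).ShortExact)
    {ζ : K.cycles j ⟶ Z} {η : K.homology j ⟶ H} (hζ : ζ ≫ z = K.iCycles j ≫ f.f j)
    (hη : K.homologyπ j ≫ η = ζ ≫ π) :
    ∃ e : L.homology j ≅ H, homologyMap f j ≫ e.hom = η := by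
  have : Mono z := hZ.mono_f
  obtain ⟨α, hα⟩ := exists_cyclesIso_of_factorization hjk hq hZ
  obtain ⟨e, he⟩ := exists_homologyIso_of_cyclesIso hij hp hB α hα
  have hζ' : cyclesMap f j ≫ α.hom = ζ := by
    rw [← cancel_mono z, Category.assoc, hα, HomologicalComplex.cyclesMap_i, hζ]
  refine ⟨e, (cancel_epi (K.homologyπ j)).1 ?_⟩
  rw [HomologicalComplex.homologyπ_naturality_assoc, he, reassoc_of% hζ', hη]

lemma exists_hom_of_cyclesFiltration (K : CochainComplex C ℤ) {Y Z B H : ℤ → C}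
    {b : ∀ n, B n ⟶ Z n} {π : ∀ n, Z n ⟶ H n} {z : ∀ n, Z n ⟶ Y n} {q : ∀ n, Y n ⟶ B (n + 1)}
    {wB : ∀ n, b n ≫ π n = 0} {wZ : ∀ n, z n ≫ q n = 0}
    (hB : ∀ n, (ShortComplex.mk _ _ (wB n)).ShortExact)
    (hZ : ∀ n, (ShortComplex.mk _ _ (wZ n)).ShortExact)
    {φ : ∀ n, K.X n ⟶ Y n} {ζ : ∀ n, K.cycles n ⟶ Z n} {η : ∀ n, K.homology n ⟶ H n}
    (hφ : ∀ n, φ n ≫ q n ≫ b (n + 1) ≫ z (n + 1) = K.d n (n + 1) ≫ φ (n + 1))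
    (hζ : ∀ n, ζ n ≫ z n = K.iCycles n ≫ φ n) (hη : ∀ n, K.homologyπ n ≫ η n = ζ n ≫ π n) :
    ∃ (L : CochainComplex C ℤ) (f : K ⟶ L), ∀ n, ∃ e : L.homology n ≅ H n,
      homologyMap f n ≫ e.hom = η n := by
  let d (n : ℤ) : Y n ⟶ Y (n + 1) := q n ≫ b (n + 1) ≫ z (n + 1)
  let L : CochainComplex C ℤ := CochainComplex.of Y d fun n => by
    simp only [d, Category.assoc, reassoc_of% wZ, zero_comp, comp_zero]
  have hd (n : ℤ) : L.d n (n + 1) = d n := CochainComplex.of_d Y d n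
  let f : K ⟶ L :=
    { f := φ
      comm' := by
        rintro i _ rfl
        rw [hd]
        exact hφ i }
  refine ⟨L, f, fun n => ?_⟩
  obtain ⟨n, rfl⟩ : ∃ m, m + 1 = n := ⟨n - 1, by simp⟩
  have : Epi (q n) := (hZ n).epi_g
  have : Mono (b (n + 1 + 1) ≫ z (n + 1 + 1)) :=
    have : Mono (b (n + 1 + 1)) := (hB _).mono_f
    have : Mono (z (n + 1 + 1)) := (hZ _).mono_f
    mono_comp _ _
  exact exists_homologyIso_of_factorization f rfl rfl (hd n).symm (hd (n + 1)).symm (hZ (n + 1))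
    (hB (n + 1)) (hζ (n + 1)) (hη (n + 1))

end CyclesFiltration

section Completeness

open Abelian
open HomologicalComplex (homologyMap cyclesMap)

variable {C : Type*} [Category* C] [Abelian C]

lemma subsingleton_ext_of_shortExact_left [HasExt.{w} C] {S : ShortComplex C} (hS : S.ShortExact)
    {Y : C} (h₁ : Subsingleton (Ext S.X₁ Y 1)) (h₃ : Subsingleton (Ext S.X₃ Y 1)) :
    Subsingleton (Ext S.X₂ Y 1) := by
  refine subsingleton_of_forall_eq 0 fun x => ?_
  obtain ⟨y, rfl⟩ := Ext.contravariant_sequence_exact₂ hS Y x (Subsingleton.elim _ _)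
  rw [Subsingleton.elim y 0, Ext.comp_zero]

lemma subsingleton_ext_of_shortExact_right [HasExt.{w} C] {S : ShortComplex C} (hS : S.ShortExact)
    {X : C} (h₁ : Subsingleton (Ext X S.X₁ 1)) (h₃ : Subsingleton (Ext X S.X₃ 1)) :
    Subsingleton (Ext X S.X₂ 1) := by
  refine subsingleton_of_forall_eq 0 fun x => ?_
  obtain ⟨y, rfl⟩ := Ext.covariant_sequence_exact₂ X hS x (Subsingleton.elim _ _)
  rw [Subsingleton.elim y 0, Ext.zero_comp]

variable (K : CochainComplex C ℤ)

lemma shortExact_kernel_homologyπ (n : ℤ) :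
    (ShortComplex.mk (kernel.ι (K.homologyπ n)) (K.homologyπ n)
      (kernel.condition _)).ShortExact :=
  .mk' (ShortComplex.exact_kernel _) inferInstance inferInstance

lemma exists_shortExact_iCycles {m n : ℤ} (h : m + 1 = n) :
    ∃ (q : K.X m ⟶ kernel (K.homologyπ n)) (w : K.iCycles m ≫ q = 0),
      (ShortComplex.mk (K.iCycles m) q w).ShortExact ∧
        q ≫ kernel.ι (K.homologyπ n) ≫ K.iCycles n = K.d m n := by
  let q : K.X m ⟶ kernel (K.homologyπ n) :=
    kernel.lift _ (K.toCycles m n) (K.toCycles_comp_homologyπ m n)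
  have hq : q ≫ kernel.ι (K.homologyπ n) ≫ K.iCycles n = K.d m n := by
    rw [kernel.lift_ι_assoc, HomologicalComplex.toCycles_i]
  have hT : (ShortComplex.mk (K.toCycles m n) (K.homologyπ n)
    (K.toCycles_comp_homologyπ m n)).Exact := ShortComplex.exact_of_g_is_cokernel _
      (K.homologyIsCokernel m n (by simp [← h]))
  have : Epi q := (ShortComplex.exact_iff_epi_kernel_lift _).1 hT
  have w : K.iCycles m ≫ q = 0 := by
    rw [← cancel_mono (kernel.ι (K.homologyπ n) ≫ K.iCycles n), Category.assoc, hq,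
      HomologicalComplex.iCycles_d, zero_comp]
  refine ⟨q, w, .mk' (ShortComplex.exact_of_f_is_kernel _
    (KernelFork.IsLimit.ofι' _ _ fun x hx => ⟨K.liftCycles x n (by simp [← h]) ?_,
      K.liftCycles_i _ _ _ _⟩)) inferInstance this, hq⟩
  rw [← hq, reassoc_of% hx, zero_comp]

namespace IsCompleteHereditaryCotorsionPair

variable {R : Type u} [Ring R] {A B : ObjectProperty (ModuleCat.{u} R)}

lemma left_of_shortExact (h : IsCompleteHereditaryCotorsionPair A B)
    {S : ShortComplex (ModuleCat.{u} R)} (hS : S.ShortExact) (h₁ : A S.X₁) (h₃ : A S.X₃) :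
    A S.X₂ :=
  h.left_of_forall_subsingleton_ext fun _ hY =>
    subsingleton_ext_of_shortExact_left hS (h.subsingleton_ext h₁ hY) (h.subsingleton_ext h₃ hY)

lemma right_of_shortExact (h : IsCompleteHereditaryCotorsionPair A B)
    {S : ShortComplex (ModuleCat.{u} R)} (hS : S.ShortExact) (h₁ : B S.X₁) (h₃ : B S.X₃) :
    B S.X₂ :=
  h.right_of_forall_subsingleton_ext fun _ hX =>
    subsingleton_ext_of_shortExact_right hS (h.subsingleton_ext hX h₁) (h.subsingleton_ext hX h₃)

lemma exists_special_preenvelope (h : IsCompleteHereditaryCotorsionPair A B)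
    (M : ModuleCat.{u} R) :
    ∃ (Y : ModuleCat.{u} R) (r : M ⟶ Y), B Y ∧ Mono r ∧ A (cokernel r) := by
  have := h.isClosedUnderIsomorphisms_left
  obtain ⟨Y, X, i, p, w, hS, hX, hY⟩ := h.enough_right M
  have := hS.mono_f
  exact ⟨Y, i, hY, this, A.prop_of_iso
    (hS.gIsCokernel.coconePointUniqueUpToIso (colimit.isColimit _)) hX⟩

/-- A Cartan–Eilenberg construction: special preenvelopes of the boundaries and of the homology are
combined to embeddings of the cycles and then of the terms of the complex. -/
lemma exists_mono_homologyMap (h : IsCompleteHereditaryCotorsionPair A B)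
    (K : CochainComplex (ModuleCat.{u} R) ℤ) :
    ∃ (L : CochainComplex (ModuleCat.{u} R) ℤ) (f : K ⟶ L), ∀ n,
      B (L.homology n) ∧ Mono (homologyMap f n) ∧ A (cokernel (homologyMap f n)) := by
  have := h.isClosedUnderIsomorphisms_left
  have := h.isClosedUnderIsomorphisms_right
  choose Y r hY hr hr' using h.exists_special_preenvelope
  choose Z b π wB ζ hB hζb hζπ using fun n => h.exists_extension_hom
    (shortExact_kernel_homologyπ K n) (hY _) (r _) (r _) (hr' _)
  have hZ' (n : ℤ) : B (Z n) := h.right_of_shortExact (hB n) (hY _) (hY _)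
  choose q₀ w₀ hT hq₀ using fun n => exists_shortExact_iCycles K (m := n) rfl
  choose X z q wZ φ hZ hφz hφq using fun n => h.exists_extension_hom
    (hT n) (hZ' n) (ζ n) (r _) (hr' _)
  obtain ⟨L, f, hf⟩ := exists_hom_of_cyclesFiltration K hB hZ (φ := φ) (ζ := ζ)
    (η := fun n => r (K.homology n))
    (fun n => by
      rw [reassoc_of% hφq n, ← reassoc_of% hζb (n + 1), ← hφz (n + 1), reassoc_of% hq₀ n])
    (fun n => (hφz n).symm) fun n => (hζπ n).symm
  refine ⟨L, f, fun n => ?_⟩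
  obtain ⟨e, he⟩ := hf n
  have hf' : homologyMap f n = r (K.homology n) ≫ e.inv := by
    rw [← he, Category.assoc, e.hom_inv_id, Category.comp_id]
  have := hr (K.homology n)
  rw [hf']
  exact ⟨B.prop_of_iso e.symm (hY _), mono_comp _ _,
    A.prop_of_iso (cokernelCompIsIso _ _).symm (hr' _)⟩

end IsCompleteHereditaryCotorsionPair

end Completeness

section GhostCompleteness

open DerivedCategory
open HomologicalComplex (homologyMap)

variable {R : Type u} [Ring R] [HasDerivedCategory.{w} (ModuleCat.{u} R)]
  {A B : ObjectProperty (ModuleCat.{u} R)}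

namespace IsCompleteHereditaryCotorsionPair

lemma exists_ghostTriangle_preenvelope (h : IsCompleteHereditaryCotorsionPair A B)
    (X : DerivedCategory (ModuleCat.{u} R)) :
    ∃ (Y Z : DerivedCategory (ModuleCat.{u} R)) (f : X ⟶ Y) (g : Y ⟶ Z) (δ : Z ⟶ X⟦(1 : ℤ)⟧),
      ghostTriangles R (Triangle.mk f g δ) ∧ homologyIn A Z ∧ homologyIn B Y := by
  have := h.isClosedUnderIsomorphisms_left
  have := h.isClosedUnderIsomorphisms_right
  let K := Q.objPreimage X
  let e : X ≅ Q.obj K := (Q.objObjPreimageIso X).symm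
  obtain ⟨L, f, hf⟩ := h.exists_mono_homologyMap K
  let H := homologyFunctor (ModuleCat.{u} R)
  have hH (s : ℤ) : (H s).map (e.hom ≫ Q.map f) =
      (((H s).mapIso e ≪≫ homologyQIso K s).hom ≫ homologyMap f s) ≫ (homologyQIso L s).inv := by
    rw [Functor.map_comp, homologyFunctor_map_Q_map, Iso.trans_hom, Functor.mapIso_hom,
      Category.assoc, Category.assoc]
  have hmono (s : ℤ) : Mono ((H s).map (e.hom ≫ Q.map f)) := by
    have := (hf s).2.1
    rw [hH]
    infer_instance
  obtain ⟨Z, g, δ, ht⟩ := distinguished_cocone_triangle (e.hom ≫ Q.map f)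
  have ht' : ghostTriangles R (Triangle.mk (e.hom ≫ Q.map f) g δ) :=
    (ghostTriangles_iff _).2 ⟨ht, (mono_homology_mor₁_iff_isGhost ht).1 hmono⟩
  refine ⟨Q.obj L, Z, _, g, δ, ht', fun s => ?_, fun s => B.prop_of_iso (homologyQIso L s).symm
    (hf s).1⟩
  let eH : cokernel ((H s).map (e.hom ≫ Q.map f)) ≅ cokernel (homologyMap f s) :=
    cokernelIsoOfEq (hH s) ≪≫ cokernelCompIsIso _ _ ≪≫ cokernelEpiComp _ _
  let eZ : cokernel ((H s).map (e.hom ≫ Q.map f)) ≅ (H s).obj Z :=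
    (colimit.isColimit _).coconePointUniqueUpToIso
      (ghostTriangles.homologyShortComplex_shortExact ht' s).gIsCokernel
  exact A.prop_of_iso (eH.symm ≪≫ eZ) (hf s).2.2

/-- Salce's trick: the connecting map of a ghost presentation of `X` by a homology-free object is
pushed forward along a preenvelope of the syzygy. -/
lemma exists_ghostTriangle_precover (h : IsCompleteHereditaryCotorsionPair A B)
    (X : DerivedCategory (ModuleCat.{u} R)) :
    ∃ (Y Z : DerivedCategory (ModuleCat.{u} R)) (f : Y ⟶ Z) (g : Z ⟶ X) (δ : X ⟶ Y⟦(1 : ℤ)⟧),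
      ghostTriangles R (Triangle.mk f g δ) ∧ homologyIn A Z ∧ homologyIn B Y := by
  obtain ⟨K, P, i, p, δ, ht, hP⟩ := exists_ghostTriangle_isHomologyFree X
  obtain ⟨Y, W, j, q, ε, ht', hW, hY⟩ := h.exists_ghostTriangle_preenvelope K
  rw [ghostTriangles_iff] at ht ht'
  obtain ⟨Z, f, g, hZ⟩ := distinguished_cocone_triangle₂ (δ ≫ (-j⟦(1 : ℤ)⟧'))
  let o := Triangulated.someOctahedron' rfl (rot_of_distTriang _ ht.1)
    (rot_of_distTriang _ (rot_of_distTriang _ ht'.1)) (rot_of_distTriang _ hZ)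
  have ho : ghostTriangles R o.triangle := (ghostTriangles_iff _).2 ⟨o.mem, ht'.2.comp_right _⟩
  refine ⟨Y, Z, f, g, _, (ghostTriangles_iff _).2 ⟨hZ, ht.2.comp_right _⟩, fun s => ?_, hY⟩
  have := hP.projective s
  exact h.left_of_shortExact (ghostTriangles.homologyShortComplex_shortExact ho s)
    (h.left_of_projective ((homologyFunctor _ s).obj P)) (hW s)

theorem isXiCompleteHereditaryCotorsionPair (h : IsCompleteHereditaryCotorsionPair A B) :
    IsXiCompleteHereditaryCotorsionPair (ghostTriangles R) (projClass A) (injClass B) := by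
  have := h.isClosedUnderIsomorphisms_left
  have := h.isClosedUnderIsomorphisms_right
  rw [h.projClass_eq, h.injClass_eq]
  exact {
    rightPerp_eq := by rw [xiRightPerp_homologyIn, h.rightPerp_eq]
    leftPerp_eq := by rw [xiLeftPerp_homologyIn, h.leftPerp_eq]
    enough_left := h.exists_ghostTriangle_precover
    enough_right := h.exists_ghostTriangle_preenvelope
    hereditary_left _ ht h₂ h₃ s :=
      h.hereditary_left _ (ghostTriangles.homologyShortComplex_shortExact ht s) (h₂ s) (h₃ s)
    hereditary_right _ ht h₁ h₂ s :=
      h.hereditary_right _ (ghostTriangles.homologyShortComplex_shortExact ht s) (h₁ s) (h₂ s) }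

end IsCompleteHereditaryCotorsionPair

end GhostCompleteness

section Stalks

open DerivedCategory

variable {C : Type*} [Category* C] [Abelian C] [HasDerivedCategory.{w} C]

lemma isZero_homology_singleFunctor_obj (X : C) {n s : ℤ} (hs : s ≠ n) :
    IsZero ((homologyFunctor C s).obj ((singleFunctor C n).obj X)) := by
  rcases lt_or_gt_of_ne hs with h | h
  · exact isZero_of_isGE _ n s h
  · exact isZero_of_isLE _ n s h

lemma mono_homologyMap_singleFunctor_map {X Y : C} (f : X ⟶ Y) [Mono f] (n s : ℤ) :
    Mono ((homologyFunctor C s).map ((singleFunctor C n).map f)) := by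
  rcases eq_or_ne s n with rfl | hs
  · exact ((MorphismProperty.monomorphisms C).arrow_mk_iso_iff
      (((Functor.mapArrowFunctor _ _).mapIso (singleFunctorCompHomologyFunctorIso C s)).app
        (Arrow.mk f))).2 ‹_›
  · exact (isZero_homology_singleFunctor_obj X hs).mono _

variable {R : Type u} [Ring R] [HasDerivedCategory.{w} (ModuleCat.{u} R)]

lemma ghostTriangles_singleTriangle {S : ShortComplex (ModuleCat.{u} R)} (hS : S.ShortExact) :
    ghostTriangles R hS.singleTriangle :=
  have := hS.mono_f
  (ghostTriangles_iff _).2 ⟨hS.singleTriangle_distinguished,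
    (mono_homology_mor₁_iff_isGhost hS.singleTriangle_distinguished).1
      (mono_homologyMap_singleFunctor_map S.f 0)⟩

lemma xiExtOneVanishes_singleFunctor_left_iff (M : ModuleCat.{u} R) (n : ℤ)
    (Y : DerivedCategory (ModuleCat.{u} R)) :
    XiExtOneVanishes (ghostTriangles R) ((singleFunctor _ n).obj M) Y ↔
      Subsingleton (Abelian.Ext M ((homologyFunctor _ n).obj Y) 1) := by
  let e := (singleFunctorCompHomologyFunctorIso (ModuleCat.{u} R) n).app M
  rw [xiExtOneVanishes_iff]
  refine ⟨fun h => subsingleton_ext_of_retract e.symm.retract (.refl _) (h n), fun h s => ?_⟩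
  rcases eq_or_ne s n with rfl | hs
  · exact subsingleton_ext_of_retract e.retract (.refl _) h
  · have := (isZero_homology_singleFunctor_obj M hs).projective
    exact Abelian.Ext.subsingleton_of_projective _ _ _

lemma xiExtOneVanishes_singleFunctor_right_iff (X : DerivedCategory (ModuleCat.{u} R))
    (N : ModuleCat.{u} R) (n : ℤ) :
    XiExtOneVanishes (ghostTriangles R) X ((singleFunctor _ n).obj N) ↔
      Subsingleton (Abelian.Ext ((homologyFunctor _ n).obj X) N 1) := by
  let e := (singleFunctorCompHomologyFunctorIso (ModuleCat.{u} R) n).app N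
  rw [xiExtOneVanishes_iff]
  refine ⟨fun h => subsingleton_ext_of_retract (.refl _) e.symm.retract (h n), fun h s => ?_⟩
  rcases eq_or_ne s n with rfl | hs
  · exact subsingleton_ext_of_retract (.refl _) e.retract h
  · have := (isZero_homology_singleFunctor_obj N hs).injective
    exact Abelian.Ext.subsingleton_of_injective _ _ _

end Stalks

namespace IsXiCompleteHereditaryCotorsionPair

open DerivedCategory

variable {R : Type u} [Ring R] [HasDerivedCategory.{w} (ModuleCat.{u} R)]
  {𝒜 ℬ : ObjectProperty (DerivedCategory (ModuleCat.{u} R))}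

lemma left_iff (H : IsXiCompleteHereditaryCotorsionPair (ghostTriangles R) 𝒜 ℬ)
    (X : DerivedCategory (ModuleCat.{u} R)) :
    𝒜 X ↔ ∀ Y, ℬ Y → XiExtOneVanishes (ghostTriangles R) X Y := by
  conv_lhs => rw [← H.leftPerp_eq]
  rfl

lemma right_iff (H : IsXiCompleteHereditaryCotorsionPair (ghostTriangles R) 𝒜 ℬ)
    (Y : DerivedCategory (ModuleCat.{u} R)) :
    ℬ Y ↔ ∀ X, 𝒜 X → XiExtOneVanishes (ghostTriangles R) X Y := by
  conv_lhs => rw [← H.rightPerp_eq]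
  rfl

lemma left_singleFunctor_iff (H : IsXiCompleteHereditaryCotorsionPair (ghostTriangles R) 𝒜 ℬ)
    (M : ModuleCat.{u} R) (n : ℤ) :
    𝒜 ((singleFunctor _ n).obj M) ↔
      ∀ Y, ℬ Y → Subsingleton (Abelian.Ext M ((homologyFunctor _ n).obj Y) 1) := by
  simp only [H.left_iff, xiExtOneVanishes_singleFunctor_left_iff]

lemma right_singleFunctor_iff (H : IsXiCompleteHereditaryCotorsionPair (ghostTriangles R) 𝒜 ℬ)
    (N : ModuleCat.{u} R) (n : ℤ) :
    ℬ ((singleFunctor _ n).obj N) ↔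
      ∀ X, 𝒜 X → Subsingleton (Abelian.Ext ((homologyFunctor _ n).obj X) N 1) := by
  simp only [H.right_iff, xiExtOneVanishes_singleFunctor_right_iff]

lemma left_singleFunctor_homology
    (H : IsXiCompleteHereditaryCotorsionPair (ghostTriangles R) 𝒜 ℬ)
    {X : DerivedCategory (ModuleCat.{u} R)} (hX : 𝒜 X) (n : ℤ) :
    𝒜 ((singleFunctor _ n).obj ((homologyFunctor _ n).obj X)) :=
  (H.left_singleFunctor_iff _ n).2 fun Y hY =>
    (xiExtOneVanishes_iff X Y).1 ((H.left_iff X).1 hX Y hY) n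

lemma right_singleFunctor_homology
    (H : IsXiCompleteHereditaryCotorsionPair (ghostTriangles R) 𝒜 ℬ)
    {Y : DerivedCategory (ModuleCat.{u} R)} (hY : ℬ Y) (n : ℤ) :
    ℬ ((singleFunctor _ n).obj ((homologyFunctor _ n).obj Y)) :=
  (H.right_singleFunctor_iff _ n).2 fun X hX =>
    (xiExtOneVanishes_iff X Y).1 ((H.left_iff X).1 hX Y hY) n

theorem isCompleteHereditaryCotorsionPair_singleFunctor
    (H : IsXiCompleteHereditaryCotorsionPair (ghostTriangles R) 𝒜 ℬ) :
    IsCompleteHereditaryCotorsionPair (𝒜.inverseImage (singleFunctor (ModuleCat.{u} R) 0))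
      (ℬ.inverseImage (singleFunctor (ModuleCat.{u} R) 0)) where
  rightPerp_eq := by
    ext N
    refine ⟨fun h => (H.right_singleFunctor_iff N 0).2 fun X hX =>
      h _ (H.left_singleFunctor_homology hX 0), fun hN M hM => ?_⟩
    exact subsingleton_ext_of_retract (.refl _)
      ((singleFunctorCompHomologyFunctorIso _ 0).symm.app N).retract
      ((H.left_singleFunctor_iff M 0).1 hM _ hN)
  leftPerp_eq := by
    ext M
    refine ⟨fun h => (H.left_singleFunctor_iff M 0).2 fun Y hY =>
      h _ (H.right_singleFunctor_homology hY 0), fun hM N hN => ?_⟩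
    exact subsingleton_ext_of_retract (.refl _)
      ((singleFunctorCompHomologyFunctorIso _ 0).symm.app N).retract
      ((H.left_singleFunctor_iff M 0).1 hM _ hN)
  enough_left M := by
    obtain ⟨Y, X, f, g, δ, ht, hX, hY⟩ := H.enough_left ((singleFunctor _ 0).obj M)
    let S := homologyShortComplex ((ghostTriangles_iff _).1 ht).1 0
    let e : S.X₃ ≅ M := (singleFunctorCompHomologyFunctorIso (ModuleCat.{u} R) 0).app M
    have hS : S.ShortExact := ghostTriangles.homologyShortComplex_shortExact ht 0
    refine ⟨S.X₁, S.X₂, S.f, S.g ≫ e.hom, by rw [← Category.assoc, S.zero, zero_comp], ?_,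
      H.left_singleFunctor_homology hX 0, H.right_singleFunctor_homology hY 0⟩
    exact ShortComplex.shortExact_of_iso (S₁ := S) (ShortComplex.isoMk (.refl _) (.refl _) e) hS
  enough_right M := by
    obtain ⟨Y, X, f, g, δ, ht, hX, hY⟩ := H.enough_right ((singleFunctor _ 0).obj M)
    let S := homologyShortComplex ((ghostTriangles_iff _).1 ht).1 0
    let e : S.X₁ ≅ M := (singleFunctorCompHomologyFunctorIso (ModuleCat.{u} R) 0).app M
    have hS : S.ShortExact := ghostTriangles.homologyShortComplex_shortExact ht 0
    refine ⟨S.X₂, S.X₃, e.inv ≫ S.f, S.g, by rw [Category.assoc, S.zero, comp_zero], ?_,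
      H.left_singleFunctor_homology hX 0, H.right_singleFunctor_homology hY 0⟩
    exact ShortComplex.shortExact_of_iso (S₁ := S) (ShortComplex.isoMk e (.refl _) (.refl _)
      ((e.hom_inv_id_assoc _).trans (Category.comp_id _).symm)) hS
  hereditary_left _ hS := H.hereditary_left _ (ghostTriangles_singleTriangle hS)
  hereditary_right _ hS := H.hereditary_right _ (ghostTriangles_singleTriangle hS)

end IsXiCompleteHereditaryCotorsionPair

section Opcycles

variable {C : Type*} [Category* C] [Abelian C]

/-- The opcycles in degree `s` as a cokernel. -/
noncomputable def opcyclesIsoCokernel (K : CochainComplex C ℤ) {r s : ℤ} (hrs : r + 1 = s) :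
    K.opcycles s ≅ cokernel (K.d r s) :=
  (K.opcyclesIsCokernel r s (by simp [← hrs])).coconePointUniqueUpToIso (colimit.isColimit _)

/-- The cycles in degree `s` as a kernel. -/
noncomputable def cyclesIsoKernel (K : CochainComplex C ℤ) {s t : ℤ} (hst : s + 1 = t) :
    K.cycles s ≅ kernel (K.d s t) :=
  (K.cyclesIsKernel s t (by simp [hst])).conePointUniqueUpToIso (limit.isLimit _)

end Opcycles

section Presentation

open DerivedCategory
open HomologicalComplex (homologyMap opcyclesMap cyclesMap)

variable {R : Type u} [Ring R] [HasDerivedCategory.{w} (ModuleCat.{u} R)]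
  {A B : ObjectProperty (ModuleCat.{u} R)}

/-- The differential of `K` out of degree `s` being zero, the homology `H^s` of `K` is all of its
opcycles, so that it splits off the opcycles of any semi-projective resolution. -/
lemma prop_homology_of_projClass [A.IsStableUnderRetracts] {K : CochainComplex (ModuleCat.{u} R) ℤ}
    (hK : projClass A (Q.obj K)) {s : ℤ} (hs : K.d s (s + 1) = 0) : A (K.homology s) := by
  obtain ⟨L, P, f, ⟨e⟩, hP, hf, hA⟩ := hK
  have := hP.isKProjective
  obtain ⟨g, hg⟩ := exists_Q_map_eq_of_isKProjective P K (Q.map f ≫ e.hom)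
  have : QuasiIso g := (isIso_Q_map_iff_quasiIso _ _).1 (by rw [hg]; infer_instance)
  have := K.isIso_homologyι s (s + 1) (by simp) hs
  have r : Retract (K.homology s) (P.opcycles s) :=
    { i := inv (homologyMap g s) ≫ P.homologyι s
      r := opcyclesMap g s ≫ inv (K.homologyι s)
      retract := by
        rw [Category.assoc, ← HomologicalComplex.homologyι_naturality_assoc, IsIso.inv_hom_id_assoc,
          IsIso.hom_inv_id] }
  exact A.prop_of_retract r (A.prop_of_iso (opcyclesIsoCokernel P (by lia)).symm (hA s))

lemma prop_homology_of_injClass [B.IsStableUnderRetracts] {K : CochainComplex (ModuleCat.{u} R) ℤ}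
    (hK : injClass B (Q.obj K)) {s : ℤ} (hs : K.d (s - 1) s = 0) : B (K.homology s) := by
  obtain ⟨L, I, f, ⟨e⟩, hI, hf, hB⟩ := hK
  have := hI.isKInjective
  obtain ⟨g, hg⟩ := exists_Q_map_eq_of_isKInjective K I (e.inv ≫ Q.map f)
  have : QuasiIso g := (isIso_Q_map_iff_quasiIso _ _).1 (by rw [hg]; infer_instance)
  have := K.isIso_homologyπ (s - 1) s (by simp) hs
  have r : Retract (K.homology s) (I.cycles s) :=
    { i := inv (K.homologyπ s) ≫ cyclesMap g s
      r := I.homologyπ s ≫ inv (homologyMap g s)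
      retract := by
        rw [Category.assoc, ← HomologicalComplex.homologyπ_naturality_assoc, IsIso.hom_inv_id,
          Category.comp_id, IsIso.inv_hom_id] }
  exact B.prop_of_retract r (B.prop_of_iso (cyclesIsoKernel I rfl).symm (hB s))

lemma prop_of_projClass_singleFunctor [A.IsStableUnderRetracts] {M : ModuleCat.{u} R} {n : ℤ}
    (hM : projClass A ((singleFunctor _ n).obj M)) : A M :=
  let K := (CochainComplex.singleFunctor (ModuleCat.{u} R) n).obj M
  A.prop_of_iso (HomologicalComplex.singleObjHomologySelfIso _ n M)
    (prop_homology_of_projClass (K := K) hM (by simp [K, CochainComplex.singleFunctor]))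

lemma prop_of_injClass_singleFunctor [B.IsStableUnderRetracts] {N : ModuleCat.{u} R} {n : ℤ}
    (hN : injClass B ((singleFunctor _ n).obj N)) : B N :=
  let K := (CochainComplex.singleFunctor (ModuleCat.{u} R) n).obj N
  B.prop_of_iso (HomologicalComplex.singleObjHomologySelfIso _ n N)
    (prop_homology_of_injClass (K := K) hN (by simp [K, CochainComplex.singleFunctor]))

end Presentation

section TwoTerm

open DerivedCategory
open HomologicalComplex (double doubleXIso₀ doubleXIso₁ double_d isZero_double_X
  double_d_eq_zero₀ double_d_eq_zero₁)

section

variable {C : Type*} [Category* C] [Abelian C] {X Y : C} (d : X ⟶ Y) {i j : ℤ}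
  (hij : (ComplexShape.up ℤ).Rel i j)

lemma projective_double_X [Projective X] [Projective Y] (n : ℤ) :
    Projective ((double d hij).X n) := by
  by_cases hi : n = i
  · subst hi
    exact Projective.of_iso (doubleXIso₀ d hij).symm ‹_›
  by_cases hj : n = j
  · subst hj
    exact Projective.of_iso (doubleXIso₁ d hij (Ne.symm hi)).symm ‹_›
  · exact (isZero_double_X d hij n hi hj).projective

lemma injective_double_X [Injective X] [Injective Y] (n : ℤ) :
    Injective ((double d hij).X n) := by
  by_cases hi : n = i
  · subst hi
    exact Injective.of_iso (doubleXIso₀ d hij).symm ‹_›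
  by_cases hj : n = j
  · subst hj
    exact Injective.of_iso (doubleXIso₁ d hij (Ne.symm hi)).symm ‹_›
  · exact (isZero_double_X d hij n hi hj).injective

/-- The last cokernel of the two-term complex `X ⟶ Y`. -/
noncomputable def cokernelDoubleIso : cokernel ((double d hij).d i j) ≅ cokernel d :=
  have hne : i ≠ j := by rw [ComplexShape.up_Rel] at hij; lia
  cokernel.mapIso _ d (doubleXIso₀ d hij) (doubleXIso₁ d hij hne) (by
    rw [double_d _ hij hne, Category.assoc, Category.assoc, Iso.inv_hom_id, Category.comp_id])

/-- The first kernel of the two-term complex `X ⟶ Y`. -/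
noncomputable def kernelDoubleIso : kernel ((double d hij).d i j) ≅ kernel d :=
  have hne : i ≠ j := by rw [ComplexShape.up_Rel] at hij; lia
  kernel.mapIso _ d (doubleXIso₀ d hij) (doubleXIso₁ d hij hne) (by
    rw [double_d _ hij hne, Category.assoc, Category.assoc, Iso.inv_hom_id, Category.comp_id])

end

variable {R : Type u} [Ring R] {A B : ObjectProperty (ModuleCat.{u} R)}
  {X Y : ModuleCat.{u} R} (d : X ⟶ Y) {i j : ℤ} (hij : (ComplexShape.up ℤ).Rel i j)

lemma isSemiProjective_double [Projective X] [Projective Y] :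
    IsSemiProjective (double d hij) := by
  have hX := projective_double_X d hij
  have : CochainComplex.IsStrictlyLE (double d hij) j :=
    (CochainComplex.isStrictlyLE_iff _ _).2 fun n hn =>
      isZero_double_X d hij n (by rw [ComplexShape.up_Rel] at hij; lia) (by lia)
  exact (isSemiProjective_iff _).2 ⟨CochainComplex.isKProjective_of_projective _ j, hX⟩

lemma isSemiInjective_double [Injective X] [Injective Y] :
    IsSemiInjective (double d hij) := by
  have hX := injective_double_X d hij
  have : CochainComplex.IsStrictlyGE (double d hij) i :=
    (CochainComplex.isStrictlyGE_iff _ _).2 fun n hn =>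
      isZero_double_X d hij n (by lia) (by rw [ComplexShape.up_Rel] at hij; lia)
  exact (isSemiInjective_iff _).2 ⟨CochainComplex.isKInjective_of_injective _ i, hX⟩

variable [HasDerivedCategory.{w} (ModuleCat.{u} R)]

lemma projClass_double [A.IsClosedUnderIsomorphisms] (hA : ∀ P, Projective P → A P)
    [Projective X] [Projective Y] (hd : A (cokernel d)) : projClass A (Q.obj (double d hij)) := by
  refine ⟨_, _, 𝟙 _, ⟨.refl _⟩, isSemiProjective_double d hij, inferInstance, fun s => ?_⟩
  by_cases hs : s = j
  · subst hs
    obtain rfl : i = s - 1 := by rw [ComplexShape.up_Rel] at hij; lia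
    exact A.prop_of_iso (cokernelDoubleIso d hij).symm hd
  · exact A.prop_of_iso (cokernelIsoOfEq (double_d_eq_zero₁ _ _ _ _ hs) ≪≫
      cokernelZeroIsoTarget).symm (hA _ (projective_double_X d hij s))

lemma injClass_double [B.IsClosedUnderIsomorphisms] (hB : ∀ I, Injective I → B I)
    [Injective X] [Injective Y] (hd : B (kernel d)) : injClass B (Q.obj (double d hij)) := by
  refine ⟨_, _, 𝟙 _, ⟨.refl _⟩, isSemiInjective_double d hij, inferInstance, fun s => ?_⟩
  by_cases hs : s = i
  · subst hs
    obtain rfl : j = s + 1 := by rw [ComplexShape.up_Rel] at hij; lia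
    exact B.prop_of_iso (kernelDoubleIso d hij).symm hd
  · exact B.prop_of_iso (kernelIsoOfEq (double_d_eq_zero₀ _ _ _ _ hs) ≪≫
      kernelZeroIsoSource).symm (hB _ (injective_double_X d hij s))

lemma exists_projClass_homology_iso [A.IsClosedUnderIsomorphisms] (hA : ∀ P, Projective P → A P)
    {M : ModuleCat.{u} R} (hM : A M) (n : ℤ) :
    ∃ V, projClass A V ∧ Nonempty ((homologyFunctor _ n).obj V ≅ M) := by
  have hn : (ComplexShape.up ℤ).Rel (n - 1) n := by simp
  let d := Projective.d (Projective.π M)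
  let K := double d hn
  let e : cokernel d ≅ M := (cokernelIsCokernel _).coconePointUniqueUpToIso
    (exact_d_f (Projective.π M)).gIsCokernel
  exact ⟨Q.obj K, projClass_double d hn hA (A.prop_of_iso e.symm hM), ⟨homologyQIso K n ≪≫
    K.isoHomologyι n (n + 1) (by simp) (double_d_eq_zero₀ _ _ _ _ (by lia)) ≪≫
      opcyclesIsoCokernel K (by lia) ≪≫ cokernelDoubleIso d hn ≪≫ e⟩⟩

lemma exists_injClass_homology_iso [B.IsClosedUnderIsomorphisms] (hB : ∀ I, Injective I → B I)
    {N : ModuleCat.{u} R} (hN : B N) (n : ℤ) :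
    ∃ V, injClass B V ∧ Nonempty ((homologyFunctor _ n).obj V ≅ N) := by
  have hn : (ComplexShape.up ℤ).Rel n (n + 1) := by simp
  let d := Injective.d (Injective.ι N)
  let K := double d hn
  let e : kernel d ≅ N := (kernelIsKernel _).conePointUniqueUpToIso
    (exact_f_d (Injective.ι N)).fIsKernel
  exact ⟨Q.obj K, injClass_double d hn hB (B.prop_of_iso e.symm hN), ⟨homologyQIso K n ≪≫
    (K.isoHomologyπ (n - 1) n (by simp) (double_d_eq_zero₀ _ _ _ _ (by simp))).symm ≪≫
      cyclesIsoKernel K rfl ≪≫ kernelDoubleIso d hn ≪≫ e⟩⟩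

theorem IsXiCompleteHereditaryCotorsionPair.isCompleteHereditaryCotorsionPair
    [A.IsStableUnderRetracts] [B.IsStableUnderRetracts]
    (H : IsXiCompleteHereditaryCotorsionPair (ghostTriangles R) (projClass A) (injClass B)) :
    IsCompleteHereditaryCotorsionPair A B := by
  have h := H.isCompleteHereditaryCotorsionPair_singleFunctor
  have := h.isClosedUnderIsomorphisms_left
  have := h.isClosedUnderIsomorphisms_right
  have hA : (projClass A).inverseImage (singleFunctor _ 0) = A := by
    refine le_antisymm (fun M => prop_of_projClass_singleFunctor) fun M hM => ?_
    obtain ⟨V, hV, ⟨e⟩⟩ := exists_projClass_homology_iso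
      (fun P _ => prop_of_projClass_singleFunctor (h.left_of_projective P)) hM 0
    exact ObjectProperty.prop_of_iso _ e (H.left_singleFunctor_homology hV 0)
  have hB : (injClass B).inverseImage (singleFunctor _ 0) = B := by
    refine le_antisymm (fun N => prop_of_injClass_singleFunctor) fun N hN => ?_
    obtain ⟨V, hV, ⟨e⟩⟩ := exists_injClass_homology_iso
      (fun I _ => prop_of_injClass_singleFunctor (h.right_of_injective I)) hN 0
    exact ObjectProperty.prop_of_iso _ e (H.right_singleFunctor_homology hV 0)
  rwa [hA, hB] at h

end TwoTerm

theorem theorem2p5 {R : Type u} [Ring R] [HasDerivedCategory.{w} (ModuleCat.{u} R)]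
    (A B : ObjectProperty (ModuleCat.{u} R))
    [A.IsStableUnderRetracts] [B.IsStableUnderRetracts] :
    IsCompleteHereditaryCotorsionPair A B ↔
      IsXiCompleteHereditaryCotorsionPair (ghostTriangles R) (projClass A) (injClass B) :=
  ⟨fun h => h.isXiCompleteHereditaryCotorsionPair, fun H => H.isCompleteHereditaryCotorsionPair⟩
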